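/- Let $(E,\Phi,\Delta)$ be an irreducible reduced crystallographic root system $\Phi$ in a real vector space $E$ with a base $\Delta$, not of type $F_4$ or $G_2$. Let $P$ be its weight lattice, $W$ its Weyl group, $\epsilon$ the sign character of $W$, $\omega_\beta$ ($\beta\in\Delta$) the fundamental weights and $\rho=\sum_{\beta\in\Delta}\omega_\beta$. Write a weight as $\lambda=\sum_{\beta\in\Delta}m_\beta(\lambda)\,\omega_\beta$, let $d(\lambda)=\gcd\{m_\beta(\lambda):\beta\in\Delta\}$, and let $m(\Phi)$ be the ratio of the squared length of a long root to that of a short root ($m(\Phi)=1$ if $\Phi$ is simply laced). For a commutative ring $\mathcal O$ let $S(\lambda)=\sum_{w\in W}\epsilon(w)e^{w\lambda}\in\mathcal O[P]$, and let $C(\lambda,d)=S(\lambda)/S(d\rho)$ whenever $S(d\rho)$ divides $S(\lambda)$ in $\mathcal O[P]$. Let $\mu\in P$ be a dominant regular weight ($m_\beta(\mu)>0$ for all $\beta\in\Delta$), let $\alpha\in\Delta$, let $c$ be a positive integer and let $\eta=\mu+c\,\omega_\alpha$. If $\Phi$ is not simply laced, assume that $\alpha$ is a corner (an end vertex) of the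 Dynkin diagram. Let $\mathcal O$ be an integral domain of characteristic zero in which no rational prime $p\le 2\,m(\Phi)\sum_{\beta\in\Delta}m_\beta(\mu)$ is a unit. Let $d,e$ be natural numbers with $d\mid e$, $e\ne d$ and $e\mid d(\mu)$. Suppose that there are non-unit elements $U,V\in\mathcal O[P]^W$ such that (i) $UV=C(\mu,d)$; (ii) $V$ divides $C(e\rho,d)$; (iii) there are $X,Y\in\mathcal O[P]$ with $UX+VY=C(\eta,d)$. Then: (1) if $\Phi$ is simply laced or $\alpha$ is a short root, then $\gcd(e,c)>d$; (2) if $\Phi$ is not simply laced and $\alpha$ is a long root, then $\gcd(e,m(\Phi)c)>d$. -/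

import Mathlib

open scoped BigOperators

noncomputable section

namespace RootPairing

variable {ι M N : Type*} [AddCommGroup M] [Module ℝ M] [AddCommGroup N] [Module ℝ N]

/-- The lattice `P` of integral weights of a root system: the vectors on which all coroots take
integral values. -/
def weightLattice (R : RootPairing ι ℝ M N) : AddSubgroup M where
  carrier := {x | ∀ i, ∃ n : ℤ, R.coroot' i x = n}
  zero_mem' i := ⟨0, by simp⟩
  add_mem' {x y} hx hy i := by
    obtain ⟨m, hm⟩ := hx i
    obtain ⟨n, hn⟩ := hy i
    exact ⟨m + n, by simp only [map_add, hm, hn, Int.cast_add]⟩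
  neg_mem' {x} hx i := by
    obtain ⟨m, hm⟩ := hx i
    exact ⟨-m, by simp only [map_neg, hm, Int.cast_neg]⟩

/-- The integer `m_i(x) = ⟨αᵢ*, x⟩` for a weight `x`, where `αᵢ*` is the `i`-th coroot. -/
def weightCoeff (R : RootPairing ι ℝ M N) (i : ι) (x : R.weightLattice) : ℤ :=
  (x.2 i).choose

lemma weightCoeff_spec (R : RootPairing ι ℝ M N) (i : ι) (x : R.weightLattice) :
    R.coroot' i (x : M) = R.weightCoeff i x :=
  (x.2 i).choose_spec

lemma smul_mem_weightLattice (R : RootPairing ι ℝ M N) [R.IsCrystallographic]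
    (w : R.weylGroup) (x : M) (hx : x ∈ R.weightLattice) : w • x ∈ R.weightLattice := by
  obtain ⟨w, hw⟩ := w
  induction hw using weylGroup.induction generalizing x with
  | mem j =>
    intro i
    obtain ⟨m, hm⟩ := hx i
    obtain ⟨n, hn⟩ := hx j
    obtain ⟨k, hk⟩ := R.exists_value (S := ℤ) j i
    refine ⟨m - n * k, ?_⟩
    change R.coroot' i (R.reflection j x) = _
    rw [R.reflection_apply, map_sub, map_smul, hm, hn, R.root_coroot'_eq_pairing, ← hk]
    simp
  | one => simpa using hx
  | mul g₁ g₂ h₁ h₂ ih₁ ih₂ =>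
    rw [← Submonoid.mk_mul_mk _ _ _ h₁ h₂, mul_smul]
    exact ih₁ _ (ih₂ _ hx)

/-- The action of an element of the Weyl group on the weight lattice. -/
def weylAct (R : RootPairing ι ℝ M N) [R.IsCrystallographic] (w : R.weylGroup) :
    R.weightLattice →+ R.weightLattice where
  toFun x := ⟨w • (x : M), R.smul_mem_weightLattice w x x.2⟩
  map_zero' := by ext; simp
  map_add' x y := by ext; simp

instance finite_weylGroup [Finite ι] (R : RootPairing ι ℝ M N) [R.IsRootSystem] :
    Finite R.weylGroup := by
  refine Finite.of_injective R.weylGroupToPerm fun g h hgh => ?_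
  apply Subtype.ext
  apply Equiv.weightHom_injective R
  apply LinearEquiv.toLinearMap_injective
  refine LinearMap.ext_on_range (v := R.root) (IsRootSystem.span_root_eq_top) fun i => ?_
  have h1 := R.weylGroup_apply_root g i
  have h2 := R.weylGroup_apply_root h i
  rw [hgh] at h1
  exact h1.trans h2.symm

/-- The sign `ε(w)` of a Weyl group element: its determinant on the ambient space. It is the
homomorphism to `{1, -1}` sending every reflection to `-1`, so it is `(-1) ^ l(w)`. -/
def weylSign (R : RootPairing ι ℝ M N) (w : R.weylGroup) : ℤ :=
  SignType.sign (LinearMap.det (R.weylGroupRootRep w))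

lemma weylSign_one (R : RootPairing ι ℝ M N) : R.weylSign 1 = 1 := by
  simp [weylSign]

lemma weylSign_mul (R : RootPairing ι ℝ M N) (v w : R.weylGroup) :
    R.weylSign (v * w) = R.weylSign v * R.weylSign w := by
  simp [weylSign, map_mul, sign_mul]

lemma weylSign_reflection [Finite ι] (R : RootPairing ι ℝ M N) [R.IsRootSystem] (i : ι) :
    R.weylSign (weylGroup.ofIdx R i) = -1 := by
  have : Module.Finite ℝ M :=
    ⟨⟨(Set.finite_range R.root).toFinset, by simp⟩⟩
  have h : R.weylGroupRootRep (weylGroup.ofIdx R i) =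
      LinearMap.transvection (R.coroot' i) (-R.root i) := by
    ext x
    change R.reflection i x = _
    rw [R.reflection_apply, LinearMap.transvection.apply]
    simp [sub_eq_add_neg]
  rw [weylSign, h, LinearMap.transvection.det, map_neg, R.root_coroot'_eq_pairing,
    R.pairing_same]
  norm_num

/-- The Schur-Weyl element `S(x) = ∑_{w ∈ W} ε(w) e^{w x}` of the group algebra `A[P]`. -/
def schurWeyl [Finite ι] (R : RootPairing ι ℝ M N) [R.IsRootSystem] [R.IsCrystallographic]
    (A : Type*) [CommRing A] (x : R.weightLattice) : AddMonoidAlgebra A R.weightLattice :=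
  letI := Fintype.ofFinite R.weylGroup
  ∑ w : R.weylGroup, AddMonoidAlgebra.single (R.weylAct w x) (R.weylSign w : A)

/-- The ring `A[P]^W` of Weyl group invariants in the group algebra of the weight lattice. -/
def weylInvariants (R : RootPairing ι ℝ M N) [R.IsCrystallographic] (A : Type*) [CommRing A] :
    Subring (AddMonoidAlgebra A R.weightLattice) :=
  ⨅ w : R.weylGroup,
    (AddMonoidAlgebra.mapDomainRingHom A (R.weylAct w)).eqLocus (RingHom.id _)

/-- The square of the length of the `i`-th root, for the canonical Weyl group invariant inner
product. -/
def normSq [Fintype ι] (R : RootPairing ι ℝ M N) (i : ι) : ℝ :=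
  R.RootForm (R.root i) (R.root i)

/-- All roots have the same length. -/
def SimplyLaced [Fintype ι] (R : RootPairing ι ℝ M N) : Prop :=
  ∀ i j, R.normSq i = R.normSq j

/-- The `i`-th root is long (if all roots have the same length, every root is long). -/
def IsLong [Fintype ι] (R : RootPairing ι ℝ M N) (i : ι) : Prop :=
  ∀ j, R.normSq j ≤ R.normSq i

/-- The `i`-th root is short (if all roots have the same length, every root is short). -/
def IsShort [Fintype ι] (R : RootPairing ι ℝ M N) (i : ι) : Prop :=
  ∀ j, R.normSq i ≤ R.normSq j

/-- The ratio `m(Φ)` of the squared length of a long root to that of a short root; for an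
irreducible reduced crystallographic root system it is `1`, `2` or `3`. -/
def lengthRatio [Fintype ι] (R : RootPairing ι ℝ M N) : ℕ :=
  ⌊(⨆ i, R.normSq i) / (⨅ i, R.normSq i)⌋₊

lemma normSq_eq_lengthRatio_mul [Fintype ι] (R : RootPairing ι ℝ M N) [R.IsRootSystem]
    [R.IsCrystallographic] [R.IsReduced] [R.IsIrreducible] {i j : ι}
    (hi : R.IsLong i) (hj : R.IsShort j) :
    R.normSq i = R.lengthRatio * R.normSq j := by
  have hne : Nonempty ι := ⟨i⟩
  have h1 : (⨆ k, R.normSq k) = R.normSq i :=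
    le_antisymm (ciSup_le hi) (le_ciSup (Set.finite_range _).bddAbove i)
  have h2 : (⨅ k, R.normSq k) = R.normSq j :=
    le_antisymm (ciInf_le (Set.finite_range _).bddBelow j) (le_ciInf hj)
  have hpos : ∀ k, 0 < R.normSq k := fun k =>
    R.rootForm_pos_of_ne_zero (by simp) (R.ne_zero k)
  have hij : R.normSq j ≤ R.normSq i := hi j
  have key := R.toInvariantForm.apply_eq_or i j
  change R.normSq i = R.normSq j ∨ R.normSq i = 2 * R.normSq j ∨ R.normSq i = 3 * R.normSq j ∨
    R.normSq j = 2 * R.normSq i ∨ R.normSq j = 3 * R.normSq i at key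
  have hn := hpos j
  have h3 : ∃ n : ℕ, R.normSq i = n * R.normSq j := by
    rcases key with h | h | h | h | h
    · exact ⟨1, by simpa using h⟩
    · exact ⟨2, by simpa using h⟩
    · exact ⟨3, by simpa using h⟩
    · linarith [hpos i]
    · linarith [hpos i]
  obtain ⟨n, h⟩ := h3
  have h4 : R.lengthRatio = n := by
    rw [lengthRatio, h1, h2, h, mul_div_cancel_right₀ _ hn.ne', Nat.floor_natCast]
  rw [h4, h]

namespace Base

variable {R : RootPairing ι ℝ M N}

/-- The fundamental weight `ω_i` attached to a simple root: its pairing with the simple coroots is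
`1` at `i` and `0` elsewhere. -/
def fundamentalWeight [R.IsRootSystem] (b : R.Base) (i : b.support) :
    R.weightLattice :=
  ⟨R.toPerfPair.symm (b.toCoweightBasis.coord i), by
    have key : ∀ y ∈ Submodule.span ℤ (R.coroot '' b.support),
        ∃ n : ℤ, b.toCoweightBasis.coord i y = n := by
      intro y hy
      induction hy using Submodule.span_induction with
      | mem y hy =>
        obtain ⟨j, hj, rfl⟩ := hy
        have : b.toCoweightBasis.coord i (R.coroot j) =
            (Finsupp.single (⟨j, hj⟩ : b.support) (1 : ℝ)) i := by
          rw [Module.Basis.coord_apply, ← b.toCoweightBasis_repr_coroot ⟨j, hj⟩]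
        classical
        rw [this, Finsupp.single_apply]
        split_ifs
        · exact ⟨1, by simp⟩
        · exact ⟨0, by simp⟩
      | zero => exact ⟨0, by simp⟩
      | add x y _ _ hx hy =>
        obtain ⟨m, hm⟩ := hx
        obtain ⟨n, hn⟩ := hy
        exact ⟨m + n, by simp only [map_add, hm, hn, Int.cast_add]⟩
      | smul a x _ hx =>
        obtain ⟨m, hm⟩ := hx
        exact ⟨a * m, by simp only [map_zsmul, hm, zsmul_eq_mul, Int.cast_mul]⟩
    intro j
    obtain ⟨n, hn⟩ := key _ (b.coroot_mem_span_int j)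
    refine ⟨n, ?_⟩
    exact (LinearMap.congr_fun (R.toPerfPair.apply_symm_apply (b.toCoweightBasis.coord i))
      (R.coroot j)).trans hn⟩

lemma weightCoeff_fundamentalWeight [R.IsRootSystem] (b : R.Base) [DecidableEq ι]
    (i j : b.support) :
    R.weightCoeff j (b.fundamentalWeight i) = if i = j then 1 else 0 := by
  have h := R.weightCoeff_spec j (b.fundamentalWeight i)
  have h' : R.coroot' j (b.fundamentalWeight i : M) = b.toCoweightBasis.coord i (R.coroot j) :=
    LinearMap.congr_fun (R.toPerfPair.apply_symm_apply (b.toCoweightBasis.coord i)) (R.coroot j)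
  rw [h', Module.Basis.coord_apply, b.toCoweightBasis_repr_coroot j, Finsupp.single_apply] at h
  have h'' : ((R.weightCoeff j (b.fundamentalWeight i) : ℤ) : ℝ) =
      ((if i = j then 1 else 0 : ℤ) : ℝ) := by
    rw [← h]
    by_cases hij : i = j
    · simp [hij]
    · simp [hij, Ne.symm hij]
  exact_mod_cast h''

/-- The Weyl weight `ρ`, the sum of the fundamental weights. -/
def rho [R.IsRootSystem] (b : R.Base) : R.weightLattice :=
  ∑ i : b.support, b.fundamentalWeight i

/-- A weight is dominant and regular if all its coefficients with respect to the fundamental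
weights are positive. -/
def DominantRegular (b : R.Base) (x : R.weightLattice) : Prop :=
  ∀ i ∈ b.support, 0 < R.weightCoeff i x

/-- `d(x)`, the greatest common divisor of the coefficients of `x` with respect to the fundamental
weights. -/
def weightGcd (b : R.Base) (x : R.weightLattice) : ℕ :=
  b.support.gcd fun i => (R.weightCoeff i x).natAbs

/-- The `i`-th simple root is a corner of the Dynkin diagram: it is joined to at most one other
simple root. -/
def IsCorner (b : R.Base) (i : b.support) : Prop :=
  {j : b.support | j ≠ i ∧ R.pairing i j ≠ 0}.Subsingleton

/-- The Cartan matrix of the base is `A`, for a suitable numbering of the simple roots. -/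
def HasCartanMatrix [R.IsCrystallographic] (b : R.Base) {n : ℕ}
    (A : Matrix (Fin n) (Fin n) ℤ) : Prop :=
  ∃ f : b.support ≃ Fin n, b.cartanMatrix.reindex f f = A

/-- `F` is the quotient `C(x, d) = S(x) / S(dρ)` in `A[P]`. -/
def IsC [Finite ι] [R.IsRootSystem] [R.IsCrystallographic] (b : R.Base) {A : Type*} [CommRing A]
    (F : AddMonoidAlgebra A R.weightLattice) (x : R.weightLattice) (d : ℕ) : Prop :=
  F * R.schurWeyl A (d • b.rho) = R.schurWeyl A x

end Base

end RootPairing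

end

/-
Assume that the greatest common divisor is `d`. For a simple root `β` and a unit `z`, substitute
`e^x ↦ z^⟨x, β*⟩ e^x̄`, where `x̄` is the class of `x` modulo `β`. The image of `S(x)` has leading
coefficient `[z^n] = z^n - z^(-n)` with `n = ⟨x, β*⟩`, so the leading coefficients `u(z)`, `v(z)` of
`U`, `V` satisfy `u(z) v(z) [z^d] = [z^n]` with `n = m_β(μ)`, and `u`, `v` have no common zero.

Let `v(z) = 0`. Then `z^(2e) = 1`, as `V` divides `C(eρ, d)`, so the image of `S(μ)` is zero. As
`u(z) ≠ 0`, so is that of `V`, and `UX + VY = C(η, d)` shows that `u(z)` divides `[z^k] / [z^d]` for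
a coefficient `k` of a Weyl conjugate of `η` with `gcd(k, e) = d`, so `u(z)` is a unit. If `ξ` is
of `p`-power order and `v(zξ) ≠ 0`, then `u(zξ) = 0` and `1 - ξ` divides `u(z)`, so `p` is a unit.
Such primes being excluded, one passes between all roots of unity in question by steps of prime
power order, and `u` or `v` has no zero at all. Let it be `u`. By invariance under `z ↦ z⁻¹`, the
Laurent polynomial `u` is a constant, and `V` vanishes at all `z` with `z^(2e) = 1 ≠ z^(2d)`. If
this happens for all `β`, then `U` is a unit.

So some adjacent simple roots `β`, `δ` behave differently: `U`, say, vanishes at `β` and `V` at `δ`.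
If the bond is simple, `β` and `δ` are conjugate under `W` and both factors vanish at both. If it is
double, consider the terms of `S(η)` in a class modulo `β` and `δ` which form an orbit of the
dihedral group of order eight. The first order term of `UX + VY = C(η, d)` at `z` yields
`p [z^(p+2r)] = (p+2r) [z^p]` for the coefficients `p`, `r > 0` at the two roots of a weight in this
orbit, where either `e ∣ p` and `gcd(2r, e) = d` or `e ∣ r` and `gcd(p, e) = d`. In the first case
only the right hand side is zero, and in the second `[z^(p+2r)] = [z^p] ≠ 0`.
-/

noncomputable section

namespace WeylCharacter

open RootPairing RootPairing.Base AddMonoidAlgebra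
open RootPairing.weylGroup (ofIdx)

section Reflections

variable {ι 𝕜 M N : Type*} [CommRing 𝕜] [AddCommGroup M] [Module 𝕜 M] [AddCommGroup N]
  [Module 𝕜 N] (R : RootPairing ι 𝕜 M N)

lemma ofIdx_smul (i : ι) (x : M) : ofIdx R i • x = x - R.coroot' i x • R.root i := by
  rw [weylGroup.ofIdx_smul]
  exact R.reflection_apply i x

lemma coroot'_ofIdx_smul (i j : ι) (x : M) :
    R.coroot' j (ofIdx R i • x) = R.coroot' j x - R.coroot' i x * R.pairing i j := by
  rw [ofIdx_smul, map_sub, LinearMap.map_smul, R.root_coroot'_eq_pairing, smul_eq_mul]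

lemma weylGroupToPerm_ofIdx (i : ι) : R.weylGroupToPerm (ofIdx R i) = R.reflectionPerm i := rfl

lemma root_weylGroupToPerm (w : R.weylGroup) (i : ι) :
    R.root (R.weylGroupToPerm w i) = w • R.root i :=
  (R.weylGroup_apply_root w i).symm

lemma smul_sub_smul_root (w : R.weylGroup) (x : M) (t : 𝕜) (i : ι) :
    w • (x - t • R.root i) = w • x - t • R.root (R.weylGroupToPerm w i) := by
  rw [smul_sub, smul_comm, root_weylGroupToPerm]

lemma weylGroup_ext {v w : R.weylGroup} (h : ∀ x : M, v • x = w • x) : v = w :=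
  Subtype.ext <| Equiv.weightHom_injective R <| LinearEquiv.ext h

lemma coroot'_weylGroupToPerm_smul (w : R.weylGroup) (i : ι) (x : M) :
    R.coroot' (R.weylGroupToPerm w i) (w • x) = R.coroot' i x := by
  obtain ⟨w, hw⟩ := w
  induction hw using weylGroup.induction generalizing x i with
  | mem j =>
    change R.coroot' (R.reflectionPerm j i) (R.reflection j x) = _
    rw [coroot'_reflectionPerm, LinearMap.comp_apply, LinearEquiv.coe_coe, R.reflection_same]
  | one => rfl
  | mul v w hv hw ihv ihw =>
    rw [← Submonoid.mk_mul_mk _ _ _ hv hw, mul_smul, map_mul]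
    exact (ihv _ _).trans (ihw _ _)

lemma ofIdx_weylGroupToPerm (w : R.weylGroup) (i : ι) :
    ofIdx R (R.weylGroupToPerm w i) = w * ofIdx R i * w⁻¹ := by
  refine weylGroup_ext R fun x => ?_
  rw [mul_smul, mul_smul, ofIdx_smul, ofIdx_smul, smul_sub_smul_root, smul_inv_smul,
    ← coroot'_weylGroupToPerm_smul R w i (w⁻¹ • x), smul_inv_smul]

lemma ofIdx_mul_self (i : ι) : ofIdx R i * ofIdx R i = 1 := by
  refine weylGroup_ext R fun x => ?_
  rw [mul_smul, weylGroup.ofIdx_smul, weylGroup.ofIdx_smul, one_smul]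
  exact R.reflection_same i x

lemma ofIdx_inv (i : ι) : (ofIdx R i)⁻¹ = ofIdx R i :=
  inv_eq_of_mul_eq_one_left (ofIdx_mul_self R i)

lemma ofIdx_reflectionPerm (i j : ι) :
    ofIdx R (R.reflectionPerm i j) = ofIdx R i * ofIdx R j * ofIdx R i := by
  rw [← weylGroupToPerm_ofIdx, ofIdx_weylGroupToPerm, ofIdx_inv]

lemma ofIdx_mul_ofIdx (i j : ι) :
    ofIdx R i * ofIdx R j = ofIdx R (R.reflectionPerm i j) * ofIdx R i := by
  rw [ofIdx_reflectionPerm, mul_assoc, ofIdx_mul_self, mul_one]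

end Reflections

section Words

variable {ι 𝕜 M N : Type*} [CommRing 𝕜] [AddCommGroup M] [Module 𝕜 M] [AddCommGroup N]
  [Module 𝕜 N] {R : RootPairing ι 𝕜 M N} (b : R.Base)

/-- The product in the Weyl group of a word in the simple reflections. -/
def wordProd (l : List b.support) : R.weylGroup :=
  (l.map fun i => ofIdx R i).prod

lemma wordProd_nil : wordProd b [] = 1 := rfl

lemma wordProd_singleton (i : b.support) : wordProd b [i] = ofIdx R i := by
  simp [wordProd]

lemma wordProd_cons (i : b.support) (l : List b.support) :
    wordProd b (i :: l) = ofIdx R i * wordProd b l := by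
  simp [wordProd]

lemma wordProd_append (l l' : List b.support) :
    wordProd b (l ++ l') = wordProd b l * wordProd b l' := by
  simp [wordProd]

/-- Reduced words: words in the simple reflections which are as short as possible among the words
with the same product. -/
def IsReducedWord (l : List b.support) : Prop :=
  ∀ l', wordProd b l' = wordProd b l → l.length ≤ l'.length

variable {b} in
lemma IsReducedWord.left_of_append {l l' : List b.support} (h : IsReducedWord b (l ++ l')) :
    IsReducedWord b l := by
  intro t ht
  have := h (t ++ l') (by rw [wordProd_append, ht, ← wordProd_append])
  simpa only [List.length_append, add_le_add_iff_right] using this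

variable [Finite ι] [IsDomain 𝕜] [CharZero 𝕜] [R.IsCrystallographic] [R.IsReduced]

lemma exists_wordProd_eq (w : R.weylGroup) : ∃ l, wordProd b l = w := by
  have exists_ofIdx (i : ι) : ∃ l, wordProd b l = ofIdx R i := by
    refine b.induction_reflect i (p := fun i => ∃ l, wordProd b l = ofIdx R i) ?_ ?_ ?_
    · rintro i ⟨l, hl⟩
      exact ⟨l ++ (l ++ l), by
        rw [wordProd_append, wordProd_append, hl, ofIdx_reflectionPerm, mul_assoc]⟩
    · exact fun i hi => ⟨[⟨i, hi⟩], wordProd_singleton b _⟩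
    · rintro i j ⟨l, hl⟩ hj
      exact ⟨⟨j, hj⟩ :: (l ++ [⟨j, hj⟩]), by
        rw [wordProd_cons, wordProd_append, hl, ofIdx_reflectionPerm, wordProd_singleton,
          mul_assoc]⟩
  obtain ⟨w, hw⟩ := w
  induction hw using weylGroup.induction with
  | mem j => exact exists_ofIdx j
  | one => exact ⟨[], rfl⟩
  | mul v w _ _ ihv ihw =>
    obtain ⟨l₁, h₁⟩ := ihv
    obtain ⟨l₂, h₂⟩ := ihw
    exact ⟨l₁ ++ l₂, by rw [wordProd_append, h₁, h₂]; rfl⟩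

lemma exists_isReducedWord (w : R.weylGroup) : ∃ l, IsReducedWord b l ∧ wordProd b l = w := by
  obtain ⟨l, hl⟩ := exists_wordProd_eq b w
  obtain ⟨l, rfl, hmin⟩ :=
    exists_minimalFor_of_wellFoundedLT (fun l => wordProd b l = w) List.length ⟨l, hl⟩
  exact ⟨l, fun l' h' => (le_total _ _).elim id (hmin h'), rfl⟩

lemma exists_suffix_maps_to_support {l : List b.support} {i : ι} (hi : b.IsPos i)
    (h : ¬ b.IsPos (R.weylGroupToPerm (wordProd b l) i)) :
    ∃ l₁ j l₂, l = l₁ ++ j :: l₂ ∧ R.weylGroupToPerm (wordProd b l₂) i = (j : b.support) := by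
  induction l with
  | nil => exact absurd hi h
  | cons j t ih =>
    by_cases ht : b.IsPos (R.weylGroupToPerm (wordProd b t) i)
    · refine ⟨[], j, t, rfl, ?_⟩
      by_contra hne
      rw [wordProd_cons, map_mul] at h
      exact h (ht.reflectionPerm j.2 hne)
    · obtain ⟨l₁, k, l₂, rfl, hk⟩ := ih ht
      exact ⟨j :: l₁, k, l₂, rfl, hk⟩

variable {b}

lemma IsReducedWord.isPos {l : List b.support} {i : b.support}
    (h : IsReducedWord b (l ++ [i])) : b.IsPos (R.weylGroupToPerm (wordProd b l) i) := by
  by_contra hneg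
  obtain ⟨l₁, j, l₂, rfl, hj⟩ :=
    exists_suffix_maps_to_support b (b.isPos_of_mem_support i.2) hneg
  have exchange : wordProd b (l₁ ++ l₂) = wordProd b (l₁ ++ j :: l₂ ++ [i]) := by
    have := ofIdx_weylGroupToPerm R (wordProd b l₂) i
    simp only [wordProd_append, wordProd_cons, wordProd_nil, ← hj, this, mul_assoc,
      inv_mul_cancel_left, ofIdx_mul_self, mul_one]
  have hlen := h _ exchange
  simp only [List.length_append, List.length_cons, List.length_nil] at hlen
  omega

variable (b)

lemma weylGroup_induction_isPos {p : R.weylGroup → Prop} (one : p 1)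
    (mul : ∀ (w : R.weylGroup) (i : b.support), p w → b.IsPos (R.weylGroupToPerm w i) →
      p (w * ofIdx R i)) (w : R.weylGroup) : p w := by
  obtain ⟨l, hl, rfl⟩ := exists_isReducedWord b w
  induction l using List.reverseRecOn with
  | nil => exact one
  | append_singleton l i ih =>
    rw [wordProd_append, wordProd_singleton]
    exact mul _ _ (ih hl.left_of_append) hl.isPos

end Words

section Coordinates

variable {ι 𝕜 M N : Type*} [CommRing 𝕜] [AddCommGroup M] [Module 𝕜 M] [AddCommGroup N]
  [Module 𝕜 N] {R : RootPairing ι 𝕜 M N} [R.IsRootSystem] (b : R.Base)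

/-- The coordinate functional of a vector with respect to the basis of simple roots, that is, the
`i`-th fundamental coweight. -/
def coord (i : b.support) : M →ₗ[𝕜] 𝕜 := b.toWeightBasis.coord i

lemma coord_root [DecidableEq b.support] (i j : b.support) :
    coord b i (R.root j) = if i = j then 1 else 0 := by
  simp [coord, Finsupp.single_apply, eq_comm]

lemma coord_root_self (i : b.support) : coord b i (R.root i) = 1 := by
  classical rw [coord_root, if_pos rfl]

lemma coord_root_of_ne {i j : b.support} (h : i ≠ j) : coord b i (R.root j) = 0 := by
  classical rw [coord_root, if_neg h]

lemma sum_coord_smul (x : M) : ∑ i, coord b i x • R.root i = x := by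
  simpa [coord] using b.toWeightBasis.sum_repr x

lemma ext_coord {x y : M} (h : ∀ i, coord b i x = coord b i y) : x = y :=
  b.toWeightBasis.ext_elem h

lemma eq_zero_of_coroot'_eq_zero {x : M} (h : ∀ i : b.support, R.coroot' i x = 0) : x = 0 := by
  apply R.toPerfPair.injective
  rw [map_zero]
  exact b.toCoweightBasis.ext fun i => by simpa using h i

lemma coroot'_eq_sum_coord (j : ι) (x : M) :
    R.coroot' j x = ∑ i, coord b i x * R.pairing i j := by
  conv_lhs => rw [← sum_coord_smul b x]
  simp only [map_sum, map_smul, R.root_coroot'_eq_pairing, smul_eq_mul]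

lemma coord_ofIdx_smul_of_ne {i j : b.support} (h : i ≠ j) (x : M) :
    coord b i (ofIdx R j • x) = coord b i x := by
  rw [ofIdx_smul, map_sub, map_smul, coord_root_of_ne b h, smul_zero, sub_zero]

lemma coord_ofIdx_smul_self (i : b.support) (x : M) :
    coord b i (ofIdx R i • x) = coord b i x - R.coroot' i x := by
  rw [ofIdx_smul, map_sub, map_smul, coord_root_self, smul_eq_mul, mul_one]

/-- The stabilizer in the Weyl group of the `i`-th fundamental coweight. -/
def coordStabilizer (i : b.support) : Subgroup R.weylGroup where
  carrier := {w | ∀ x : M, coord b i (w • x) = coord b i x}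
  one_mem' x := by rw [one_smul]
  mul_mem' {v w} hv hw x := by rw [mul_smul, hv, hw]
  inv_mem' {w} hw x := by rw [← hw, smul_inv_smul]

lemma ofIdx_mem_coordStabilizer {i j : b.support} (h : i ≠ j) :
    ofIdx R j ∈ coordStabilizer b i :=
  coord_ofIdx_smul_of_ne b h

lemma eq_one_of_mem_coordStabilizer {w : R.weylGroup} (h : ∀ i, w ∈ coordStabilizer b i) :
    w = 1 :=
  weylGroup_ext R fun x => ext_coord b fun i => by rw [h i x, one_smul]

lemma exists_coord_root_eq_natCast [CharZero 𝕜] {j : ι} (hj : b.IsPos j) (i : b.support) :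
    ∃ n : ℕ, coord b i (R.root j) = n := by
  classical
  obtain ⟨f, hf, h | h⟩ := b.exists_root_eq_sum_nat_or_neg j
  · refine ⟨f i, ?_⟩
    rw [h, ← Finset.sum_coe_sort b.support (fun k => f k • R.root k), map_sum]
    simp [coord_root, map_nsmul]
  · have h' : R.root j = ∑ k ∈ b.support, (fun k => -(f k : ℤ)) k • R.root k := by
      rw [h, ← Finset.sum_neg_distrib]
      exact Finset.sum_congr rfl fun k _ => by simp
    rw [isPos_iff, height_eq_sum h', Finset.sum_neg_distrib] at hj
    have : (0 : ℤ) ≤ ∑ k ∈ b.support, (f k : ℤ) := Finset.sum_nonneg fun _ _ => by positivity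
    omega

variable [Finite ι] [IsDomain 𝕜] [CharZero 𝕜] [R.IsCrystallographic] [R.IsReduced]

lemma exists_coord_smul_eq_sub_sum (w : R.weylGroup) (i : b.support) : ∃ k : b.support → ℕ,
    (∀ x : M, coord b i (w • x) = coord b i x - ∑ j, k j * R.coroot' j x) ∧
      (k = 0 ∨ 1 ≤ k i) := by
  classical
  induction w using weylGroup_induction_isPos b with
  | one => exact ⟨0, by simp, Or.inl rfl⟩
  | mul w j ih hpos =>
    obtain ⟨k, hk, hk'⟩ := ih
    obtain ⟨n, hn⟩ := exists_coord_root_eq_natCast b hpos i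
    refine ⟨k + Pi.single j n, fun x => ?_, ?_⟩
    · have hsingle : ∑ l, ((Pi.single j n : b.support → ℕ) l : 𝕜) * R.coroot' l x =
          n * R.coroot' j x := by
        rw [Finset.sum_eq_single j] <;> simp +contextual
      rw [mul_smul, ofIdx_smul, smul_sub_smul_root, map_sub, (coord b i).map_smul, hn, hk]
      simp only [Pi.add_apply, Nat.cast_add, add_mul, Finset.sum_add_distrib, smul_eq_mul, hsingle]
      ring
    · rcases hk' with rfl | hk'
      · have hn' : (n : 𝕜) = if i = j then 1 else 0 := by
          rw [← hn, root_weylGroupToPerm, hk, ← coord_root b i j]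
          simp
        split_ifs at hn' with hij
        · exact Or.inr (by simp [hij, show n = 1 by exact_mod_cast hn'])
        · exact Or.inl (by simp [show n = 0 by exact_mod_cast hn'])
      · exact Or.inr (le_add_right hk')

end Coordinates

section Parabolic

variable {ι M N : Type*} [AddCommGroup M] [Module ℝ M] [AddCommGroup N] [Module ℝ N]
  {R : RootPairing ι ℝ M N} (b : R.Base)

lemma dvd_weightCoeff {n : ℤ} {x : R.weightLattice} (h : ∀ i ∈ b.support, n ∣ R.weightCoeff i x)
    (i : ι) : n ∣ R.weightCoeff i x := by
  have span_le : Submodule.span ℤ (R.coroot '' b.support) ≤ AddSubgroup.toIntSubmodule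
      ((AddSubgroup.zmultiples (n : ℝ)).comap (R.toLinearMap (x : M)).toAddMonoidHom) := by
    rw [Submodule.span_le]
    rintro _ ⟨j, hj, rfl⟩
    obtain ⟨k, hk⟩ := h j hj
    refine ⟨k, (Eq.trans ?_ (R.weightCoeff_spec j x).symm)⟩
    simp [hk, mul_comm]
  obtain ⟨k, hk⟩ := span_le (b.coroot_mem_span_int i)
  have hk' : (k • (n : ℝ)) = R.weightCoeff i x := hk.trans (R.weightCoeff_spec i x)
  exact ⟨k, by rw [mul_comm]; exact_mod_cast (zsmul_eq_mul (n : ℝ) k ▸ hk').symm⟩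

lemma pairing_le_zero_of_ne [Finite ι] [R.IsCrystallographic] {i j : b.support}
    (h : i ≠ j) :
    R.pairing i j ≤ 0 := by
  rw [← R.algebraMap_pairingIn ℤ]
  simpa using b.pairingIn_le_zero_of_ne (Subtype.coe_ne_coe.2 h) i.2 j.2

lemma exists_mem_notMem_pairing_ne_zero [Finite ι] [R.IsCrystallographic] [R.IsReduced]
    [R.IsIrreducible] {K : Set b.support} (hK : K.Nonempty) (hK' : K ≠ Set.univ) :
    ∃ j ∈ K, ∃ i ∉ K, R.pairing j i ≠ 0 := by
  by_contra! hcon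
  obtain ⟨j, hj⟩ := hK
  refine hK' (Set.eq_univ_of_forall fun k => ?_)
  refine b.induction_on_cartanMatrix (· ∈ K) (i := j) (j := k) hj fun i j hi hij => ?_
  by_contra hj
  have hpairing : R.pairingIn ℤ i j = 0 := by
    have := hcon i hi j hj
    rw [← R.algebraMap_pairingIn ℤ] at this
    simpa using this
  exact hij ((b.cartanMatrix_apply_eq_zero_iff_symm).2 hpairing)

variable [R.IsRootSystem]

lemma coroot'_fundamentalWeight [DecidableEq b.support] (i j : b.support) :
    R.coroot' j (b.fundamentalWeight i : M) = if i = j then 1 else 0 := by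
  classical
  rw [weightCoeff_spec, weightCoeff_fundamentalWeight]
  split_ifs <;> simp

lemma coroot'_fundamentalWeight_self (i : b.support) :
    R.coroot' i (b.fundamentalWeight i : M) = 1 := by
  classical rw [coroot'_fundamentalWeight, if_pos rfl]

lemma coroot'_fundamentalWeight_of_ne {i j : b.support} (h : i ≠ j) :
    R.coroot' j (b.fundamentalWeight i : M) = 0 := by
  classical rw [coroot'_fundamentalWeight, if_neg h]

lemma sum_mul_coroot'_fundamentalWeight (f : b.support → ℝ) (i : b.support) :
    ∑ j, f j * R.coroot' j (b.fundamentalWeight i : M) = f i := by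
  classical
  simp only [coroot'_fundamentalWeight, mul_ite, mul_one, mul_zero, Finset.sum_ite_eq,
    Finset.mem_univ, if_true]

lemma ofIdx_smul_fundamentalWeight_of_ne {i j : b.support} (h : i ≠ j) :
    ofIdx R j • (b.fundamentalWeight i : M) = b.fundamentalWeight i := by
  rw [ofIdx_smul, coroot'_fundamentalWeight_of_ne b h, zero_smul, sub_zero]

lemma ofIdx_smul_fundamentalWeight_self (i : b.support) :
    ofIdx R i • (b.fundamentalWeight i : M) = b.fundamentalWeight i - R.root i := by
  rw [ofIdx_smul, coroot'_fundamentalWeight_self, one_smul]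

/-- The standard parabolic subgroup of the Weyl group attached to a set of simple roots. -/
def parabolic (J : Set b.support) : Subgroup R.weylGroup :=
  Subgroup.closure ((fun i : b.support => ofIdx R i) '' J)

variable [R.IsCrystallographic] [Finite ι] [R.IsReduced]

lemma mem_coordStabilizer_of_mul_ofIdx {w : R.weylGroup} {i j : b.support}
    (hpos : b.IsPos (R.weylGroupToPerm w j)) (h : w * ofIdx R j ∈ coordStabilizer b i) :
    w ∈ coordStabilizer b i ∧ i ≠ j := by
  classical
  obtain ⟨k, hk, -⟩ := exists_coord_smul_eq_sub_sum b w i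
  obtain ⟨n, hn⟩ := exists_coord_root_eq_natCast b hpos i
  have hkn (l : b.support) : (k l : ℝ) + (if l = j then (n : ℝ) else 0) = 0 := by
    have := h (b.fundamentalWeight l : M)
    rw [mul_smul, ofIdx_smul, smul_sub_smul_root, map_sub,
      (coord b i).map_smul, hn, hk,
      sum_mul_coroot'_fundamentalWeight, coroot'_fundamentalWeight] at this
    simp only [smul_eq_mul, ite_mul, one_mul, zero_mul] at this
    linarith
  have hk_zero (l : b.support) : (k l : ℝ) = 0 := by
    have : (0 : ℝ) ≤ if l = j then (n : ℝ) else 0 := by positivity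
    linarith [hkn l, (k l).cast_nonneg (α := ℝ)]
  have hw : w ∈ coordStabilizer b i := fun x => by simp [hk, hk_zero]
  refine ⟨hw, ?_⟩
  rintro rfl
  have hn_zero : (n : ℝ) = 0 := by simpa [hk_zero] using hkn i
  rw [root_weylGroupToPerm, hw, coord_root_self, hn_zero] at hn
  exact one_ne_zero hn

lemma mem_parabolic_of_mem_coordStabilizer {J : Set b.support} {w : R.weylGroup}
    (hw : ∀ i ∉ J, w ∈ coordStabilizer b i) : w ∈ parabolic b J := by
  induction w using weylGroup_induction_isPos b with
  | one => exact one_mem _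
  | mul w j ih hpos =>
    refine mul_mem (ih fun i hi => (mem_coordStabilizer_of_mul_ofIdx b hpos (hw i hi)).1)
      (Subgroup.subset_closure ⟨j, ?_, rfl⟩)
    by_contra hj
    exact (mem_coordStabilizer_of_mul_ofIdx b hpos (hw j hj)).2 rfl

lemma smul_fundamentalWeight_of_mem_coordStabilizer {i : b.support} {w : R.weylGroup}
    (hw : w ∈ coordStabilizer b i) : w • (b.fundamentalWeight i : M) = b.fundamentalWeight i := by
  have hle : parabolic b {i}ᶜ ≤ MulAction.stabilizer R.weylGroup (b.fundamentalWeight i : M) := by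
    rw [parabolic, Subgroup.closure_le]
    rintro _ ⟨j, hj, rfl⟩
    exact ofIdx_smul_fundamentalWeight_of_ne b (Ne.symm hj)
  exact hle (mem_parabolic_of_mem_coordStabilizer b fun j hj => by rwa [not_not.1 hj])

/-- A vector is strictly dominant if it lies in the open fundamental chamber. For weights this is
`RootPairing.Base.DominantRegular`. -/
def StrictlyDominant (x : M) : Prop := ∀ i : b.support, 0 < R.coroot' i x

lemma exists_coord_smul_eq_sub_sum_of_mem_coordStabilizer {K : Set b.support} {w : R.weylGroup}
    (hw : ∀ i ∈ K, w ∈ coordStabilizer b i) (i : b.support) : ∃ k : b.support → ℕ,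
    (∀ x : M, coord b i (w • x) = coord b i x - ∑ j, k j * R.coroot' j x) ∧
      (k = 0 ∨ 1 ≤ k i) ∧ ∀ j ∈ K, k j = 0 := by
  obtain ⟨k, hk, hki⟩ := exists_coord_smul_eq_sub_sum b w i
  refine ⟨k, hk, hki, fun j hj => ?_⟩
  have h := hk (b.fundamentalWeight j)
  rw [smul_fundamentalWeight_of_mem_coordStabilizer b (hw j hj),
    sum_mul_coroot'_fundamentalWeight] at h
  have : (k j : ℝ) = 0 := by linarith
  exact_mod_cast this

lemma mem_coordStabilizer_or_coord_smul_le {K : Set b.support} {w : R.weylGroup}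
    (hw : ∀ i ∈ K, w ∈ coordStabilizer b i) {x : M}
    (hx : ∀ j ∉ K, 0 < R.coroot' (j : b.support) x) (i : b.support) :
    w ∈ coordStabilizer b i ∨
      (coord b i (w • x) ≤ coord b i x - R.coroot' i x ∧
        (coord b i (w • x) = coord b i x - R.coroot' i x →
          w * ofIdx R i ∈ coordStabilizer b i)) := by
  classical
  obtain ⟨k, hk, rfl | hki, hkK⟩ := exists_coord_smul_eq_sub_sum_of_mem_coordStabilizer b hw i
  · exact Or.inl fun y => by simp [hk]
  by_cases hiK : i ∈ K
  · exact Or.inl (hw i hiK)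
  right
  have hterm (j : b.support) : 0 ≤ (k j : ℝ) * R.coroot' j x := by
    by_cases hj : j ∈ K
    · simp [hkK j hj]
    · exact mul_nonneg (Nat.cast_nonneg _) (hx j hj).le
  have hki' : (1 : ℝ) ≤ k i := by exact_mod_cast hki
  have hxi := hx i hiK
  have hsplit := Finset.add_sum_erase Finset.univ (fun j => (k j : ℝ) * R.coroot' j x)
    (Finset.mem_univ i)
  have hrest : 0 ≤ ∑ j ∈ Finset.univ.erase i, (k j : ℝ) * R.coroot' j x :=
    Finset.sum_nonneg fun j _ => hterm j
  rw [hk, ← hsplit]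
  refine ⟨by nlinarith, fun heq y => ?_⟩
  have hki_one : (k i : ℝ) = 1 := by nlinarith
  have hrest_zero : ∑ j ∈ Finset.univ.erase i, (k j : ℝ) * R.coroot' j x = 0 := by
    rw [hki_one] at heq
    linarith
  have hkj (j : b.support) (hj : j ≠ i) : (k j : ℝ) = 0 := by
    by_cases hjK : j ∈ K
    · simp [hkK j hjK]
    · have := (Finset.sum_eq_zero_iff_of_nonneg fun j _ => hterm j).1 hrest_zero j (by simp [hj])
      exact (mul_eq_zero.1 this).resolve_right (hx j hjK).ne'
  rw [mul_smul, hk, Finset.sum_eq_single i (fun j _ hj => by simp [hkj j hj]) (by simp), hki_one,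
    one_mul, ← coord_ofIdx_smul_self, ← mul_smul, ofIdx_mul_self, one_smul]

variable {b}

namespace StrictlyDominant

variable {x : M} (hx : StrictlyDominant b x)
include hx

lemma coord_smul_le (w : R.weylGroup) (i : b.support) : coord b i (w • x) ≤ coord b i x := by
  rcases mem_coordStabilizer_or_coord_smul_le b (K := ∅) (w := w) (by simp) (fun j _ => hx j) i
    with h | h
  · exact (h x).le
  · linarith [h.1, hx i]

lemma eq_one_of_smul_eq {w : R.weylGroup} (hw : w • x = x) : w = 1 := by
  refine eq_one_of_mem_coordStabilizer b fun i => ?_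
  rcases mem_coordStabilizer_or_coord_smul_le b (K := ∅) (w := w) (by simp) (fun j _ => hx j) i
    with h | h
  · exact h
  · rw [hw] at h
    linarith [h.1, hx i]

lemma smul_injective {v w : R.weylGroup} (h : v • x = w • x) : v = w := by
  have : w⁻¹ * v = 1 := hx.eq_one_of_smul_eq (by rw [mul_smul, h, inv_smul_smul])
  exact (inv_mul_eq_one.1 this).symm

end StrictlyDominant

end Parabolic

section RootForm

variable {ι M N : Type*} [Fintype ι] [AddCommGroup M] [Module ℝ M] [AddCommGroup N] [Module ℝ N]
  {R : RootPairing ι ℝ M N}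

lemma rootForm_weylGroup_smul (w : R.weylGroup) (x y : M) :
    R.RootForm (w • x) (w • y) = R.RootForm x y :=
  InvariantForm.apply_weylGroup_smul R (B := R.toInvariantForm) w x y

lemma two_mul_rootForm_root (i : ι) (x : M) :
    2 * R.RootForm (R.root i) x = R.coroot' i x * R.normSq i := by
  have h := rootForm_weylGroup_smul (ofIdx R i) (R.root i) x
  rw [ofIdx_smul, ofIdx_smul, R.root_coroot'_eq_pairing, R.pairing_same] at h
  simp only [map_sub, map_smul, LinearMap.sub_apply, LinearMap.smul_apply, smul_eq_mul] at h
  rw [normSq]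
  linarith

variable [R.IsRootSystem]

lemma normSq_pos (i : ι) : 0 < R.normSq i := R.rootForm_pos_of_ne_zero (by simp) (R.ne_zero i)

lemma eq_zero_or_eq_coroot'_of_rootForm_eq {x : M} {i : ι} {t : ℝ}
    (h : R.RootForm (x - t • R.root i) (x - t • R.root i) = R.RootForm x x) :
    t = 0 ∨ t = R.coroot' i x := by
  have hsymm : R.RootForm x (R.root i) = R.RootForm (R.root i) x := R.rootForm_symmetric.eq _ _
  simp only [map_sub, map_smul, LinearMap.sub_apply, LinearMap.smul_apply, smul_eq_mul, hsymm] at h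
  have : t * (t - R.coroot' i x) * R.normSq i = 0 := by
    have hroot := two_mul_rootForm_root (R := R) i x
    rw [normSq] at hroot ⊢
    linear_combination t * hroot + h
  simpa [(normSq_pos i).ne', sub_eq_zero] using this

end RootForm

section Adapted

variable {ι M N : Type*} [AddCommGroup M] [Module ℝ M] [AddCommGroup N] [Module ℝ N]
  {R : RootPairing ι ℝ M N} [R.IsRootSystem] {b : R.Base}

variable (b) in
/-- `u` is adapted to a set `K` of simple roots if it maps strictly dominant vectors to vectors
which are strictly dominant outside of `K`, and the elements of the Weyl group which agree with `u`
in the coordinates in `K` are determined up to the stabilizer of these coordinates. In the orbit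
sum of a strictly dominant vector `x`, this isolates the terms `v • x` with the same `K`-coordinates
as `u • x`. -/
structure IsAdapted (K : Set b.support) (u : R.weylGroup) : Prop where
  pos : ∀ x : M, StrictlyDominant b x → ∀ j ∉ K, 0 < R.coroot' (j : b.support) (u • x)
  mul_inv_mem : ∀ x : M, StrictlyDominant b x → ∀ v : R.weylGroup,
    (∀ i ∈ K, coord b i (v • x) = coord b i (u • x)) → ∀ i ∈ K, v * u⁻¹ ∈ coordStabilizer b i

lemma IsAdapted.empty_one : IsAdapted b ∅ 1 :=
  ⟨fun x hx j _ => by simpa using hx j, by simp⟩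

variable (b) in
/-- `u` lowers the fundamental weight `ω_α` by the root `w α`, which is positive with support `K`
and has `α`-coordinate `1`, and `u` is adapted to `K`. -/
structure IsLowering (α : b.support) (K : Set b.support) (u w : R.weylGroup) : Prop where
  isAdapted : IsAdapted b K u
  smul_fundamentalWeight : u • (b.fundamentalWeight α : M) = b.fundamentalWeight α - w • R.root α
  coord_root_self : coord b α (w • R.root α) = 1
  coord_smul_self : ∀ x : M, coord b α (u • x) = coord b α x - R.coroot' α x
  coord_root_pos : ∀ i ∈ K, 0 < coord b i (w • R.root α)
  coord_root_eq_zero : ∀ i ∉ K, coord b i (w • R.root α) = 0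

section

variable {α : b.support} {K : Set b.support} {u w : R.weylGroup} (h : IsLowering b α K u w)
include h

lemma IsLowering.mem : α ∈ K := by
  by_contra hα
  exact one_ne_zero (h.coord_root_self.symm.trans (h.coord_root_eq_zero α hα))

variable [Finite ι] [R.IsCrystallographic]

lemma IsLowering.coord_mul_pairing_nonpos {i : b.support} (hi : i ∉ K) (j : b.support) :
    coord b j (w • R.root α) * R.pairing j i ≤ 0 := by
  by_cases hj : j ∈ K
  · exact mul_nonpos_of_nonneg_of_nonpos (h.coord_root_pos j hj).le
      (pairing_le_zero_of_ne b fun h' => hi (h' ▸ hj))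
  · rw [h.coord_root_eq_zero j hj, zero_mul]

lemma IsLowering.coroot'_nonpos {i : b.support} (hi : i ∉ K) : R.coroot' i (w • R.root α) ≤ 0 := by
  rw [coroot'_eq_sum_coord b]
  exact Finset.sum_nonpos fun j _ => h.coord_mul_pairing_nonpos hi j

lemma IsLowering.coroot'_neg {i j : b.support} (hi : i ∉ K) (hj : j ∈ K) (hji : R.pairing j i ≠ 0) :
    R.coroot' i (w • R.root α) < 0 := by
  rw [coroot'_eq_sum_coord b]
  refine Finset.sum_neg' (fun k _ => h.coord_mul_pairing_nonpos hi k) ⟨j, Finset.mem_univ _, ?_⟩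
  exact mul_neg_of_pos_of_neg (h.coord_root_pos j hj)
    (lt_of_le_of_ne (pairing_le_zero_of_ne b fun h' => hi (h' ▸ hj)) hji)

end

variable [Finite ι] [R.IsCrystallographic] [R.IsReduced]

lemma StrictlyDominant.eq_or_eq_ofIdx_mul {x : M} (hx : StrictlyDominant b x) {v w : R.weylGroup}
    {i : ι} {t : ℝ} (h : w • x = v • x - t • R.root i) : w = v ∨ w = ofIdx R i * v := by
  have := Fintype.ofFinite ι
  have hform : R.RootForm (v • x - t • R.root i) (v • x - t • R.root i) =
      R.RootForm (v • x) (v • x) := by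
    rw [← h, rootForm_weylGroup_smul, rootForm_weylGroup_smul]
  rcases eq_zero_or_eq_coroot'_of_rootForm_eq hform with rfl | rfl
  · exact Or.inl (hx.smul_injective (by rw [h, zero_smul, sub_zero]))
  · exact Or.inr (hx.smul_injective (by rw [h, mul_smul, ofIdx_smul]))

namespace IsAdapted

variable {K : Set b.support} {u : R.weylGroup}

lemma insert (h : IsAdapted b K u) {i : b.support} (hi : i ∉ K) :
    IsAdapted b (insert i K) (ofIdx R i * u) := by
  refine ⟨fun x hx j hj => ?_, fun x hx v hv => ?_⟩
  · rw [Set.mem_insert_iff, not_or] at hj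
    rw [mul_smul, coroot'_ofIdx_smul]
    nlinarith [h.pos x hx j hj.2, h.pos x hx i hi, pairing_le_zero_of_ne b (Ne.symm hj.1)]
  · have hne (j) (hj : j ∈ K) : j ≠ i := fun h => hi (h ▸ hj)
    have hK (j) (hj : j ∈ K) : v * u⁻¹ ∈ coordStabilizer b j := by
      refine h.mul_inv_mem x hx v (fun j hj => ?_) j hj
      rw [hv j (Set.mem_insert_of_mem _ hj), mul_smul, coord_ofIdx_smul_of_ne b (hne j hj)]
    have hvu : (v * u⁻¹) • u • x = v • x := by rw [mul_smul, inv_smul_smul]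
    have hvi := hv i (Set.mem_insert _ _)
    rw [mul_smul, coord_ofIdx_smul_self, ← hvu] at hvi
    rw [mul_inv_rev, ofIdx_inv, ← mul_assoc]
    rintro j (rfl | hj)
    · rcases mem_coordStabilizer_or_coord_smul_le b hK (h.pos x hx) j with h' | h'
      · linarith [h' (u • x), h.pos x hx j hi]
      · exact h'.2 hvi
    · exact mul_mem (hK j hj) (ofIdx_mem_coordStabilizer b (hne j hj))

lemma mul_inv_mem_parabolic (h : IsAdapted b K u) {J : Set b.support} (hJ : Disjoint K J) {x : M}
    (hx : StrictlyDominant b x) {v : R.weylGroup}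
    (hv : ∀ i ∉ J, coord b i (v • x) = coord b i (u • x)) : v * u⁻¹ ∈ parabolic b J := by
  have hK := h.mul_inv_mem x hx v fun i hi => hv i (Set.disjoint_left.1 hJ hi)
  refine mem_parabolic_of_mem_coordStabilizer b fun i hi => ?_
  by_cases hiK : i ∈ K
  · exact hK i hiK
  refine (mem_coordStabilizer_or_coord_smul_le b hK (h.pos x hx) i).resolve_right fun h' => ?_
  have hvu : (v * u⁻¹) • u • x = v • x := by rw [mul_smul, inv_smul_smul]
  rw [hvu, hv i hi] at h'
  linarith [h'.1, h.pos x hx i hiK]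

end IsAdapted

namespace IsLowering

lemma singleton (α : b.support) : IsLowering b α {α} (ofIdx R α) 1 where
  isAdapted := by simpa using IsAdapted.empty_one.insert (i := α) (by simp)
  smul_fundamentalWeight := by rw [ofIdx_smul_fundamentalWeight_self, one_smul]
  coord_root_self := by rw [one_smul, WeylCharacter.coord_root_self]
  coord_smul_self := coord_ofIdx_smul_self b α
  coord_root_pos := by
    rintro i rfl
    rw [one_smul, WeylCharacter.coord_root_self]
    exact one_pos
  coord_root_eq_zero i hi := by rw [one_smul, coord_root_of_ne b hi]

variable {α : b.support} {K : Set b.support} {u w : R.weylGroup} (h : IsLowering b α K u w)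
include h

lemma insert {i : b.support} (hi : i ∉ K) (hneg : R.coroot' i (w • R.root α) < 0) :
    IsLowering b α (insert i K) (ofIdx R i * u) (ofIdx R i * w) := by
  have hiα : α ≠ i := fun h' => hi (h' ▸ h.mem)
  refine ⟨h.isAdapted.insert hi, ?_, ?_, fun x => ?_, ?_, fun k hk => ?_⟩
  · rw [mul_smul, h.smul_fundamentalWeight, smul_sub, ofIdx_smul_fundamentalWeight_of_ne b hiα,
      mul_smul]
  · rw [mul_smul, coord_ofIdx_smul_of_ne b hiα, h.coord_root_self]
  · rw [mul_smul, coord_ofIdx_smul_of_ne b hiα, h.coord_smul_self]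
  · rintro k (rfl | hk)
    · rw [mul_smul, coord_ofIdx_smul_self, h.coord_root_eq_zero _ hi]
      linarith
    · rw [mul_smul, coord_ofIdx_smul_of_ne b fun h' : k = i => hi (h' ▸ hk)]
      exact h.coord_root_pos k hk
  · rw [Set.mem_insert_iff, not_or] at hk
    rw [mul_smul, coord_ofIdx_smul_of_ne b hk.1, h.coord_root_eq_zero k hk.2]

end IsLowering

lemma exists_isLowering [R.IsIrreducible] {α : b.support} {J : Set b.support} (hJ : J.Nonempty)
    (hα : α ∉ J) : ∃ (K : Set b.support) (u w : R.weylGroup), IsLowering b α K u w ∧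
      Disjoint K J ∧ ∃ i ∈ J, R.coroot' i (w • R.root α) < 0 := by
  obtain ⟨K, ⟨hKJ, u, w, h⟩, hmax⟩ :=
    (Set.toFinite {K | Disjoint K J ∧ ∃ u w, IsLowering b α K u w}).exists_maximal
      ⟨{α}, by simpa using hα, ofIdx R α, 1, IsLowering.singleton α⟩
  have hK' : K ≠ Set.univ := by
    rintro rfl
    exact hJ.ne_empty (by simpa using hKJ)
  obtain ⟨j, hj, i, hi, hji⟩ := exists_mem_notMem_pairing_ne_zero b ⟨α, h.mem⟩ hK'
  have hneg := h.coroot'_neg hi hj hji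
  refine ⟨K, u, w, h, hKJ, i, ?_, hneg⟩
  by_contra hiJ
  exact hi (hmax ⟨Set.disjoint_insert_left.2 ⟨hiJ, hKJ⟩, _, _, h.insert hi hneg⟩
    (Set.subset_insert i K) (Set.mem_insert i K))

end Adapted

section Twist

variable {A B P Q G : Type*} [CommSemiring A] [CommSemiring B] [Algebra A B]

section AddMonoid

variable [AddMonoid P] [AddMonoid Q] [AddMonoid G]

/-- The homomorphism of monoid algebras `e^p ↦ χ(p) e^{g(p)}`. -/
def twist (χ : Multiplicative P →* B) (g : P →+ G) :
    AddMonoidAlgebra A P →ₐ[A] AddMonoidAlgebra B G :=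
  lift A (AddMonoidAlgebra B G) P
    { toFun := fun p => single (g p.toAdd) (χ p)
      map_one' := by simp [one_def]
      map_mul' := fun p q => by simp [single_mul_single] }

variable (χ : Multiplicative P →* B) (g : P →+ G)

lemma twist_single (p : P) (a : A) :
    twist χ g (single p a) = single (g p) (a • χ (.ofAdd p)) := by
  rw [twist, lift_single]
  simp [smul_single]

lemma twist_eq_sum (F : AddMonoidAlgebra A P) :
    twist χ g F = ∑ p ∈ F.coeff.support, single (g p) (F.coeff p • χ (.ofAdd p)) := by
  conv_lhs => rw [← sum_coeff_single F, Finsupp.sum, map_sum]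
  simp_rw [twist_single]

lemma coeff_twist [DecidableEq G] (F : AddMonoidAlgebra A P) (x : G) :
    (twist χ g F).coeff x = ∑ p ∈ F.coeff.support with g p = x, F.coeff p • χ (.ofAdd p) := by
  rw [twist_eq_sum, coeff_sum, Finsupp.finsetSum_apply, Finset.sum_filter]
  simp_rw [coeff_single, Finsupp.single_apply]

variable {χ g} in
lemma exists_of_coeff_twist_ne_zero {F : AddMonoidAlgebra A P} {x : G}
    (h : (twist χ g F).coeff x ≠ 0) : ∃ p, F.coeff p ≠ 0 ∧ g p = x := by
  classical
  rw [coeff_twist] at h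
  obtain ⟨p, hp, -⟩ := Finset.exists_ne_zero_of_sum_ne_zero h
  rw [Finset.mem_filter, Finsupp.mem_support_iff] at hp
  exact ⟨p, hp⟩

lemma twist_mapDomainRingHom (h : Q →+ P) (F : AddMonoidAlgebra A Q) :
    twist χ g (mapDomainRingHom A h F) =
      twist (χ.comp (AddMonoidHom.toMultiplicative h)) (g.comp h) F := by
  induction F using induction_linear with
  | zero => simp
  | add x y hx hy => rw [map_add, map_add, map_add, hx, hy]
  | single p a => simp [twist_single, mapDomainRingHom]

lemma map_coeff_twist {C : Type*} [CommSemiring C] [Algebra A C] (φ : B →ₐ[A] C)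
    (F : AddMonoidAlgebra A P) (x : G) :
    φ ((twist χ g F).coeff x) = (twist ((φ : B →* C).comp χ) g F).coeff x := by
  classical
  rw [coeff_twist, coeff_twist, map_sum]
  simp

end AddMonoid

lemma twist_eq_zero_of_factor {G' : Type*} [AddGroup P] [AddGroup G] [AddGroup G']
    {χ χ' : Multiplicative P →* B} {g : P →+ G} {g' : P →+ G'}
    (h : ∀ p, g p = 0 → χ' (.ofAdd p) = χ (.ofAdd p) ∧ g' p = 0)
    {F : AddMonoidAlgebra A P} (hF : twist χ g F = 0) : twist χ' g' F = 0 := by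
  classical
  have hχ {p q : P} (hpq : g p = g q) :
      χ' (.ofAdd p) = χ' (.ofAdd q) * χ (.ofAdd (-q)) * χ (.ofAdd p) := by
    rw [mul_assoc, ← map_mul, ← ofAdd_add, ← (h (-q + p) (by simp [hpq])).1, ← map_mul,
      ← ofAdd_add, add_neg_cancel_left]
  have hg {p q : P} (hpq : g p = g q) : g' p = g' q := by
    have := (h (-q + p) (by simp [hpq])).2
    rw [map_add, map_neg, neg_add_eq_zero] at this
    exact this.symm
  rw [twist_eq_sum, ← Finset.sum_fiberwise_of_maps_to (g := g) (t := F.coeff.support.image g)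
    fun p hp => Finset.mem_image_of_mem g hp]
  refine Finset.sum_eq_zero fun x hx => ?_
  obtain ⟨q, -, rfl⟩ := Finset.mem_image.1 hx
  have hcoeff : (twist χ g F).coeff (g q) = 0 := by rw [hF]; rfl
  have hterm : ∀ p ∈ F.coeff.support.filter (fun p => g p = g q),
      single (g' p) (F.coeff p • χ' (.ofAdd p)) = singleAddHom (g' q)
        (χ' (.ofAdd q) * χ (.ofAdd (-q)) * (F.coeff p • χ (.ofAdd p))) := by
    intro p hp
    have hpq := (Finset.mem_filter.1 hp).2
    rw [singleAddHom_apply, hg hpq, hχ hpq, mul_smul_comm]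
  rw [coeff_twist] at hcoeff
  rw [Finset.sum_congr rfl hterm, ← map_sum, ← Finset.mul_sum, hcoeff, mul_zero, map_zero]

/-- The character `p ↦ z ^ f(p)`. -/
def powChar {B P : Type*} [Monoid B] [AddGroup P] (z : Bˣ) (f : P →+ ℤ) : Multiplicative P →* B :=
  (Units.coeHom B).comp ((zpowersHom Bˣ z).comp (AddMonoidHom.toMultiplicative f))

lemma powChar_apply {B P : Type*} [Monoid B] [AddGroup P] (z : Bˣ) (f : P →+ ℤ) (p : P) :
    powChar z f (.ofAdd p) = ((z ^ f p : Bˣ) : B) := rfl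

end Twist

section LeadingExponents

variable {A B P G : Type*}

lemma exists_isGreatest_image_support [LinearOrder G] [Semiring A] (f : P → G)
    {F : AddMonoidAlgebra A P} (hF : F ≠ 0) :
    ∃ p, F.coeff p ≠ 0 ∧ IsGreatest (f '' F.coeff.support) (f p) := by
  have hne : F.coeff.support.Nonempty := by simpa [Finsupp.support_nonempty_iff] using hF
  obtain ⟨p, hp, hmax⟩ := F.coeff.support.exists_max_image f hne
  exact ⟨p, Finsupp.mem_support_iff.1 hp, Set.mem_image_of_mem f hp,
    Set.forall_mem_image.2 hmax⟩

variable [AddCommGroup P]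

lemma coeff_coeff_twist_of [AddMonoid G] [CommSemiring A] (f : P →+ G)
    (F : AddMonoidAlgebra A P) (p : P) :
    ((twist (of A P) f F).coeff (f p)).coeff p = F.coeff p := by
  classical
  rw [coeff_twist, coeff_sum, Finsupp.finsetSum_apply]
  simp only [of_apply, smul_single, coeff_single, Finsupp.single_apply, toAdd_ofAdd]
  rw [Finset.sum_ite_eq']
  simp +contextual [eq_comm]

lemma mem_upperBounds_support_twist [Preorder G] [AddMonoid G] [CommSemiring A] [CommSemiring B]
    [Algebra A B] {f : P →+ G} {F : AddMonoidAlgebra A P} {a : G}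
    (h : a ∈ upperBounds (f '' F.coeff.support)) (χ : Multiplicative P →* B) :
    a ∈ upperBounds ((twist χ f F).coeff.support : Set G) := by
  intro x hx
  obtain ⟨p, hp, rfl⟩ := exists_of_coeff_twist_ne_zero (Finsupp.mem_support_iff.1 hx)
  exact h (Set.mem_image_of_mem f (Finsupp.mem_support_iff.2 hp))

variable [AddCommGroup G] [LinearOrder G] [IsOrderedAddMonoid G]

section Bounds

variable [Semiring B] {F₁ F₂ : AddMonoidAlgebra B G} {a₁ a₂ : G}
  (h₁ : a₁ ∈ upperBounds (F₁.coeff.support : Set G))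
  (h₂ : a₂ ∈ upperBounds (F₂.coeff.support : Set G))
include h₁ h₂

lemma coeff_mul_of_mem_upperBounds :
    (F₁ * F₂).coeff (a₁ + a₂) = F₁.coeff a₁ * F₂.coeff a₂ := by
  refine coeff_mul_add_of_uniqueAdd fun x y hx hy hxy => ?_
  obtain rfl : x = a₁ := le_antisymm (h₁ hx) <| le_of_not_gt fun hlt =>
    (add_lt_add_of_lt_of_le hlt (h₂ hy)).ne hxy
  exact ⟨rfl, add_left_cancel hxy⟩

lemma add_mem_upperBounds_support_mul :
    a₁ + a₂ ∈ upperBounds ((F₁ * F₂).coeff.support : Set G) := by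
  classical
  intro x hx
  obtain ⟨y, hy, z, hz, rfl⟩ := Finset.mem_add.1 (support_coeff_mul_subset F₁ F₂ hx)
  exact add_le_add (h₁ hy) (h₂ hz)

end Bounds

lemma exists_coeff_eq_mul_of_isGreatest [Semiring B] [NoZeroDivisors B]
    {F₁ F₂ : AddMonoidAlgebra B G} {a a₁ : G}
    (h₁ : IsGreatest (F₁.coeff.support : Set G) a₁)
    (h : IsGreatest ((F₁ * F₂).coeff.support : Set G) a) :
    ∃ a₂, (F₁ * F₂).coeff a = F₁.coeff a₁ * F₂.coeff a₂ := by
  have hF₂ : F₂ ≠ 0 := by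
    rintro rfl
    simpa using h.1
  obtain ⟨a₂, ha₂, hmax⟩ := exists_isGreatest_image_support id hF₂
  rw [Set.image_id] at hmax
  have hcoeff := coeff_mul_of_mem_upperBounds h₁.2 hmax.2
  have hne : (F₁ * F₂).coeff (a₁ + a₂) ≠ 0 :=
    hcoeff ▸ mul_ne_zero (Finsupp.mem_support_iff.1 h₁.1) ha₂
  refine ⟨a₂, hcoeff ▸ congrArg _ (h.unique ⟨Finsupp.mem_support_iff.2 hne, ?_⟩)⟩
  exact add_mem_upperBounds_support_mul h₁.2 hmax.2

-- Twisting by the universal character `p ↦ e^p` turns `f` into a grading of `A[P]` whose graded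
-- pieces are the coefficients, so the claim is the multiplicativity of leading coefficients.
lemma isGreatest_image_support_mul [CommRing A] [IsDomain A]
    [TwoUniqueSums P] {f : P →+ G} {F₁ F₂ : AddMonoidAlgebra A P} {a₁ a₂ : G}
    (h₁ : IsGreatest (f '' F₁.coeff.support) a₁)
    (h₂ : IsGreatest (f '' F₂.coeff.support) a₂) :
    IsGreatest (f '' (F₁ * F₂).coeff.support) (a₁ + a₂) := by
  have hne {F : AddMonoidAlgebra A P} {a : G} (h : IsGreatest (f '' F.coeff.support) a) :
      (twist (of A P) f F).coeff a ≠ 0 := by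
    obtain ⟨p, hp, rfl⟩ := h.1
    intro h0
    have hcoeff := coeff_coeff_twist_of f F p
    rw [h0] at hcoeff
    exact Finsupp.mem_support_iff.1 hp hcoeff.symm
  have hb₁ := mem_upperBounds_support_twist h₁.2 (of A P)
  have hb₂ := mem_upperBounds_support_twist h₂.2 (of A P)
  have hcoeff := coeff_mul_of_mem_upperBounds hb₁ hb₂
  have hbound := add_mem_upperBounds_support_mul hb₁ hb₂
  rw [← map_mul] at hcoeff hbound
  constructor
  · obtain ⟨p, hp, hpa⟩ :=
      exists_of_coeff_twist_ne_zero (hcoeff ▸ mul_ne_zero (hne h₁) (hne h₂))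
    exact ⟨p, Finsupp.mem_support_iff.2 hp, hpa⟩
  · rintro _ ⟨p, hp, rfl⟩
    refine hbound (Finsupp.mem_support_iff.2 fun h0 => Finsupp.mem_support_iff.1 hp ?_)
    rw [← coeff_coeff_twist_of f (F₁ * F₂) p, h0]
    rfl

end LeadingExponents

section Weights

variable {ι M N : Type*} [AddCommGroup M] [Module ℝ M] [AddCommGroup N] [Module ℝ N]
  (R : RootPairing ι ℝ M N)

instance : TwoUniqueSums R.weightLattice :=
  let := Module.compHom M (algebraMap ℚ ℝ)
  TwoUniqueSums.of_injective_addHom R.weightLattice.subtype.toAddHom Subtype.val_injective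
    inferInstance

lemma isUnit_weylSign (w : R.weylGroup) : IsUnit (R.weylSign w) :=
  .of_mul_eq_one (R.weylSign w⁻¹) (by rw [← weylSign_mul, mul_inv_cancel, weylSign_one])

lemma weylSign_ofIdx_mul [Finite ι] [R.IsRootSystem] (i : ι) (w : R.weylGroup) :
    R.weylSign (ofIdx R i * w) = -R.weylSign w := by
  rw [weylSign_mul, weylSign_reflection, neg_one_mul]

lemma ofIdx_mul_ne_self [Finite ι] [R.IsRootSystem] (i : ι) (w : R.weylGroup) :
    ofIdx R i * w ≠ w := fun h =>
  (isUnit_weylSign R w).ne_zero <| self_eq_neg.1 <| by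
    rw [← weylSign_ofIdx_mul R i w, h]

/-- The coefficient `x ↦ ⟨αᵢ*, x⟩` of weights, as an additive map. -/
def weightCoeffHom (i : ι) : R.weightLattice →+ ℤ :=
  AddMonoidHom.mk' (R.weightCoeff i) fun x y => by
    have h := R.weightCoeff_spec i (x + y)
    rw [AddSubgroup.coe_add, map_add, R.weightCoeff_spec, R.weightCoeff_spec] at h
    exact_mod_cast h.symm

lemma weightCoeffHom_apply (i : ι) (x : R.weightLattice) :
    weightCoeffHom R i x = R.weightCoeff i x := rfl

lemma weightCoeffHom_cast (i : ι) (x : R.weightLattice) :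
    ((weightCoeffHom R i x : ℤ) : ℝ) = R.coroot' i (x : M) :=
  (R.weightCoeff_spec i x).symm

lemma weightCoeffHom_eq_iff {i : ι} {x : R.weightLattice} {n : ℤ} :
    weightCoeffHom R i x = n ↔ R.coroot' i (x : M) = n := by
  rw [← weightCoeffHom_cast, Int.cast_inj]

variable [R.IsCrystallographic]

lemma coe_weylAct (w : R.weylGroup) (x : R.weightLattice) :
    ((R.weylAct w x : R.weightLattice) : M) = w • (x : M) := rfl

lemma weylAct_mul (v w : R.weylGroup) (x : R.weightLattice) :
    R.weylAct (v * w) x = R.weylAct v (R.weylAct w x) :=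
  Subtype.ext (mul_smul v w (x : M))

lemma weylAct_one (x : R.weightLattice) : R.weylAct 1 x = x :=
  Subtype.ext (one_smul _ (x : M))

lemma weylAct_injective (w : R.weylGroup) : Function.Injective (R.weylAct w) :=
  Function.LeftInverse.injective (g := R.weylAct w⁻¹) fun x => by
    rw [← weylAct_mul, inv_mul_cancel, weylAct_one]

lemma weightCoeffHom_weylGroupToPerm_weylAct (w : R.weylGroup) (i : ι) (x : R.weightLattice) :
    weightCoeffHom R (R.weylGroupToPerm w i) (R.weylAct w x) = weightCoeffHom R i x := by
  rw [weightCoeffHom_eq_iff, coe_weylAct, coroot'_weylGroupToPerm_smul, weightCoeffHom_cast]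

lemma weightCoeffHom_weylAct_ofIdx (i : ι) (x : R.weightLattice) :
    weightCoeffHom R i (R.weylAct (ofIdx R i) x) = -weightCoeffHom R i x := by
  rw [weightCoeffHom_eq_iff, coe_weylAct, coroot'_ofIdx_smul, R.pairing_same, Int.cast_neg,
    weightCoeffHom_cast]
  ring

lemma mapDomainRingHom_weylAct {A : Type*} [CommRing A] {F : AddMonoidAlgebra A R.weightLattice}
    (hF : F ∈ R.weylInvariants A) (w : R.weylGroup) :
    mapDomainRingHom A (R.weylAct w) F = F := by
  rw [weylInvariants, Subring.mem_iInf] at hF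
  exact hF w

lemma coeff_weylAct {A : Type*} [CommRing A] {F : AddMonoidAlgebra A R.weightLattice}
    (hF : F ∈ R.weylInvariants A) (w : R.weylGroup) (x : R.weightLattice) :
    F.coeff (R.weylAct w x) = F.coeff x := by
  conv_lhs => rw [← mapDomainRingHom_weylAct R hF w]
  exact Finsupp.mapDomain_apply (weylAct_injective R w) _ _

end Weights

section VanishesAt

variable {ι M N A B G : Type*} [AddCommGroup M] [Module ℝ M] [AddCommGroup N] [Module ℝ N]
  [CommRing A] [CommRing B] [Algebra A B] [AddCommGroup G] {R : RootPairing ι ℝ M N}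

variable (R) in
/-- The image of `F` under `e^x ↦ z^⟨x, αᵢ*⟩ e^x̄`, where `x̄` is the class of `x` modulo the line
spanned by the `i`-th root, is zero. -/
def VanishesAt (i : ι) (z : Bˣ) (F : AddMonoidAlgebra A R.weightLattice) : Prop :=
  twist (powChar z (weightCoeffHom R i))
    ((Submodule.span ℝ {R.root i}).mkQ.toAddMonoidHom.comp R.weightLattice.subtype) F = 0

lemma vanishesAt_iff_twist_eq_zero {i : ι} {z : Bˣ} {g : R.weightLattice →+ G}
    (hg : ∀ x, g x = 0 ↔ (x : M) ∈ Submodule.span ℝ {R.root i})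
    {F : AddMonoidAlgebra A R.weightLattice} :
    VanishesAt R i z F ↔ twist (powChar z (weightCoeffHom R i)) g F = 0 := by
  constructor
  · refine twist_eq_zero_of_factor fun p hp => ⟨rfl, (hg p).2 ?_⟩
    simpa using hp
  · refine twist_eq_zero_of_factor fun p hp => ⟨rfl, ?_⟩
    simpa using (hg p).1 hp

lemma VanishesAt.weylGroupToPerm [R.IsCrystallographic] {i : ι} {z : Bˣ}
    {F : AddMonoidAlgebra A R.weightLattice} (h : VanishesAt R i z F)
    (hF : F ∈ R.weylInvariants A) (w : R.weylGroup) :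
    VanishesAt R (R.weylGroupToPerm w i) z F := by
  rw [VanishesAt, ← mapDomainRingHom_weylAct R hF w, twist_mapDomainRingHom]
  refine twist_eq_zero_of_factor (fun p hp => ⟨?_, ?_⟩) h
  · change powChar z _ (.ofAdd (R.weylAct w p)) = _
    rw [powChar_apply, powChar_apply, weightCoeffHom_weylGroupToPerm_weylAct]
  · have hp' : (p : M) ∈ Submodule.span ℝ {R.root i} := by simpa using hp
    obtain ⟨a, ha⟩ := Submodule.mem_span_singleton.1 hp'
    refine (Submodule.Quotient.mk_eq_zero _).2 (Submodule.mem_span_singleton.2 ⟨a, ?_⟩)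
    rw [AddSubgroup.subtype_apply, coe_weylAct, ← ha, smul_comm w a, ← root_weylGroupToPerm]

end VanishesAt

section SchurWeyl

variable {ι M N A B G : Type*} [AddCommGroup M] [Module ℝ M] [AddCommGroup N] [Module ℝ N]
  [CommRing A] [CommRing B] [Algebra A B] [AddCommGroup G] {R : RootPairing ι ℝ M N}
  [R.IsCrystallographic] [Finite ι] [R.IsRootSystem]
  {χ : Multiplicative R.weightLattice →* B} {g : R.weightLattice →+ G} {x : R.weightLattice}

lemma twist_schurWeyl [Fintype R.weylGroup] (χ : Multiplicative R.weightLattice →* B)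
    (g : R.weightLattice →+ G) (x : R.weightLattice) :
    twist χ g (R.schurWeyl A x) = ∑ w : R.weylGroup,
      single (g (R.weylAct w x)) ((R.weylSign w : B) * χ (.ofAdd (R.weylAct w x))) := by
  rw [schurWeyl, map_sum]
  refine Finset.sum_congr (by ext; simp) fun w _ => ?_
  rw [twist_single, Algebra.smul_def, map_intCast]

lemma coeff_twist_schurWeyl [Fintype R.weylGroup] [DecidableEq G]
    (χ : Multiplicative R.weightLattice →* B) (g : R.weightLattice →+ G) (x : R.weightLattice)
    (a : G) :
    (twist χ g (R.schurWeyl A x)).coeff a = ∑ w : R.weylGroup with g (R.weylAct w x) = a,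
      (R.weylSign w : B) * χ (.ofAdd (R.weylAct w x)) := by
  rw [twist_schurWeyl, coeff_sum, Finsupp.finsetSum_apply, Finset.sum_filter]
  simp_rw [coeff_single, Finsupp.single_apply]

lemma exists_of_coeff_twist_schurWeyl_ne_zero {a : G}
    (h : (twist χ g (R.schurWeyl A x)).coeff a ≠ 0) : ∃ w, g (R.weylAct w x) = a := by
  classical
  let := Fintype.ofFinite R.weylGroup
  rw [coeff_twist_schurWeyl] at h
  obtain ⟨w, hw, -⟩ := Finset.exists_ne_zero_of_sum_ne_zero h
  exact ⟨w, by simpa using hw⟩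

-- The terms of `w` and `sᵢ w` cancel.
lemma twist_schurWeyl_eq_zero (i : ι)
    (hχ : ∀ w : R.weylGroup, χ (.ofAdd (R.weylAct (ofIdx R i) (R.weylAct w x))) =
      χ (.ofAdd (R.weylAct w x)))
    (hg : ∀ y, g (R.weylAct (ofIdx R i) y) = g y) : twist χ g (R.schurWeyl A x) = 0 := by
  let := Fintype.ofFinite R.weylGroup
  rw [twist_schurWeyl]
  refine Finset.sum_involution (fun w _ => ofIdx R i * w) (fun w _ => ?_)
    (fun w _ _ => ofIdx_mul_ne_self R i w) (fun w _ => Finset.mem_univ _) fun w _ => ?_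
  · rw [weylAct_mul, hg, hχ, weylSign_ofIdx_mul, ← single_add]
    simp
  · rw [← mul_assoc, ofIdx_mul_self, one_mul]

lemma exists_of_coeff_schurWeyl_ne_zero {x y : R.weightLattice}
    (h : (R.schurWeyl A x).coeff y ≠ 0) : ∃ w, R.weylAct w x = y := by
  classical
  rw [schurWeyl, coeff_sum, Finsupp.finsetSum_apply] at h
  obtain ⟨w, -, hw⟩ := Finset.exists_ne_zero_of_sum_ne_zero h
  rw [coeff_single, Finsupp.single_apply, ite_ne_right_iff] at hw
  exact ⟨w, hw.1⟩

end SchurWeyl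

section DominantWeights

variable {ι M N : Type*} [AddCommGroup M] [Module ℝ M] [AddCommGroup N] [Module ℝ N]
  {R : RootPairing ι ℝ M N} (b : R.Base)

lemma dominantRegular_iff_strictlyDominant {x : R.weightLattice} :
    b.DominantRegular x ↔ StrictlyDominant b (x : M) := by
  simp only [DominantRegular, StrictlyDominant, Subtype.forall, weightCoeff_spec, Int.cast_pos]

variable [R.IsRootSystem]

lemma weightCoeffHom_fundamentalWeight [DecidableEq b.support] (i j : b.support) :
    weightCoeffHom R j (b.fundamentalWeight i) = if i = j then 1 else 0 := by
  rw [weightCoeffHom_eq_iff, coroot'_fundamentalWeight]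
  split_ifs <;> simp

lemma weightCoeffHom_rho (i : b.support) : weightCoeffHom R i b.rho = 1 := by
  classical
  rw [rho, map_sum]
  simp [weightCoeffHom_fundamentalWeight]

lemma weightCoeffHom_nsmul_rho (i : b.support) (d : ℕ) : weightCoeffHom R i (d • b.rho) = d := by
  rw [map_nsmul, weightCoeffHom_rho, nsmul_one]

lemma dominantRegular_nsmul_rho {d : ℕ} (hd : 0 < d) : b.DominantRegular (d • b.rho) := by
  intro i hi
  rw [← weightCoeffHom_apply, weightCoeffHom_nsmul_rho b ⟨i, hi⟩]
  exact_mod_cast hd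

end DominantWeights

section LexHom

variable {ι M N : Type*} [AddCommGroup M] [Module ℝ M] [AddCommGroup N] [Module ℝ N]
  {R : RootPairing ι ℝ M N} [R.IsRootSystem] (b : R.Base)

open Classical in
/-- The `i`-th simple coordinate if `i ∉ J`, and zero if `i ∈ J`: together these are the coordinates
modulo the span of the simple roots in `J`. -/
def coordMod (J : Set b.support) (i : b.support) : M →ₗ[ℝ] ℝ := if i ∈ J then 0 else coord b i

/-- An additive map to a linearly ordered group which compares weights modulo the span of the simple
roots in `J` by their coordinates lexicographically, starting with the `α`-coordinate (which thus
occurs twice). -/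
def lexHom (α : b.support) (J : Set b.support) :
    R.weightLattice →+ Lex (Fin (Fintype.card b.support + 1) → ℝ) where
  toFun x := toLex fun k => coordMod b J
    (Fin.cons (α := fun _ => b.support) α (Fintype.equivFin b.support).symm k) x
  map_zero' := by simp [← Pi.zero_def]
  map_add' x y := by simp [← toLex_add, Pi.add_def]

variable {b} {α : b.support} {J : Set b.support} {x y : R.weightLattice}

lemma coordMod_of_notMem {i : b.support} (hi : i ∉ J) : coordMod b J i = coord b i := if_neg hi

lemma coordMod_of_mem {i : b.support} (hi : i ∈ J) : coordMod b J i = 0 := if_pos hi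

lemma lexHom_eq_iff :
    lexHom b α J x = lexHom b α J y ↔ ∀ i ∉ J, coord b i (x : M) = coord b i (y : M) := by
  constructor
  · intro h i hi
    simpa [coordMod_of_notMem hi] using
      congrFun (toLex.injective h) (Fin.succ (Fintype.equivFin b.support i))
  · intro h
    refine congrArg toLex (funext fun k => ?_)
    generalize Fin.cons (α := fun _ => b.support) α _ k = i
    by_cases hi : i ∈ J
    · rw [coordMod_of_mem hi, LinearMap.zero_apply, LinearMap.zero_apply]
    · rw [coordMod_of_notMem hi, h i hi]

lemma lexHom_le (h : ∀ i ∉ J, coord b i (x : M) ≤ coord b i (y : M)) :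
    lexHom b α J x ≤ lexHom b α J y := by
  refine Pi.toLex_monotone fun k => ?_
  generalize Fin.cons (α := fun _ => b.support) α _ k = i
  by_cases hi : i ∈ J
  · rw [coordMod_of_mem hi, LinearMap.zero_apply, LinearMap.zero_apply]
  · rw [coordMod_of_notMem hi]
    exact h i hi

lemma coord_le_of_lexHom_le (hα : α ∉ J) (h : lexHom b α J x ≤ lexHom b α J y) :
    coord b α (x : M) ≤ coord b α (y : M) := by
  have h₀ := Pi.apply_le_of_toLex (i := 0) h fun j hj => absurd hj (Fin.not_lt_zero j)
  simpa [coordMod_of_notMem hα] using h₀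

lemma lexHom_empty_injective : Function.Injective (lexHom b α ∅) := fun _ _ h =>
  Subtype.ext (ext_coord b fun i => lexHom_eq_iff.1 h i (Set.notMem_empty i))

lemma lexHom_singleton_eq_iff {β : b.support} :
    lexHom b α {β} x = lexHom b α {β} y ↔ ∃ t : ℝ, (x : M) = y - t • R.root β := by
  rw [lexHom_eq_iff]
  constructor
  · intro h
    refine ⟨coord b β (y : M) - coord b β (x : M), ext_coord b fun i => ?_⟩
    rcases eq_or_ne i β with rfl | hi
    · simp [coord_root_self]
    · simp [coord_root_of_ne b hi, h i hi]
  · rintro ⟨t, ht⟩ i hi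
    simp [ht, coord_root_of_ne b (i := i) (j := β) hi]

lemma vanishesAt_iff_twist_lexHom {A B : Type*} [CommRing A] [CommRing B] [Algebra A B]
    {β : b.support} {z : Bˣ} {F : AddMonoidAlgebra A R.weightLattice} :
    VanishesAt R (β : ι) z F ↔
      twist (powChar z (weightCoeffHom R β)) (lexHom b α {β}) F = 0 := by
  refine vanishesAt_iff_twist_eq_zero fun x => ?_
  rw [← map_zero (lexHom b α {β}), eq_comm, lexHom_singleton_eq_iff, Submodule.mem_span_singleton]
  simp only [AddSubgroup.coe_zero, eq_comm (a := (0 : M)), sub_eq_zero, eq_comm (b := (x : M))]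

end LexHom

section AntisymmPow

variable {B : Type*} [CommRing B] {z : Bˣ} {n : ℤ}

/-- The value `z ^ n - z ^ (-n)`, by which `S(x)` specializes in rank one. -/
def antisymmPow (z : Bˣ) (n : ℤ) : B := ((z ^ n : Bˣ) : B) - ((z ^ (-n) : Bˣ) : B)

lemma antisymmPow_eq_zero_iff : antisymmPow z n = 0 ↔ z ^ (2 * n) = 1 := by
  rw [antisymmPow, sub_eq_zero, Units.val_inj, zpow_neg, eq_inv_iff_mul_eq_one, ← zpow_add,
    two_mul]

end AntisymmPow

section Leading

variable {ι M N A B : Type*} [AddCommGroup M] [Module ℝ M] [AddCommGroup N] [Module ℝ N]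
  {R : RootPairing ι ℝ M N} [R.IsRootSystem] (b : R.Base) [CommRing A] [CommRing B] [Algebra A B]

/-- `x` is an exponent of `F` which is maximal for all the orders given by `lexHom`. -/
structure IsLeading (α : b.support) (F : AddMonoidAlgebra A R.weightLattice)
    (x : R.weightLattice) : Prop where
  coeff_ne_zero : F.coeff x ≠ 0
  mem_upperBounds (J : Set b.support) :
    lexHom b α J x ∈ upperBounds (lexHom b α J '' F.coeff.support)

/-- The coefficient of the image of `F` modulo the simple root `β`, under `e^x ↦ z^⟨x, β*⟩ e^x̄`, at
the class of `x`. -/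
def leadingValue (α β : b.support) (z : Bˣ) (F : AddMonoidAlgebra A R.weightLattice)
    (x : R.weightLattice) : B :=
  (twist (powChar z (weightCoeffHom R β)) (lexHom b α {β}) F).coeff (lexHom b α {β} x)

variable {b} {α : b.support} {F F₁ F₂ : AddMonoidAlgebra A R.weightLattice}
  {x y : R.weightLattice}

namespace IsLeading

lemma isGreatest (h : IsLeading b α F x) (J : Set b.support) :
    IsGreatest (lexHom b α J '' F.coeff.support) (lexHom b α J x) :=
  ⟨Set.mem_image_of_mem _ (Finsupp.mem_support_iff.2 h.coeff_ne_zero), h.mem_upperBounds J⟩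

lemma unique (hx : IsLeading b α F x) (hy : IsLeading b α F y) : x = y :=
  lexHom_empty_injective ((hx.isGreatest ∅).unique (hy.isGreatest ∅))

lemma coeff_mul (hx : IsLeading b α F₁ x) (hy : IsLeading b α F₂ y) :
    (F₁ * F₂).coeff (x + y) = F₁.coeff x * F₂.coeff y := by
  refine coeff_mul_add_of_uniqueAdd fun p q hp hq hpq => ?_
  have hsum := congrArg (lexHom b α ∅) hpq
  rw [map_add, map_add, add_eq_add_iff_eq_and_eq (hx.mem_upperBounds ∅ ⟨p, hp, rfl⟩)
    (hy.mem_upperBounds ∅ ⟨q, hq, rfl⟩)] at hsum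
  exact hsum.imp (@lexHom_empty_injective _ _ _ _ _ _ _ _ _ _ _ _ _)
    (@lexHom_empty_injective _ _ _ _ _ _ _ _ _ _ _ _ _)

lemma mul [IsDomain A] (hx : IsLeading b α F₁ x) (hy : IsLeading b α F₂ y) :
    IsLeading b α (F₁ * F₂) (x + y) where
  coeff_ne_zero := by
    rw [hx.coeff_mul hy]
    exact mul_ne_zero hx.coeff_ne_zero hy.coeff_ne_zero
  mem_upperBounds J := by
    rw [map_add]
    exact (isGreatest_image_support_mul (hx.isGreatest J) (hy.isGreatest J)).2

lemma leadingValue_mul (hx : IsLeading b α F₁ x) (hy : IsLeading b α F₂ y) (β : b.support)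
    (z : Bˣ) :
    leadingValue b α β z (F₁ * F₂) (x + y) =
      leadingValue b α β z F₁ x * leadingValue b α β z F₂ y := by
  rw [leadingValue, map_mul, map_add]
  exact coeff_mul_of_mem_upperBounds (mem_upperBounds_support_twist (hx.mem_upperBounds {β}) _)
    (mem_upperBounds_support_twist (hy.mem_upperBounds {β}) _)

lemma exists_of_mul [IsDomain A] (h : IsLeading b α (F₁ * F₂) x) :
    ∃ y z, IsLeading b α F₁ y ∧ IsLeading b α F₂ z ∧ y + z = x := by
  have hne : F₁ * F₂ ≠ 0 := fun h₀ => h.coeff_ne_zero (by rw [h₀]; rfl)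
  have hF₁ := left_ne_zero_of_mul hne
  have hF₂ := right_ne_zero_of_mul hne
  obtain ⟨y, hy₀, hy⟩ := exists_isGreatest_image_support (lexHom b α ∅) hF₁
  obtain ⟨z, hz₀, hz⟩ := exists_isGreatest_image_support (lexHom b α ∅) hF₂
  have hyz : y + z = x := lexHom_empty_injective (b := b) (α := α) <| by
    rw [map_add]
    exact (isGreatest_image_support_mul hy hz).unique (h.isGreatest ∅)
  have hmax (J : Set b.support) :
      lexHom b α J y ∈ upperBounds (lexHom b α J '' F₁.coeff.support) ∧
        lexHom b α J z ∈ upperBounds (lexHom b α J '' F₂.coeff.support) := by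
    obtain ⟨s, -, hs⟩ := exists_isGreatest_image_support (lexHom b α J) hF₁
    obtain ⟨t, -, ht⟩ := exists_isGreatest_image_support (lexHom b α J) hF₂
    have hst := (h.isGreatest J).unique (isGreatest_image_support_mul hs ht)
    rw [← hyz, map_add, add_eq_add_iff_eq_and_eq
      (hs.2 ⟨y, Finsupp.mem_support_iff.2 hy₀, rfl⟩)
      (ht.2 ⟨z, Finsupp.mem_support_iff.2 hz₀, rfl⟩)] at hst
    exact ⟨hst.1 ▸ hs.2, hst.2 ▸ ht.2⟩
  exact ⟨y, z, ⟨hy₀, fun J => (hmax J).1⟩, ⟨hz₀, fun J => (hmax J).2⟩, hyz⟩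

end IsLeading

lemma map_leadingValue {C : Type*} [CommRing C] [Algebra A C] (φ : B →ₐ[A] C) (β : b.support)
    (z : Bˣ) (F : AddMonoidAlgebra A R.weightLattice) (x : R.weightLattice) :
    φ (leadingValue b α β z F x) = leadingValue b α β (Units.map (φ : B →* C) z) F x := by
  have h : (φ : B →* C).comp (powChar z (weightCoeffHom R β)) =
      powChar (Units.map (φ : B →* C) z) (weightCoeffHom R β) := by
    refine MonoidHom.ext fun p => ?_
    change (Units.map (φ : B →* C) (z ^ weightCoeffHom R β p.toAdd) : C) =
      ((Units.map (φ : B →* C) z ^ weightCoeffHom R β p.toAdd : Cˣ) : C)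
    rw [map_zpow]
  rw [leadingValue, map_coeff_twist, leadingValue, h]

end Leading

section LeadingSchurWeyl

variable {ι M N A B : Type*} [Finite ι] [AddCommGroup M] [Module ℝ M] [AddCommGroup N] [Module ℝ N]
  {R : RootPairing ι ℝ M N} [R.IsRootSystem] [R.IsCrystallographic] [R.IsReduced] {b : R.Base}
  [CommRing A] [CommRing B] [Algebra A B] {α : b.support} {x : R.weightLattice}

lemma coeff_schurWeyl_self (hx : b.DominantRegular x) : (R.schurWeyl A x).coeff x = 1 := by
  classical
  rw [schurWeyl, coeff_sum, Finsupp.finsetSum_apply, Finset.sum_eq_single_of_mem 1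
    (@Finset.mem_univ _ (Fintype.ofFinite _) _)]
  · rw [weylAct_one, coeff_single, Finsupp.single_eq_same, weylSign_one, Int.cast_one]
  · intro w _ hw
    rw [coeff_single, Finsupp.single_apply, if_neg]
    exact fun h => hw <| ((dominantRegular_iff_strictlyDominant b).1 hx).eq_one_of_smul_eq
      (congrArg Subtype.val h)

variable (A α) in
lemma isLeading_schurWeyl [Nontrivial A] (hx : b.DominantRegular x) :
    IsLeading b α (R.schurWeyl A x) x where
  coeff_ne_zero := by rw [coeff_schurWeyl_self hx]; exact one_ne_zero
  mem_upperBounds J := by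
    rintro _ ⟨y, hy, rfl⟩
    obtain ⟨w, rfl⟩ := exists_of_coeff_schurWeyl_ne_zero (Finsupp.mem_support_iff.1 hy)
    exact lexHom_le fun i _ =>
      ((dominantRegular_iff_strictlyDominant b).1 hx).coord_smul_le w i

-- Only `v` and `s_β v` send `x` to the class of `v x` modulo `β`.
lemma leadingValue_schurWeyl_weylAct (hx : b.DominantRegular x) (β : b.support) (v : R.weylGroup)
    (z : Bˣ) :
    leadingValue b α β z (R.schurWeyl A x) (R.weylAct v x) =
      R.weylSign v * antisymmPow z (weightCoeffHom R β (R.weylAct v x)) := by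
  classical
  let := Fintype.ofFinite R.weylGroup
  have hfiber : Finset.univ.filter (fun w : R.weylGroup =>
      lexHom b α {β} (R.weylAct w x) = lexHom b α {β} (R.weylAct v x)) =
        {v, ofIdx R β * v} := by
    ext w
    simp only [Finset.mem_filter, Finset.mem_univ, true_and, Finset.mem_insert,
      Finset.mem_singleton, lexHom_singleton_eq_iff]
    constructor
    · rintro ⟨t, ht⟩
      exact ((dominantRegular_iff_strictlyDominant b).1 hx).eq_or_eq_ofIdx_mul ht
    · rintro (rfl | rfl)
      · exact ⟨0, by simp⟩
      · exact ⟨R.coroot' β (v • (x : M)), by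
          rw [coe_weylAct, coe_weylAct, mul_smul, ofIdx_smul]⟩
  rw [leadingValue, coeff_twist_schurWeyl, hfiber,
    Finset.sum_pair (ofIdx_mul_ne_self R β v).symm, weylSign_ofIdx_mul, powChar_apply,
    powChar_apply, weylAct_mul, weightCoeffHom_weylAct_ofIdx, antisymmPow]
  push_cast
  ring

lemma leadingValue_schurWeyl_self (hx : b.DominantRegular x) (β : b.support) (z : Bˣ) :
    leadingValue b α β z (R.schurWeyl A x) x = antisymmPow z (weightCoeffHom R β x) := by
  simpa only [weylAct_one, weylSign_one, Int.cast_one, one_mul] using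
    leadingValue_schurWeyl_weylAct hx β 1 z

end LeadingSchurWeyl

section LeadingFactorization

variable {ι M N A B : Type*} [Finite ι] [AddCommGroup M] [Module ℝ M] [AddCommGroup N] [Module ℝ N]
  {R : RootPairing ι ℝ M N} [R.IsRootSystem] [R.IsCrystallographic] {b : R.Base}
  [CommRing A] [CommRing B] [Algebra A B] {α : b.support}
  {U V : AddMonoidAlgebra A R.weightLattice} {d : ℕ} {x y y' : R.weightLattice}

variable (b α) in
/-- A factorization `U V = C(x, d)` with leading exponents `y` of `U` and `y'` of `V`, where `x` is
dominant regular and `d` is positive. -/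
structure LeadingFactorization (U V : AddMonoidAlgebra A R.weightLattice) (x : R.weightLattice)
    (d : ℕ) (y y' : R.weightLattice) : Prop where
  pos : 0 < d
  dominantRegular : b.DominantRegular x
  isC : b.IsC (U * V) x d
  left : IsLeading b α U y
  right : IsLeading b α V y'
  add_eq : y + y' + d • b.rho = x

lemma LeadingFactorization.symm (h : LeadingFactorization b α U V x d y y') :
    LeadingFactorization b α V U x d y' y :=
  ⟨h.pos, h.dominantRegular, mul_comm U V ▸ h.isC, h.right, h.left, add_comm y y' ▸ h.add_eq⟩

variable [R.IsReduced] [IsDomain A]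

lemma exists_leadingFactorization (α : b.support) (hd : 0 < d) (hx : b.DominantRegular x)
    (h : b.IsC (U * V) x d) : ∃ y y', LeadingFactorization b α U V x d y y' := by
  have hlead : IsLeading b α (U * V * R.schurWeyl A (d • b.rho)) x := by
    rw [show _ = _ from h]
    exact isLeading_schurWeyl A α hx
  obtain ⟨s, t, hs, ht, hst⟩ := hlead.exists_of_mul
  obtain ⟨y, y', hy, hy', rfl⟩ := hs.exists_of_mul
  obtain rfl := ht.unique (isLeading_schurWeyl A α (dominantRegular_nsmul_rho b hd))
  exact ⟨y, y', hd, hx, h, hy, hy', hst⟩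

namespace LeadingFactorization

lemma coeff_mul_coeff (h : LeadingFactorization b α U V x d y y') :
    U.coeff y * V.coeff y' = 1 := by
  have hρ := dominantRegular_nsmul_rho b h.pos
  have hcoeff := (h.left.mul h.right).coeff_mul (isLeading_schurWeyl A α hρ)
  rw [h.add_eq, show _ = _ from h.isC, coeff_schurWeyl_self h.dominantRegular,
    h.left.coeff_mul h.right, coeff_schurWeyl_self hρ, mul_one] at hcoeff
  exact hcoeff.symm

lemma leadingValue_mul (h : LeadingFactorization b α U V x d y y') (β : b.support) (z : Bˣ) :
    leadingValue b α β z U y * leadingValue b α β z V y' * antisymmPow z d =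
      antisymmPow z (weightCoeffHom R β x) := by
  have hρ := dominantRegular_nsmul_rho b h.pos
  rw [← leadingValue_schurWeyl_self (A := A) h.dominantRegular β z, ← show _ = _ from h.isC,
    ← h.add_eq, (h.left.mul h.right).leadingValue_mul (isLeading_schurWeyl A α hρ),
    h.left.leadingValue_mul h.right, leadingValue_schurWeyl_self hρ, weightCoeffHom_nsmul_rho]

end LeadingFactorization

end LeadingFactorization

section CommGroup

variable {G : Type*} [CommGroup G] {H : Subgroup G} {S : G → Prop}

lemma mem_of_pow_mem_of_pow_mem {z : G} {m n : ℕ} (hmn : m.Coprime n) (hm : z ^ m ∈ H)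
    (hn : z ^ n ∈ H) : z ∈ H := by
  rw [← QuotientGroup.eq_one_iff, QuotientGroup.mk_pow] at hm hn
  rw [← QuotientGroup.eq_one_iff, ← pow_one (z : G ⧸ H), ← hmn.gcd_eq_one]
  exact pow_gcd_eq_one.2 ⟨hm, hn⟩

lemma exists_eq_mul_of_pow_mul_eq_one {z : G} {m n : ℕ} (hmn : m.Coprime n)
    (h : z ^ (m * n) = 1) : ∃ x y, x * y = z ∧ x ^ m = 1 ∧ y ^ n = 1 := by
  have hbezout : (n * Nat.gcdB m n + m * Nat.gcdA m n : ℤ) = 1 := by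
    rw [add_comm, ← Nat.gcd_eq_gcd_ab, hmn.gcd_eq_one, Nat.cast_one]
  refine ⟨(z ^ n) ^ Nat.gcdB m n, (z ^ m) ^ Nat.gcdA m n, ?_, ?_, ?_⟩
  · rw [← zpow_natCast, ← zpow_natCast, ← zpow_mul, ← zpow_mul, ← zpow_add, hbezout, zpow_one]
  · rw [← zpow_natCast, zpow_comm, zpow_natCast, ← pow_mul, mul_comm, h, one_zpow]
  · rw [← zpow_natCast, zpow_comm, zpow_natCast, ← pow_mul, h, one_zpow]

/-- `S` does not change, outside of `H`, under multiplication with an element of order dividing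
a prime power which divides `N`. -/
def IsPrimePowInvariant (N : ℕ) (H : Subgroup G) (S : G → Prop) : Prop :=
  ∀ ⦃p k : ℕ⦄, p.Prime → 0 < k → p ^ k ∣ N → ∀ ⦃z ξ : G⦄, z ^ N = 1 → z ∉ H → ξ ^ p ^ k = 1 →
    z * ξ ∉ H → (S z ↔ S (z * ξ))

lemma IsPrimePowInvariant.iff_mul {N m : ℕ} (hS : IsPrimePowInvariant N H S) (hm : m ∣ N) {z v : G}
    (hz : z ^ N = 1) (hzH : z ^ m ∉ H) (hv : v ^ m = 1) : S z ↔ S (z * v) := by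
  have hzH' : z ∉ H := fun h => hzH (pow_mem h m)
  induction m using Nat.recOnPosPrimePosCoprime generalizing z v with
  | prime_pow p k hp hk =>
    refine hS hp hk hm hz hzH' hv fun h => hzH ?_
    simpa only [mul_pow, hv, mul_one] using pow_mem h (p ^ k)
  | zero => exact absurd (pow_zero z ▸ one_mem H) hzH
  | one => rw [← pow_one v, hv, mul_one]
  | coprime m n _ _ hmn ihm ihn =>
    obtain ⟨x, y, rfl, hx, hy⟩ := exists_eq_mul_of_pow_mul_eq_one hmn hv
    have hx' (j : ℕ) : (z * x) ^ (m * j) = z ^ (m * j) := by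
      rw [mul_pow, pow_mul x, hx, one_pow, mul_one]
    have hN : (z * x) ^ N = 1 := by
      obtain ⟨j, rfl⟩ := (dvd_mul_right m n).trans hm
      rw [hx', hz]
    have hzx : (z * x) ^ n ∉ H := fun h => hzH <| by
      rw [← hx', mul_comm m, pow_mul]
      exact pow_mem h m
    rw [← mul_assoc]
    refine (ihm ((dvd_mul_right m n).trans hm) hz (fun h => hzH (pow_mul z m n ▸ pow_mem h n)) hx
      hzH').trans ?_
    exact ihn ((dvd_mul_left n m).trans hm) hN hzx hy fun h => hzx (pow_mem h n)

lemma exists_prime_pow_mul_eq_of_notMem {N : ℕ} (hN : 0 < N) {z : G} (hz : z ∉ H)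
    (hzN : z ^ N ∈ H) :
    ∃ p k m : ℕ, p.Prime ∧ 0 < k ∧ p ^ k * m = N ∧ (p ^ k).Coprime m ∧ z ^ m ∉ H := by
  induction N using Nat.recOnPosPrimePosCoprime generalizing z with
  | prime_pow p k hp hk =>
    exact ⟨p, k, 1, hp, hk, mul_one _, Nat.coprime_one_right _, by rwa [pow_one]⟩
  | zero => exact absurd hN (lt_irrefl 0)
  | one => exact absurd (pow_one z ▸ hzN) hz
  | coprime a b ha hb hab iha ihb =>
    have lift {a b : ℕ} (hab : a.Coprime b)
        (h : ∃ p k m : ℕ, p.Prime ∧ 0 < k ∧ p ^ k * m = b ∧ (p ^ k).Coprime m ∧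
          (z ^ a) ^ m ∉ H) :
        ∃ p k m : ℕ, p.Prime ∧ 0 < k ∧ p ^ k * m = a * b ∧ (p ^ k).Coprime m ∧ z ^ m ∉ H := by
      obtain ⟨p, k, m, hp, hk, rfl, hm, hzm⟩ := h
      exact ⟨p, k, a * m, hp, hk, by ring,
        (Nat.Coprime.coprime_mul_right_right hab).symm.mul_right hm, by rwa [pow_mul]⟩
    by_cases h : z ^ a ∈ H
    · rw [mul_comm a b]
      exact lift hab.symm (iha (by omega) (fun h' => hz (mem_of_pow_mem_of_pow_mem hab h h'))
        (by rwa [← pow_mul, mul_comm b a]))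
    · exact lift hab (ihb (by omega) h (by rwa [← pow_mul]))

-- Write `N = p ^ k * m` with `z ^ m ∉ H` and `z⁻¹ z' = u v` with `u ^ p ^ k = 1` and `v ^ m = 1`:
-- then the way from `z` to `z v` avoids `H`, and `z v u = z'`.
lemma IsPrimePowInvariant.iff {N : ℕ} (hN : 0 < N) (hS : IsPrimePowInvariant N H S) {z z' : G}
    (hz : z ^ N = 1) (hz' : z' ^ N = 1) (hzH : z ∉ H) (hzH' : z' ∉ H) : S z ↔ S z' := by
  obtain ⟨p, k, m, hp, hk, rfl, hpm, hzm⟩ :=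
    exists_prime_pow_mul_eq_of_notMem hN hzH (hz ▸ one_mem H)
  obtain ⟨u, v, huv, hu, hv⟩ := exists_eq_mul_of_pow_mul_eq_one (z := z⁻¹ * z') hpm (by
    rw [mul_pow, inv_pow, hz, hz', inv_one, one_mul])
  have hz'_eq : z * v * u = z' := by rw [mul_assoc, mul_comm v, huv, mul_inv_cancel_left]
  have hzv : z * v ∉ H := fun h => hzm <| by
    simpa only [mul_pow, hv, mul_one] using pow_mem h m
  rw [hS.iff_mul (dvd_mul_left m _) hz hzm hv, ← hz'_eq]
  refine hS hp hk (dvd_mul_right _ m) ?_ hzv hu (hz'_eq ▸ hzH')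
  rw [mul_pow, hz, one_mul, mul_comm, pow_mul, hv, one_pow]

end CommGroup

section AntisymmPowGcd

variable {B C : Type*} [CommRing B] [CommRing C] {z : Bˣ} {d e n : ℤ}

lemma map_antisymmPow (φ : B →+* C) (z : Bˣ) (n : ℤ) :
    φ (antisymmPow z n) = antisymmPow (Units.map (φ : B →* C) z) n := by
  simp only [antisymmPow, map_sub, ← map_zpow, Units.coe_map, MonoidHom.coe_coe]

lemma antisymmPow_neg (z : Bˣ) (n : ℤ) : antisymmPow z (-n) = -antisymmPow z n := by
  rw [antisymmPow, neg_neg, antisymmPow, neg_sub]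

lemma zpow_neg_eq_of_dvd (hz : z ^ (2 * e) = 1) (h : e ∣ n) : z ^ (-n) = z ^ n := by
  obtain ⟨k, rfl⟩ := h
  rw [zpow_neg, inv_eq_iff_mul_eq_one, ← zpow_add, ← two_mul, ← mul_assoc, zpow_mul, hz, one_zpow]

lemma antisymmPow_eq_zero_of_dvd (hz : z ^ (2 * e) = 1) (h : e ∣ n) : antisymmPow z n = 0 := by
  rw [antisymmPow, zpow_neg_eq_of_dvd hz h, sub_self]

lemma antisymmPow_dvd_antisymmPow_mul (z : Bˣ) (n k : ℤ) :
    antisymmPow z n ∣ antisymmPow z (n * k) := by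
  have hpow (m : ℕ) : antisymmPow z n ∣ antisymmPow z (n * m) := by
    simpa only [antisymmPow, ← neg_mul, zpow_mul, zpow_natCast, Units.val_pow_eq_pow_val] using
      sub_dvd_pow_sub_pow _ _ m
  obtain ⟨m, rfl | rfl⟩ := k.eq_nat_or_neg
  · exact hpow m
  · rw [mul_neg, antisymmPow_neg, dvd_neg]
    exact hpow m

lemma antisymmPow_dvd_antisymmPow_gcd (hz : z ^ (2 * e) = 1) (n : ℤ) :
    antisymmPow z n ∣ antisymmPow z (Int.gcd n e) := by
  refine (antisymmPow_dvd_antisymmPow_mul z n (Int.gcdA n e)).trans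
    ⟨(z ^ (e * Int.gcdB n e) : Bˣ), ?_⟩
  rw [Int.gcd_eq_gcd_ab, antisymmPow, neg_add, zpow_add, zpow_add,
    zpow_neg_eq_of_dvd hz (dvd_mul_right e _), Units.val_mul, Units.val_mul, ← sub_mul, antisymmPow]

lemma antisymmPow_ne_zero_of_gcd_eq (hz : z ^ (2 * e) = 1) (hd : antisymmPow z d ≠ 0)
    (hn : Int.gcd n e = d) : antisymmPow z n ≠ 0 := fun h =>
  hd <| zero_dvd_iff.1 <| h ▸ hn ▸ antisymmPow_dvd_antisymmPow_gcd hz n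

end AntisymmPowGcd

section DualNumbers

open TrivSqZeroExt

variable {B : Type*} [CommRing B]

/-- The unit `z (1 + ε)` of the dual numbers. -/
def tangentUnit (z : Bˣ) : (DualNumber B)ˣ where
  val := inl (z : B) + inr (z : B)
  inv := inl ((z⁻¹ : Bˣ) : B) - inr ((z⁻¹ : Bˣ) : B)
  val_inv := by ext <;> simp
  inv_val := by ext <;> simp

lemma map_fstHom_tangentUnit (z : Bˣ) :
    Units.map (fstHom B B B : DualNumber B →* B) (tangentUnit z) = z := by
  ext
  simp [tangentUnit]

lemma tangentUnit_zpow (z : Bˣ) (n : ℤ) :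
    ((tangentUnit z ^ n : (DualNumber B)ˣ) : DualNumber B) =
      inl ((z ^ n : Bˣ) : B) + inr (n * ((z ^ n : Bˣ) : B)) := by
  have hval : ((tangentUnit z : (DualNumber B)ˣ) : DualNumber B) = inl (z : B) + inr (z : B) := rfl
  have hinv : (((tangentUnit z)⁻¹ : (DualNumber B)ˣ) : DualNumber B) =
    inl ((z⁻¹ : Bˣ) : B) - inr ((z⁻¹ : Bˣ) : B) := rfl
  induction n using Int.induction_on with
  | zero => simp
  | succ n ih =>
    rw [zpow_add_one, Units.val_mul, ih, hval, zpow_add_one]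
    ext
    · simp
    · simp only [snd_mul, snd_add, fst_add, snd_inl, fst_inl, snd_inr, fst_inr, smul_eq_mul,
        MulOpposite.smul_eq_mul_unop, MulOpposite.unop_op, Units.val_mul]
      push_cast
      ring
  | pred n ih =>
    rw [zpow_sub_one, Units.val_mul, ih, hinv, zpow_sub_one]
    ext
    · simp
    · simp only [snd_mul, snd_add, fst_add, snd_sub, fst_sub, snd_inl, fst_inl, snd_inr, fst_inr,
        smul_eq_mul, MulOpposite.smul_eq_mul_unop, MulOpposite.unop_op, Units.val_mul]
      push_cast
      ring

lemma dualNumber_mul_eq_zero {x y : DualNumber B} (hx : x.fst = 0) (hy : y.fst = 0) :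
    x * y = 0 := by
  ext <;> simp [hx, hy]

lemma antisymmPow_tangentUnit_ne_zero [CharZero B] (z : Bˣ) {n : ℤ} (hn : n ≠ 0) :
    antisymmPow (tangentUnit z) n ≠ 0 := by
  rw [Ne, antisymmPow_eq_zero_iff]
  intro h
  have hsnd := congrArg (fun u : (DualNumber B)ˣ => (u : DualNumber B).snd) h
  simp only [tangentUnit_zpow, snd_add, snd_inl, snd_inr, zero_add, Units.val_one, snd_one,
    Units.mul_left_eq_zero, Int.cast_eq_zero] at hsnd
  omega

end DualNumbers

section RootsOfUnity

variable {B : Type*} [CommRing B]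

lemma one_sub_dvd_one_sub_zpow (ξ : Bˣ) (k : ℤ) : (1 - ξ : B) ∣ 1 - ((ξ ^ k : Bˣ) : B) := by
  have hpow (ζ : Bˣ) (m : ℕ) : (1 - ζ : B) ∣ 1 - ((ζ ^ m : Bˣ) : B) := by
    simpa only [one_pow, Units.val_pow_eq_pow_val] using sub_dvd_pow_sub_pow (1 : B) ζ m
  obtain ⟨m, rfl | rfl⟩ := k.eq_nat_or_neg
  · simpa only [zpow_natCast] using hpow ξ m
  · rw [zpow_neg, ← inv_zpow, zpow_natCast]
    refine Dvd.dvd.trans ⟨-((ξ⁻¹ : Bˣ) : B), ?_⟩ (hpow ξ⁻¹ m)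
    rw [mul_neg, sub_mul, ← Units.val_mul, mul_inv_cancel]
    simp

lemma isUnit_natCast_of_isUnit_one_sub {p k : ℕ} (hp : p.Prime) {ξ : B} (hξ : ξ ^ p ^ k = 1)
    (h : IsUnit (1 - ξ)) : IsUnit (p : B) := by
  obtain ⟨t, ht⟩ := exists_add_pow_prime_pow_eq hp (1 - ξ) ξ k
  rw [sub_add_cancel, one_pow, hξ] at ht
  refine isUnit_of_dvd_unit ⟨-((1 - ξ) * ξ * t), ?_⟩ (h.pow (p ^ k))
  linear_combination -ht

lemma isUnit_natCast_of_isUnit_integralClosure {A K : Type*} [CommRing A] [CommRing K] [Algebra A K]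
    [FaithfulSMul A K] {p : ℕ} (h : IsUnit (p : integralClosure A K)) : IsUnit (p : A) := by
  have := FaithfulSMul.tower_bot A (integralClosure A K) K
  rw [← map_natCast (algebraMap A (integralClosure A K))] at h
  exact h.of_map _ _

lemma exists_map_eq_of_zpow_eq_one (A : Type*) {K : Type*} [CommRing A] [CommRing K] [Algebra A K]
    {z : Kˣ} {n : ℤ} (hn : n ≠ 0) (hz : z ^ n = 1) :
    ∃ z' : (integralClosure A K)ˣ,
      Units.map ((integralClosure A K).val : integralClosure A K →* K) z' = z := by
  have hpow : z ^ n.natAbs = 1 := by rwa [pow_natAbs_eq_one]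
  have hint {x : Kˣ} (hx : x ^ n.natAbs = 1) : IsIntegral A (x : K) :=
    .of_pow (Int.natAbs_pos.2 hn) (by
      rw [← Units.val_pow_eq_pow_val, hx]
      exact isIntegral_one)
  exact ⟨⟨⟨z, hint hpow⟩, ⟨(z⁻¹ : Kˣ), hint (by rw [inv_pow, hpow, inv_one])⟩,
    Subtype.ext z.mul_inv, Subtype.ext z.inv_mul⟩, Units.ext rfl⟩

end RootsOfUnity

-- After division by the least power of `z`, the sum becomes a polynomial without any root.
lemma eq_of_forall_sum_mul_zpow_ne_zero {K τ : Type*} [Field K] [IsAlgClosed K] {s : Finset τ}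
    {f : τ → ℤ} (hf : Set.InjOn f s) {a : τ → K} (ha : ∀ p ∈ s, a p ≠ 0)
    (h : ∀ z : Kˣ, ∑ p ∈ s, a p * ((z ^ f p : Kˣ) : K) ≠ 0) {p q : τ} (hp : p ∈ s) (hq : q ∈ s) :
    f p = f q := by
  classical
  obtain ⟨p₀, hp₀, hmin⟩ := s.exists_min_image f ⟨p, hp⟩
  let g (p : τ) : ℕ := (f p - f p₀).toNat
  have hg {p : τ} (hp : p ∈ s) : (g p : ℤ) = f p - f p₀ :=
    Int.toNat_of_nonneg (sub_nonneg.2 (hmin p hp))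
  let P : Polynomial K := ∑ p ∈ s, Polynomial.monomial (g p) (a p)
  have hcoeff {p : τ} (hp : p ∈ s) : P.coeff (g p) = a p := by
    rw [Polynomial.finsetSum_coeff, Finset.sum_eq_single_of_mem p hp,
      Polynomial.coeff_monomial_same]
    intro q hq hqp
    refine Polynomial.coeff_monomial_of_ne _ fun hgqp => hqp (hf hq hp ?_)
    have := hg hp
    have := hg hq
    omega
  have hroot (x : K) : P.eval x ≠ 0 := by
    rcases eq_or_ne x 0 with rfl | hx
    · have hg₀ : g p₀ = 0 := by simp [g]
      rw [← Polynomial.coeff_zero_eq_eval_zero, ← hg₀, hcoeff hp₀]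
      exact ha p₀ hp₀
    · have heval : P.eval x * x ^ f p₀ = ∑ p ∈ s, a p * ((Units.mk0 x hx ^ f p : Kˣ) : K) := by
        rw [Polynomial.eval_finsetSum, Finset.sum_mul]
        refine Finset.sum_congr rfl fun p hp => ?_
        rw [Polynomial.eval_monomial, mul_assoc, ← zpow_natCast, ← zpow_add₀ hx, hg hp,
          sub_add_cancel, Units.val_zpow_eq_zpow_val, Units.val_mk0]
      exact fun h₀ => h (Units.mk0 x hx) (by rw [← heval, h₀, zero_mul])
  have hdeg : P.natDegree = 0 := by
    by_contra hP
    obtain ⟨x, hx⟩ := IsAlgClosed.exists_root P fun h₀ =>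
      hP (Polynomial.natDegree_eq_of_degree_eq_some h₀)
    exact hroot x hx
  have heq {p : τ} (hp : p ∈ s) : f p = f p₀ := by
    have hle := Polynomial.le_natDegree_of_ne_zero (hcoeff hp ▸ ha p hp)
    have := hg hp
    omega
  rw [heq hp, heq hq]

section LeadingValue

variable {ι M N A B : Type*} [AddCommGroup M] [Module ℝ M] [AddCommGroup N] [Module ℝ N]
  {R : RootPairing ι ℝ M N} {b : R.Base}

lemma dvd_weightCoeffHom_weylAct [R.IsCrystallographic] {e : ℤ} {x : R.weightLattice}
    (h : ∀ i ∈ b.support, e ∣ R.weightCoeff i x) (w : R.weylGroup) (i : ι) :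
    e ∣ weightCoeffHom R i (R.weylAct w x) := by
  have hperm := weightCoeffHom_weylGroupToPerm_weylAct R w (R.weylGroupToPerm w⁻¹ i) x
  rw [← Equiv.Perm.mul_apply, ← map_mul, mul_inv_cancel, map_one, Equiv.Perm.one_apply] at hperm
  rw [hperm]
  exact dvd_weightCoeff b h _

lemma lexHom_weylAct_ofIdx [R.IsRootSystem] [R.IsCrystallographic] (α : b.support)
    {J : Set b.support} {β : b.support} (hβ : β ∈ J) (x : R.weightLattice) :
    lexHom b α J (R.weylAct (ofIdx R β) x) = lexHom b α J x :=
  lexHom_eq_iff.2 fun i hi => coord_ofIdx_smul_of_ne b (fun h : i = β => hi (h ▸ hβ)) _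

section Sum

variable [R.IsRootSystem] [CommRing A] [CommRing B] [Algebra A B] {α β : b.support}
  {F : AddMonoidAlgebra A R.weightLattice} {y : R.weightLattice}

lemma twist_ne_zero_of_leadingValue_ne_zero {z : Bˣ} (h : leadingValue b α β z F y ≠ 0) :
    twist (powChar z (weightCoeffHom R β)) (lexHom b α {β}) F ≠ 0 := fun h₀ =>
  h (by rw [leadingValue, h₀]; rfl)

lemma not_vanishesAt_of_leadingValue_ne_zero {z : Bˣ} (h : leadingValue b α β z F y ≠ 0) :
    ¬ VanishesAt R (β : ι) z F := fun h₀ =>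
  twist_ne_zero_of_leadingValue_ne_zero h (vanishesAt_iff_twist_lexHom.1 h₀)

lemma fst_leadingValue_tangentUnit (z : Bˣ) (F : AddMonoidAlgebra A R.weightLattice)
    (y : R.weightLattice) :
    (leadingValue b α β (tangentUnit z) F y).fst = leadingValue b α β z F y := by
  have h := map_leadingValue (α := α) (TrivSqZeroExt.fstHom A B B) β (tangentUnit z) F y
  exact h.trans (congrArg (leadingValue b α β · F y) (map_fstHom_tangentUnit z))

lemma leadingValue_eq_sum [DecidableEq (Lex (Fin (Fintype.card b.support + 1) → ℝ))] (z : Bˣ)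
    (F : AddMonoidAlgebra A R.weightLattice) (y : R.weightLattice) :
    leadingValue b α β z F y =
      ∑ p ∈ F.coeff.support with lexHom b α {β} p = lexHom b α {β} y,
        F.coeff p • ((z ^ weightCoeffHom R β p : Bˣ) : B) := by
  rw [leadingValue, coeff_twist]
  rfl

lemma one_sub_dvd_leadingValue_sub (z ξ : Bˣ) (F : AddMonoidAlgebra A R.weightLattice)
    (y : R.weightLattice) :
    (1 - ξ : B) ∣ leadingValue b α β z F y - leadingValue b α β (z * ξ) F y := by
  classical
  rw [leadingValue_eq_sum, leadingValue_eq_sum, ← Finset.sum_sub_distrib]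
  refine Finset.dvd_sum fun p _ => ?_
  rw [← smul_sub, mul_zpow, Units.val_mul, ← mul_one_sub, Algebra.smul_def]
  exact ((one_sub_dvd_one_sub_zpow ξ _).mul_left _).mul_left _

lemma eq_of_lexHom_singleton_eq {p q : R.weightLattice}
    (h : lexHom b α {β} p = lexHom b α {β} q)
    (hcoeff : weightCoeffHom R β p = weightCoeffHom R β q) : p = q := by
  obtain ⟨t, ht⟩ := lexHom_singleton_eq_iff.1 h
  have hpair := congrArg (R.coroot' β) ht
  rw [map_sub, (R.coroot' β).map_smul, R.root_coroot'_eq_pairing, R.pairing_same,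
    ← weightCoeffHom_cast, ← weightCoeffHom_cast, hcoeff, smul_eq_mul] at hpair
  obtain rfl : t = 0 := by linarith
  rw [zero_smul, sub_zero] at ht
  exact Subtype.ext ht

end Sum

section Crystallographic

variable [R.IsRootSystem] [R.IsCrystallographic] [CommRing A] [CommRing B] [Algebra A B]
  {α β : b.support}

lemma twist_schurWeyl_eq_zero_of_dvd [Finite ι] {e : ℤ} {x : R.weightLattice}
    (hx : ∀ i ∈ b.support, e ∣ R.weightCoeff i x) (α β : b.support) {z : Bˣ}
    (hz : z ^ (2 * e) = 1) :
    twist (powChar z (weightCoeffHom R β)) (lexHom b α {β}) (R.schurWeyl A x) = 0 := by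
  refine twist_schurWeyl_eq_zero β (fun w => ?_) (lexHom_weylAct_ofIdx α rfl)
  rw [powChar_apply, powChar_apply, weightCoeffHom_weylAct_ofIdx,
    zpow_neg_eq_of_dvd hz (dvd_weightCoeffHom_weylAct hx w β)]

-- A leading value without zeros is a monomial in `z`, and it is symmetric under `z ↦ z⁻¹`.
lemma weightCoeffHom_eq_zero_of_leadingValue_ne_zero {F : AddMonoidAlgebra A R.weightLattice}
    {y : R.weightLattice} {K : Type*} [Field K] [IsAlgClosed K]
    [Algebra A K] [FaithfulSMul A K] (hF : F ∈ R.weylInvariants A) (hy : F.coeff y ≠ 0)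
    (h : ∀ z : Kˣ, leadingValue b α β z F y ≠ 0) : weightCoeffHom R β y = 0 := by
  classical
  let T := F.coeff.support.filter fun p => lexHom b α {β} p = lexHom b α {β} y
  have hmem {p : R.weightLattice} (hp : F.coeff p ≠ 0)
      (hpy : lexHom b α {β} p = lexHom b α {β} y) : p ∈ T :=
    Finset.mem_filter.2 ⟨Finsupp.mem_support_iff.2 hp, hpy⟩
  have hinj : Set.InjOn (weightCoeffHom R (β : ι)) T := fun p hp q hq =>
    eq_of_lexHom_singleton_eq ((Finset.mem_filter.1 hp).2.trans (Finset.mem_filter.1 hq).2.symm)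
  have heq : weightCoeffHom R β (R.weylAct (ofIdx R β) y) = weightCoeffHom R β y := by
    refine eq_of_forall_sum_mul_zpow_ne_zero (K := K) (a := fun p => algebraMap A K (F.coeff p))
      hinj (fun p hp => ?_) (fun z => ?_)
      (hmem ?_ (lexHom_weylAct_ofIdx α (Set.mem_singleton β) y)) (hmem hy rfl)
    · rw [Ne, FaithfulSMul.algebraMap_eq_zero_iff]
      exact Finsupp.mem_support_iff.1 (Finset.mem_filter.1 hp).1
    · simpa only [leadingValue_eq_sum, Algebra.smul_def] using h z
    · rwa [coeff_weylAct R hF]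
  rw [weightCoeffHom_weylAct_ofIdx] at heq
  omega

namespace LeadingFactorization

variable [Finite ι] [R.IsReduced] {U V : AddMonoidAlgebra A R.weightLattice} {d : ℕ}
  {x y y' : R.weightLattice}
  {z : Bˣ}

lemma vanishesAt_left [IsDomain B] (h : LeadingFactorization b α U V x d y y') {e : ℤ}
    (hex : ∀ i ∈ b.support, e ∣ R.weightCoeff i x) (hze : z ^ (2 * e) = 1)
    (hzd : antisymmPow z d ≠ 0) (hz : leadingValue b α β z V y' ≠ 0) :
    VanishesAt R (β : ι) z U := by
  have hzero := twist_schurWeyl_eq_zero_of_dvd (A := A) hex α β hze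
  rw [← show _ = _ from h.isC, map_mul, map_mul] at hzero
  have hρ : leadingValue b α β z (R.schurWeyl A (d • b.rho)) (d • b.rho) ≠ 0 := by
    rwa [leadingValue_schurWeyl_self (dominantRegular_nsmul_rho b h.pos), weightCoeffHom_nsmul_rho]
  exact (vanishesAt_iff_twist_lexHom (α := α)).2 <| (mul_eq_zero.1 <| (mul_eq_zero.1
    hzero).resolve_right (twist_ne_zero_of_leadingValue_ne_zero hρ)).resolve_right
      (twist_ne_zero_of_leadingValue_ne_zero hz)

variable [IsDomain A]

lemma zpow_eq_one_of_leadingValue_eq_zero (h : LeadingFactorization b α U V x d y y')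
    (hz : leadingValue b α β z U y = 0) : z ^ (2 * weightCoeffHom R β x) = 1 := by
  have hmul := h.leadingValue_mul β z
  rw [hz, zero_mul, zero_mul] at hmul
  exact antisymmPow_eq_zero_iff.1 hmul.symm

lemma leadingValue_tangentUnit_mul_ne_zero (h : LeadingFactorization b α U V x d y y') [CharZero B]
    (β : b.support) (z : Bˣ) :
    leadingValue b α β (tangentUnit z) U y * leadingValue b α β (tangentUnit z) V y' *
      antisymmPow (tangentUnit z) d ≠ 0 := by
  rw [h.leadingValue_mul]
  exact antisymmPow_tangentUnit_ne_zero z (h.dominantRegular β β.2).ne'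

lemma leadingValue_right_ne_zero (h : LeadingFactorization b α U V x d y y') [CharZero B]
    (hz : leadingValue b α β z U y = 0) : leadingValue b α β z V y' ≠ 0 := fun hz' =>
  h.leadingValue_tangentUnit_mul_ne_zero β z <| by
    rw [dualNumber_mul_eq_zero ((fst_leadingValue_tangentUnit z U y).trans hz)
      ((fst_leadingValue_tangentUnit z V y').trans hz'), zero_mul]

lemma antisymmPow_ne_zero (h : LeadingFactorization b α U V x d y y') [CharZero B]
    (hz : leadingValue b α β z U y = 0) : antisymmPow z d ≠ 0 := fun hz' =>
  h.leadingValue_tangentUnit_mul_ne_zero β z <| by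
    have hfst : (antisymmPow (tangentUnit z) (d : ℤ)).fst = 0 := by
      have hmap := map_antisymmPow (TrivSqZeroExt.fstHom B B B : DualNumber B →+* B)
        (tangentUnit z) d
      exact hmap.trans ((congrArg (antisymmPow · (d : ℤ)) (map_fstHom_tangentUnit z)).trans hz')
    rw [mul_right_comm,
      dualNumber_mul_eq_zero ((fst_leadingValue_tangentUnit z U y).trans hz) hfst, zero_mul]

lemma leadingValue_eq_zero_or [IsDomain B] (h : LeadingFactorization b α U V x d y y')
    (hzx : z ^ (2 * weightCoeffHom R β x) = 1) (hzd : antisymmPow z d ≠ 0) :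
    leadingValue b α β z U y = 0 ∨ leadingValue b α β z V y' = 0 := by
  have hmul := h.leadingValue_mul β z
  rw [antisymmPow_eq_zero_iff.2 hzx] at hmul
  exact mul_eq_zero.1 ((mul_eq_zero.1 hmul).resolve_right hzd)

end LeadingFactorization

end Crystallographic

end LeadingValue

section AdmissibleShift

variable {ι M N : Type*} [AddCommGroup M] [Module ℝ M] [AddCommGroup N] [Module ℝ N]
  {R : RootPairing ι ℝ M N}

lemma gcd_eq_gcd_of_modEq {m n k : ℤ} (h : m ≡ n [ZMOD k]) : Int.gcd m k = Int.gcd n k := by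
  rw [← Int.gcd_emod, show m % k = n % k from h, Int.gcd_emod]

lemma coroot'_smul_root [R.IsCrystallographic] (w : R.weylGroup) (i j : ι) :
    R.coroot' i (w • R.root j) = (R.pairingIn ℤ (R.weylGroupToPerm w j) i : ℝ) := by
  rw [← root_weylGroupToPerm, R.root_coroot'_eq_pairing, ← R.algebraMap_pairingIn ℤ]
  rfl

lemma pairingIn_reflectionPerm_eq_sub [R.IsCrystallographic] (i j k : ι) :
    R.pairingIn ℤ (R.reflectionPerm i j) k =
      R.pairingIn ℤ j k - R.pairingIn ℤ j i * R.pairingIn ℤ i k := by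
  refine Int.cast_injective (α := ℝ) ?_
  have h := R.algebraMap_pairingIn ℤ
  simp only [algebraMap_int_eq, eq_intCast] at h
  simp only [Int.cast_sub, Int.cast_mul, h, ← R.root_coroot'_eq_pairing, R.root_reflectionPerm,
    R.reflection_apply, map_sub, map_smul, smul_eq_mul]

variable [R.IsRootSystem]

lemma root_ne_and_ne_neg_of_coord_ne_zero {b : R.Base} {α β : b.support} (hβ : α ≠ β) {x : M}
    (hx : coord b α x ≠ 0) : R.root β ≠ x ∧ R.root β ≠ -x := by
  have hβα : coord b α (R.root β) = 0 := coord_root_of_ne b hβ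
  refine ⟨fun h => hx (h ▸ hβα), fun h => hx ?_⟩
  rwa [h, map_neg, neg_eq_zero] at hβα

lemma dominantRegular_add_nsmul_fundamentalWeight {b : R.Base} {μ : R.weightLattice}
    (hμ : b.DominantRegular μ) (α : b.support) (c : ℕ) :
    b.DominantRegular (μ + c • b.fundamentalWeight α) := by
  classical
  intro i hi
  have hpos := hμ i hi
  rw [← weightCoeffHom_apply] at hpos ⊢
  rw [map_add, map_nsmul, weightCoeffHom_fundamentalWeight b α ⟨i, hi⟩]
  split_ifs <;> simp only [nsmul_eq_mul, mul_one, mul_zero] <;> omega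

variable [R.IsCrystallographic] (b : R.Base)

/-- The greatest common divisor of `c` and `e`, and those of all nonzero multiples of `c` by
pairings of roots in the orbit of `α` with non-proportional roots, are equal to `d`. -/
structure GcdCondition (α : b.support) (c e d : ℕ) : Prop where
  gcd_eq : Nat.gcd c e = d
  gcd_pairing_mul_eq : ∀ (w : R.weylGroup) (i : ι), R.root i ≠ w • R.root α →
    R.root i ≠ -(w • R.root α) → R.pairingIn ℤ (R.weylGroupToPerm w α) i ≠ 0 →
      Int.gcd (R.pairingIn ℤ (R.weylGroupToPerm w α) i * c) e = d

/-- The relation between `μ` and `η = μ + c ω_α` from which the contradiction is derived when the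
greatest common divisor of the theorem is equal to `d`. -/
structure AdmissibleShift (α : b.support) (μ : R.weightLattice) (c e d : ℕ) : Prop where
  dominantRegular : b.DominantRegular μ
  dvd_weightCoeff : ∀ i ∈ b.support, (e : ℤ) ∣ R.weightCoeff i μ
  gcdCondition : GcdCondition b α c e d

variable {b} {α β : b.support} {μ : R.weightLattice} {c d e : ℕ}

lemma GcdCondition.gcd_pairingIn_mul_eq (h : GcdCondition b α c e d) (hβ : α ≠ β) {w : R.weylGroup}
    (hw : coord b α (w • R.root α) = 1) (hne : R.pairingIn ℤ (R.weylGroupToPerm w α) β ≠ 0) :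
    Int.gcd (R.pairingIn ℤ (R.weylGroupToPerm w α) β * c) e = d :=
  have hroot := root_ne_and_ne_neg_of_coord_ne_zero hβ (hw ▸ one_ne_zero)
  h.gcd_pairing_mul_eq w β hroot.1 hroot.2 hne

namespace AdmissibleShift

lemma dominantRegular_add (h : AdmissibleShift b α μ c e d) :
    b.DominantRegular (μ + c • b.fundamentalWeight α) :=
  dominantRegular_add_nsmul_fundamentalWeight h.dominantRegular α c

variable (h : AdmissibleShift b α μ c e d) {w : R.weylGroup}
include h

lemma strictlyDominant_add :
    StrictlyDominant b ((μ + c • b.fundamentalWeight α : R.weightLattice) : M) :=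
  (dominantRegular_iff_strictlyDominant b).1 h.dominantRegular_add

lemma weightCoeffHom_modEq {i : ι} {n : ℤ}
    (hn : R.coroot' i (w • (b.fundamentalWeight α : M)) = n) :
    weightCoeffHom R i (R.weylAct w (μ + c • b.fundamentalWeight α)) ≡ n * c [ZMOD e] := by
  have hω : weightCoeffHom R i (R.weylAct w (b.fundamentalWeight α)) = n :=
    (weightCoeffHom_eq_iff R).2 hn
  rw [map_add, map_add, map_nsmul, map_nsmul, hω, nsmul_eq_mul, mul_comm]
  have hμ := Int.modEq_zero_iff_dvd.2 (dvd_weightCoeffHom_weylAct h.dvd_weightCoeff w i)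
  simpa only [zero_add] using hμ.add_right (n * c)

lemma dvd_weightCoeffHom {i : ι} (hi : R.coroot' i (w • (b.fundamentalWeight α : M)) = 0) :
    (e : ℤ) ∣ weightCoeffHom R i (R.weylAct w (μ + c • b.fundamentalWeight α)) := by
  have hmod := h.weightCoeffHom_modEq (n := 0) (hi.trans Int.cast_zero.symm)
  rw [zero_mul] at hmod
  exact Int.modEq_zero_iff_dvd.1 hmod

lemma gcd_weightCoeffHom_self :
    Int.gcd (weightCoeffHom R α (μ + c • b.fundamentalWeight α)) e = d := by
  have hmod := h.weightCoeffHom_modEq (w := 1) (i := α) (n := 1) (by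
    rw [one_smul, coroot'_fundamentalWeight_self b, Int.cast_one])
  rw [weylAct_one, one_mul] at hmod
  rw [gcd_eq_gcd_of_modEq hmod, Int.gcd_natCast_natCast, h.gcdCondition.gcd_eq]

variable {v : R.weylGroup}
  (hv : v • (b.fundamentalWeight α : M) = b.fundamentalWeight α - w • R.root α)
include hv

lemma weightCoeffHom_modEq_of_smul_eq_sub (hβ : α ≠ β) :
    weightCoeffHom R β (R.weylAct v (μ + c • b.fundamentalWeight α)) ≡
      -(R.pairingIn ℤ (R.weylGroupToPerm w α) β * c) [ZMOD e] := by
  rw [← neg_mul]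
  refine h.weightCoeffHom_modEq ?_
  rw [hv, map_sub, coroot'_fundamentalWeight_of_ne b hβ, coroot'_smul_root, zero_sub,
    Int.cast_neg]

lemma gcd_weightCoeffHom_of_smul_eq_sub (hβ : α ≠ β) (hw : coord b α (w • R.root α) = 1)
    (hne : R.pairingIn ℤ (R.weylGroupToPerm w α) β ≠ 0) :
    Int.gcd (weightCoeffHom R β (R.weylAct v (μ + c • b.fundamentalWeight α))) e = d := by
  rw [gcd_eq_gcd_of_modEq (h.weightCoeffHom_modEq_of_smul_eq_sub hv hβ), Int.neg_gcd]
  exact h.gcdCondition.gcd_pairingIn_mul_eq hβ hw hne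

end AdmissibleShift

variable [Finite ι] [R.IsReduced]

lemma smul_fundamentalWeight_eq_or {x : M} (hx : StrictlyDominant b x) {v : R.weylGroup}
    (h : coord b α x - R.coroot' α x ≤ coord b α (v • x)) :
    v • (b.fundamentalWeight α : M) = b.fundamentalWeight α ∨
      ∃ w : R.weylGroup, coord b α (w • R.root α) = 1 ∧
        v • (b.fundamentalWeight α : M) = b.fundamentalWeight α - w • R.root α := by
  rcases mem_coordStabilizer_or_coord_smul_le b (K := ∅) (w := v) (by simp) (fun j _ => hx j) α
    with hv | ⟨hle, hv⟩
  · exact Or.inl (smul_fundamentalWeight_of_mem_coordStabilizer b hv)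
  · have hmem := hv (hle.antisymm h)
    refine Or.inr ⟨v * ofIdx R α, ?_, ?_⟩
    · rw [show coord b α _ = _ from hmem _, coord_root_self]
    · calc
        v • (b.fundamentalWeight α : M) =
            (v * ofIdx R α) • ofIdx R α • (b.fundamentalWeight α : M) := by
          rw [← mul_smul, mul_assoc, ofIdx_mul_self, mul_one]
        _ = b.fundamentalWeight α - (v * ofIdx R α) • R.root α := by
          rw [ofIdx_smul_fundamentalWeight_self b, smul_sub,
            smul_fundamentalWeight_of_mem_coordStabilizer b hmem]

variable {A B : Type*} [CommRing A] [CommRing B] [Algebra A B]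

lemma associated_leadingValue_schurWeyl {x : R.weightLattice} (hx : b.DominantRegular x)
    (β : b.support) (v : R.weylGroup) (z : Bˣ) :
    Associated (leadingValue b α β z (R.schurWeyl A x) (R.weylAct v x))
      (antisymmPow z (weightCoeffHom R β (R.weylAct v x))) := by
  rw [leadingValue_schurWeyl_weylAct hx]
  exact associated_unit_mul_left _ _ ((isUnit_weylSign R v).map (Int.castRingHom B))

namespace AdmissibleShift

variable [R.IsIrreducible] (h : AdmissibleShift b α μ c e d)
  {z : Bˣ} (hze : z ^ (2 * (e : ℤ)) = 1) (hzd : antisymmPow z d ≠ 0)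
include h hze hzd

lemma exists_leadingValue_schurWeyl_ne_zero (hβ : α ≠ β) : ∃ u : R.weylGroup,
    leadingValue b α β z (R.schurWeyl A (μ + c • b.fundamentalWeight α))
      (R.weylAct u (μ + c • b.fundamentalWeight α)) ≠ 0 ∧
    ∀ x : M, coord b α (u • x) = coord b α x - R.coroot' α x := by
  obtain ⟨K, u, w, hu, -, ⟨_, rfl, hneg⟩⟩ := exists_isLowering (b := b) (J := {β})
    (Set.singleton_nonempty _) hβ
  rw [coroot'_smul_root, Int.cast_lt_zero] at hneg
  have hgcd := h.gcd_weightCoeffHom_of_smul_eq_sub hu.smul_fundamentalWeight hβ hu.coord_root_self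
    hneg.ne
  exact ⟨u, (associated_leadingValue_schurWeyl h.dominantRegular_add _ u z).ne_zero_iff.2
    (antisymmPow_ne_zero_of_gcd_eq hze hzd (by rw [hgcd])), hu.coord_smul_self⟩

lemma exists_isGreatest_support_twist_schurWeyl [Nontrivial A] (β : b.support) : ∃ v : R.weylGroup,
    IsGreatest ((twist (powChar z (weightCoeffHom R β)) (lexHom b α {β})
        (R.schurWeyl A (μ + c • b.fundamentalWeight α))).coeff.support : Set _)
      (lexHom b α {β} (R.weylAct v (μ + c • b.fundamentalWeight α))) ∧
    Int.gcd (weightCoeffHom R β (R.weylAct v (μ + c • b.fundamentalWeight α))) e = d := by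
  set η := μ + c • b.fundamentalWeight α
  have hη : b.DominantRegular η := h.dominantRegular_add
  by_cases hβ : α = β
  · subst hβ
    have hgcd := h.gcd_weightCoeffHom_self
    refine ⟨1, ⟨Finsupp.mem_support_iff.2 ?_, ?_⟩, ?_⟩ <;> rw [weylAct_one]
    · change leadingValue b α α z _ _ ≠ 0
      rw [leadingValue_schurWeyl_self hη]
      exact antisymmPow_ne_zero_of_gcd_eq hze hzd (by rw [hgcd])
    · exact mem_upperBounds_support_twist ((isLeading_schurWeyl A α hη).mem_upperBounds _) _
    · exact hgcd
  obtain ⟨u, hne, hu⟩ := h.exists_leadingValue_schurWeyl_ne_zero (A := A) hze hzd hβ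
  obtain ⟨a, ha, hmax⟩ := exists_isGreatest_image_support id
    (twist_ne_zero_of_leadingValue_ne_zero hne)
  rw [Set.image_id] at hmax
  obtain ⟨v, rfl⟩ := exists_of_coeff_twist_schurWeyl_ne_zero ha
  refine ⟨v, hmax, ?_⟩
  have hv : ¬ (e : ℤ) ∣ weightCoeffHom R β (R.weylAct v η) := fun hdvd =>
    (associated_leadingValue_schurWeyl hη β v z).ne_zero_iff.1 ha
      (antisymmPow_eq_zero_of_dvd hze hdvd)
  have hle := coord_le_of_lexHom_le (α := α) (J := {β}) hβ
    (hmax.2 (Finsupp.mem_support_iff.2 hne))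
  rw [coe_weylAct, hu] at hle
  rcases smul_fundamentalWeight_eq_or h.strictlyDominant_add hle with hfix | ⟨w, hw, hsub⟩
  · refine absurd (h.dvd_weightCoeffHom ?_) hv
    rw [hfix, coroot'_fundamentalWeight_of_ne b hβ]
  · refine h.gcd_weightCoeffHom_of_smul_eq_sub hsub hβ hw fun h₀ => hv ?_
    have hmod := h.weightCoeffHom_modEq_of_smul_eq_sub hsub hβ
    rw [h₀, zero_mul, neg_zero] at hmod
    exact Int.modEq_zero_iff_dvd.1 hmod

lemma isUnit_leadingValue [IsDomain A] [IsDomain B] {U V X Y : AddMonoidAlgebra A R.weightLattice}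
    {y : R.weightLattice} (hd : 0 < d)
    (hC : b.IsC (U * X + V * Y) (μ + c • b.fundamentalWeight α) d)
    (hU : IsLeading b α U y) (hUz : leadingValue b α β z U y ≠ 0) (hV : VanishesAt R β z V) :
    IsUnit (leadingValue b α β z U y) := by
  obtain ⟨v, hv, hgcd⟩ := h.exists_isGreatest_support_twist_schurWeyl (A := A) hze hzd β
  have hρ := dominantRegular_nsmul_rho b hd
  have hUρ := hU.mul (isLeading_schurWeyl A α hρ)
  have hUρz := hU.leadingValue_mul (isLeading_schurWeyl A α hρ) β z
  rw [leadingValue_schurWeyl_self hρ, weightCoeffHom_nsmul_rho] at hUρz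
  let φ := twist (A := A) (powChar z (weightCoeffHom R β)) (lexHom b α {β})
  have hfactor : φ (R.schurWeyl A (μ + c • b.fundamentalWeight α)) =
      φ (U * R.schurWeyl A (d • b.rho)) * φ X := by
    rw [← show _ = _ from hC, ← map_mul, add_mul, map_add, mul_right_comm V, map_mul φ (_ * _) Y,
      map_mul φ V, show φ V = 0 from vanishesAt_iff_twist_lexHom.1 hV, zero_mul, zero_mul, add_zero,
      mul_right_comm]
  have hval := associated_leadingValue_schurWeyl (A := A) (α := α) h.dominantRegular_add β v z
  rw [leadingValue, show twist _ _ _ = _ from hfactor] at hval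
  rw [show twist _ _ _ = _ from hfactor] at hv
  obtain ⟨x, hx⟩ := exists_coeff_eq_mul_of_isGreatest
    ⟨Finsupp.mem_support_iff.2 (hUρz ▸ mul_ne_zero hUz hzd : leadingValue b α β z _ _ ≠ 0),
      mem_upperBounds_support_twist (hUρ.mem_upperBounds {β}) _⟩ hv
  rw [hx] at hval
  have hdvd : leadingValue b α β z U y * antisymmPow z d ∣ antisymmPow z d := by
    rw [← hUρz]
    refine (Dvd.intro _ rfl).trans (hval.dvd.trans ?_)
    rw [← hgcd]
    exact antisymmPow_dvd_antisymmPow_gcd hze _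
  exact isUnit_of_dvd_one ((mul_dvd_mul_iff_right hzd).1 (by rwa [one_mul]))

end AdmissibleShift

end AdmissibleShift

section CoprimeFactorization

variable {ι M N A B : Type*} [AddCommGroup M] [Module ℝ M] [AddCommGroup N] [Module ℝ N]
  {R : RootPairing ι ℝ M N} {b : R.Base} {α β : b.support} {μ : R.weightLattice} {c e d : ℕ}
  [CommRing A] {U V : AddMonoidAlgebra A R.weightLattice} {y y' : R.weightLattice}

lemma exists_weightCoeffHom_eq_natCast (hμ : b.DominantRegular μ) (β : b.support) :
    ∃ m : ℕ, 0 < m ∧ weightCoeffHom R β μ = m := by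
  obtain ⟨m, hm⟩ := Int.eq_ofNat_of_zero_le (hμ β β.2).le
  exact ⟨m, by exact_mod_cast hm ▸ hμ β β.2, hm⟩

lemma pos_of_dvd_weightCoeff (hμ : b.DominantRegular μ) (h : (e : ℤ) ∣ R.weightCoeff β μ) :
    0 < e := by
  refine Nat.pos_of_ne_zero fun he => (hμ β β.2).ne' (zero_dvd_iff.1 ?_)
  exact_mod_cast he ▸ h

variable [R.IsCrystallographic]

lemma AdmissibleShift.e_pos (h : AdmissibleShift b α μ c e d) : 0 < e :=
  pos_of_dvd_weightCoeff h.dominantRegular (h.dvd_weightCoeff α α.2)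

lemma AdmissibleShift.d_pos (h : AdmissibleShift b α μ c e d) : 0 < d :=
  h.gcdCondition.gcd_eq ▸ Nat.gcd_pos_of_pos_right c h.e_pos

lemma antisymmPow_natCast_eq_zero_iff {B : Type*} [CommRing B] {z : Bˣ} :
    antisymmPow z (d : ℤ) = 0 ↔ z ∈ (powMonoidHom (2 * d) : Bˣ →* Bˣ).ker := by
  rw [antisymmPow_eq_zero_iff, MonoidHom.mem_ker, powMonoidHom_apply]
  norm_cast

lemma sum_weylAct_eq_zero [R.IsRootSystem] [Fintype R.weylGroup]
    (x : R.weightLattice) :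
    ∑ w : R.weylGroup, R.weylAct w x = 0 := by
  have hinv (i : ι) : R.weylAct (ofIdx R i) (∑ w : R.weylGroup, R.weylAct w x) =
      ∑ w : R.weylGroup, R.weylAct w x := by
    rw [map_sum]
    simp_rw [← weylAct_mul]
    exact Fintype.sum_equiv (Equiv.mulLeft (ofIdx R i)) _ _ fun w => rfl
  refine Subtype.ext (R.eq_zero_iff_forall_coroot'_eq_zero.2 fun i => ?_)
  have hneg := weightCoeffHom_weylAct_ofIdx R i (∑ w : R.weylGroup, R.weylAct w x)
  rw [hinv] at hneg
  rw [← weightCoeffHom_cast, Int.cast_eq_zero]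
  omega

variable [Finite ι] [R.IsRootSystem]

variable (b α μ c e d) in
/-- The factorization `U V = C(μ, d)` of the theorem, in the case to be excluded, in which the
greatest common divisor of the conclusion is `d`. -/
structure CoprimeFactorization (U V : AddMonoidAlgebra A R.weightLattice) : Prop where
  shift : AdmissibleShift b α μ c e d
  left_mem : U ∈ R.weylInvariants A
  right_mem : V ∈ R.weylInvariants A
  isC : b.IsC (U * V) μ d
  exists_isC_mul : ∃ Z : AddMonoidAlgebra A R.weightLattice, b.IsC (V * Z) (e • b.rho) d
  exists_isC_add : ∃ X Y : AddMonoidAlgebra A R.weightLattice,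
    b.IsC (U * X + V * Y) (μ + c • b.fundamentalWeight α) d
  not_isUnit_natCast : ∀ β : b.support, ∀ p : ℕ, p.Prime →
    (p : ℤ) ≤ 2 * R.weightCoeff β μ → ¬ IsUnit (p : A)

namespace CoprimeFactorization

variable [R.IsReduced] [R.IsIrreducible] [IsDomain A] [CommRing B] [IsDomain B]
  [CharZero B] [Algebra A B]
  (h : CoprimeFactorization b α μ c e d U V) (hlead : LeadingFactorization b α U V μ d y y')
include h hlead

lemma isUnit_leadingValue {z : Bˣ} (hz : leadingValue b α β z V y' = 0) :
    IsUnit (leadingValue b α β z U y) := by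
  obtain ⟨Z, hZ⟩ := h.exists_isC_mul
  obtain ⟨X, Y, hXY⟩ := h.exists_isC_add
  have heρ := dominantRegular_nsmul_rho b h.shift.e_pos
  have hze : z ^ (2 * (e : ℤ)) = 1 := by
    obtain ⟨x, x', hx⟩ := exists_leadingFactorization α hlead.pos heρ hZ
    obtain rfl := hx.left.unique hlead.right
    rw [← weightCoeffHom_nsmul_rho b β e]
    exact hx.zpow_eq_one_of_leadingValue_eq_zero hz
  have hzd := hlead.symm.antisymmPow_ne_zero hz
  have hzU := hlead.symm.leadingValue_right_ne_zero hz
  exact h.shift.isUnit_leadingValue hze hzd hlead.pos hXY hlead.left hzU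
    (hlead.symm.vanishesAt_left h.shift.dvd_weightCoeff hze hzd hzU)

lemma leadingValue_mul_eq_zero {p k : ℕ} (hp : p.Prime) (hpB : ¬ IsUnit (p : B)) {z ξ : Bˣ}
    (hξ : ξ ^ p ^ k = 1) (hzμ : (z * ξ) ^ (2 * weightCoeffHom R β μ) = 1)
    (hzd : antisymmPow (z * ξ) d ≠ 0) (hz : leadingValue b α β z V y' = 0) :
    leadingValue b α β (z * ξ) V y' = 0 := by
  by_contra hzξ
  have hU := (hlead.leadingValue_eq_zero_or hzμ hzd).resolve_right hzξ
  have hdvd := one_sub_dvd_leadingValue_sub (b := b) (α := α) (β := β) z ξ U y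
  rw [hU, sub_zero] at hdvd
  have hξ' : (ξ : B) ^ p ^ k = 1 := by rw [← Units.val_pow_eq_pow_val, hξ, Units.val_one]
  exact hpB <| isUnit_natCast_of_isUnit_one_sub hp hξ'
    (isUnit_of_dvd_unit hdvd (h.isUnit_leadingValue hlead hz))

lemma isPrimePowInvariant {m : ℕ} (hm₀ : 0 < m) (hm : weightCoeffHom R β μ = m)
    (hB : ∀ p : ℕ, IsUnit (p : B) → IsUnit (p : A)) :
    IsPrimePowInvariant (2 * m) (powMonoidHom (2 * d) : Bˣ →* Bˣ).ker
      fun z => leadingValue b α β z V y' = 0 := by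
  intro p k hp hk hpm z ξ hz hzH hξ hzξH
  have hpB : ¬ IsUnit (p : B) := fun hu => h.not_isUnit_natCast β p hp (by
    rw [← weightCoeffHom_apply, hm]
    exact_mod_cast Nat.le_of_dvd (by omega) ((dvd_pow_self p hk.ne').trans hpm)) (hB p hu)
  have hpow {ζ : Bˣ} (hζ : ζ ^ (2 * m) = 1) : ζ ^ (2 * weightCoeffHom R β μ) = 1 := by
    rw [hm]
    exact_mod_cast hζ
  have hξm : ξ ^ (2 * m) = 1 := by
    obtain ⟨n, hn⟩ := hpm
    rw [hn, pow_mul, hξ, one_pow]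
  constructor
  · exact h.leadingValue_mul_eq_zero hlead hp hpB hξ
      (hpow (by rw [mul_pow, hz, hξm, one_mul])) (mt antisymmPow_natCast_eq_zero_iff.1 hzξH)
  · intro hzξ
    have hinv : z * ξ * ξ⁻¹ = z := mul_inv_cancel_right z ξ
    rw [← hinv] at hz hzH ⊢
    exact h.leadingValue_mul_eq_zero hlead hp hpB (by rw [inv_pow, hξ, inv_one]) (hpow hz)
      (mt antisymmPow_natCast_eq_zero_iff.1 hzH) hzξ

lemma leadingValue_ne_zero_or (β : b.support) (hB : ∀ p : ℕ, IsUnit (p : B) → IsUnit (p : A)) :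
    (∀ z : Bˣ, leadingValue b α β z U y ≠ 0) ∨ ∀ z : Bˣ, leadingValue b α β z V y' ≠ 0 := by
  by_contra! hzeros
  obtain ⟨⟨z₁, hz₁⟩, z₂, hz₂⟩ := hzeros
  obtain ⟨m, hm₀, hm⟩ := exists_weightCoeffHom_eq_natCast h.shift.dominantRegular β
  have hpow {ζ : Bˣ} (hζ : ζ ^ (2 * weightCoeffHom R β μ) = 1) : ζ ^ (2 * m) = 1 := by
    rw [hm] at hζ
    exact_mod_cast hζ
  refine hlead.leadingValue_right_ne_zero hz₁ ?_
  exact ((h.isPrimePowInvariant hlead hm₀ hm hB).iff (by omega)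
    (hpow (hlead.symm.zpow_eq_one_of_leadingValue_eq_zero hz₂))
    (hpow (hlead.zpow_eq_one_of_leadingValue_eq_zero hz₁))
    (mt antisymmPow_natCast_eq_zero_iff.2 (hlead.symm.antisymmPow_ne_zero hz₂))
    (mt antisymmPow_natCast_eq_zero_iff.2 (hlead.antisymmPow_ne_zero hz₁))).1 hz₂

end CoprimeFactorization

section Field

variable {K : Type*} [Field K] [CharZero K] [Algebra A K] [FaithfulSMul A K]

namespace CoprimeFactorization

variable [R.IsReduced] [R.IsIrreducible] [IsDomain A]
  (h : CoprimeFactorization b α μ c e d U V) (hlead : LeadingFactorization b α U V μ d y y')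
include h hlead

-- The zeros of leading values are roots of unity, so they lie in the integral closure of `A`, in
-- which a rational prime is a unit only if it is a unit in `A`.
lemma forall_leadingValue_ne_zero_or (β : b.support) :
    (∀ z : Kˣ, leadingValue b α β z U y ≠ 0) ∨ ∀ z : Kˣ, leadingValue b α β z V y' ≠ 0 := by
  have hne : 2 * weightCoeffHom R β μ ≠ 0 :=
    mul_ne_zero two_ne_zero (h.shift.dominantRegular β β.2).ne'
  have hlift {F : AddMonoidAlgebra A R.weightLattice} {x : R.weightLattice}
      (hF : ∀ z : Kˣ, leadingValue b α β z F x = 0 → z ^ (2 * weightCoeffHom R β μ) = 1)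
      (hint : ∀ z : (integralClosure A K)ˣ, leadingValue b α β z F x ≠ 0) (z : Kˣ) :
      leadingValue b α β z F x ≠ 0 := fun hz => by
    obtain ⟨z, rfl⟩ := exists_map_eq_of_zpow_eq_one A hne (hF z hz)
    rw [← map_leadingValue] at hz
    exact hint z (Subtype.ext hz)
  exact (h.leadingValue_ne_zero_or hlead β fun p => isUnit_natCast_of_isUnit_integralClosure).imp
    (hlift fun z => hlead.zpow_eq_one_of_leadingValue_eq_zero)
    (hlift fun z => hlead.symm.zpow_eq_one_of_leadingValue_eq_zero)

lemma vanishesAt_dichotomy [IsAlgClosed K] (β : b.support) :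
    (weightCoeffHom R β y = 0 ∧ ∀ z : Kˣ, z ^ (2 * (e : ℤ)) = 1 → antisymmPow z d ≠ 0 →
      VanishesAt R β z V ∧ ¬ VanishesAt R β z U) ∨
    (weightCoeffHom R β y' = 0 ∧ ∀ z : Kˣ, z ^ (2 * (e : ℤ)) = 1 → antisymmPow z d ≠ 0 →
      VanishesAt R β z U ∧ ¬ VanishesAt R β z V) := by
  refine (h.forall_leadingValue_ne_zero_or (K := K) hlead β).imp (fun hne => ⟨?_, ?_⟩)
    fun hne => ⟨?_, ?_⟩
  · exact weightCoeffHom_eq_zero_of_leadingValue_ne_zero h.left_mem hlead.left.coeff_ne_zero hne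
  · exact fun z hze hzd => ⟨hlead.symm.vanishesAt_left h.shift.dvd_weightCoeff hze hzd (hne z),
      not_vanishesAt_of_leadingValue_ne_zero (hne z)⟩
  · exact weightCoeffHom_eq_zero_of_leadingValue_ne_zero h.right_mem hlead.right.coeff_ne_zero hne
  · exact fun z hze hzd => ⟨hlead.vanishesAt_left h.shift.dvd_weightCoeff hze hzd (hne z),
      not_vanishesAt_of_leadingValue_ne_zero (hne z)⟩

end CoprimeFactorization

lemma exists_zpow_eq_one_of_dvd [IsAlgClosed K] (hde : d ∣ e) (hne : e ≠ d) (he : 0 < e) :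
    ∃ z : Kˣ, z ^ (2 * (e : ℤ)) = 1 ∧ antisymmPow z d ≠ 0 := by
  have : NeZero ((2 * e : ℕ) : K) := ⟨by exact_mod_cast (by omega : 2 * e ≠ 0)⟩
  obtain ⟨ζ, hζ⟩ := HasEnoughRootsOfUnity.exists_primitiveRoot K (2 * e)
  obtain ⟨z, rfl⟩ := hζ.isUnit (by omega)
  rw [IsPrimitiveRoot.coe_units_iff] at hζ
  refine ⟨z, by exact_mod_cast hζ.pow_eq_one, fun h => hne ?_⟩
  have hdvd : 2 * e ∣ 2 * d := hζ.dvd_of_pow_eq_one _ (by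
    exact_mod_cast antisymmPow_eq_zero_iff.1 h)
  exact Nat.dvd_antisymm ((Nat.mul_dvd_mul_iff_left two_pos).1 hdvd) hde

end Field

section LeadingZero

-- All exponents are `≤ 0` in every Weyl conjugate of the order, but the sum of an orbit is zero.
lemma eq_single_of_isLeading_zero {F : AddMonoidAlgebra A R.weightLattice}
    (hF : F ∈ R.weylInvariants A) (h : IsLeading b α F 0) : F = single 0 (F.coeff 0) := by
  classical
  let := Fintype.ofFinite R.weylGroup
  have hsupp {p : R.weightLattice} (hp : F.coeff p ≠ 0) : p = 0 := by
    have hle (w : R.weylGroup) : lexHom b α ∅ (R.weylAct w p) ≤ 0 := by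
      rw [← map_zero (lexHom b α ∅)]
      exact (h.mem_upperBounds ∅) ⟨R.weylAct w p, by
        rwa [Finset.mem_coe, Finsupp.mem_support_iff, coeff_weylAct R hF], rfl⟩
    have hsum : ∑ w : R.weylGroup, lexHom b α ∅ (R.weylAct w p) = 0 := by
      rw [← map_sum, sum_weylAct_eq_zero, map_zero]
    have hone := (Finset.sum_eq_zero_iff_of_nonpos fun w _ => hle w).1 hsum 1 (Finset.mem_univ _)
    rw [weylAct_one, ← map_zero (lexHom b α ∅)] at hone
    exact lexHom_empty_injective hone
  ext p
  rw [coeff_single, Finsupp.single_apply]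
  split_ifs with hp
  · rw [← hp]
  · exact not_ne_iff.1 fun hne => hp (hsupp hne).symm

lemma isUnit_of_isLeading_zero {U : R.weylInvariants A}
    (h : IsLeading b α (U : AddMonoidAlgebra A R.weightLattice) 0)
    (hU : IsUnit ((U : AddMonoidAlgebra A R.weightLattice).coeff 0)) : IsUnit U := by
  obtain ⟨v, hv⟩ := hU.exists_right_inv
  have hmem : (single 0 v : AddMonoidAlgebra A R.weightLattice) ∈ R.weylInvariants A := by
    simp only [weylInvariants, Subring.mem_iInf]
    intro w
    change mapDomainRingHom A (R.weylAct w) (single 0 v) = single 0 v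
    simp [mapDomainRingHom]
  refine IsUnit.of_mul_eq_one ⟨_, hmem⟩ (Subtype.ext ?_)
  change (U : AddMonoidAlgebra A R.weightLattice) * single 0 v = 1
  rw [eq_single_of_isLeading_zero U.2 h, single_mul_single, add_zero, hv]
  rfl

end LeadingZero

end CoprimeFactorization

section TangentChar

variable {A K P G : Type*} [CommRing A] [Field K] [Algebra A K] [AddCommGroup P] [AddCommGroup G]

/-- The character `x ↦ (1 + f(x)ε) z ^ f'(x)` with values in the dual numbers, whose `ε`-part
detects `f` to first order. -/
def tangentChar (z : Kˣ) (f f' : P →+ ℤ) : Multiplicative P →* DualNumber K :=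
  powChar (tangentUnit 1) f *
    powChar (Units.map (TrivSqZeroExt.inlHom K K : K →* DualNumber K) z) f'

lemma tangentChar_apply (z : Kˣ) (f f' : P →+ ℤ) (x : P) :
    tangentChar z f f' (.ofAdd x) =
      TrivSqZeroExt.inl ((z ^ f' x : Kˣ) : K) +
        TrivSqZeroExt.inr ((f x : K) * ((z ^ f' x : Kˣ) : K)) := by
  rw [tangentChar, MonoidHom.mul_apply, powChar_apply, powChar_apply, tangentUnit_zpow, ← map_zpow,
    Units.coe_map]
  ext <;> simp

lemma fstHom_comp_tangentChar (z : Kˣ) (f f' : P →+ ℤ) :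
    ((TrivSqZeroExt.fstHom A K K : DualNumber K →ₐ[A] K) : DualNumber K →* K).comp
      (tangentChar z f f') = powChar z f' := by
  refine MonoidHom.ext fun x => ?_
  change (tangentChar z f f' (.ofAdd x.toAdd)).fst = powChar z f' (.ofAdd x.toAdd)
  rw [tangentChar_apply, powChar_apply]
  simp

lemma mul_eq_zero_of_fst_coeff_eq_zero {F₁ F₂ : AddMonoidAlgebra (DualNumber K) G}
    (h₁ : ∀ x, (F₁.coeff x).fst = 0) (h₂ : ∀ x, (F₂.coeff x).fst = 0) : F₁ * F₂ = 0 := by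
  rw [mul_def]
  refine Finset.sum_eq_zero fun x _ => Finset.sum_eq_zero fun y _ => ?_
  change single (x + y) (F₁.coeff x * F₂.coeff y) = 0
  rw [dualNumber_mul_eq_zero (h₁ x) (h₂ y), single_zero]

lemma twist_tangentChar_mul_eq_zero {z : Kˣ} {f' : P →+ ℤ} {g : P →+ G}
    {F₁ F₂ : AddMonoidAlgebra A P} (h₁ : twist (powChar z f') g F₁ = 0)
    (h₂ : twist (powChar z f') g F₂ = 0) (f : P →+ ℤ) :
    twist (tangentChar z f f') g (F₁ * F₂) = 0 := by
  have hfst : ∀ F : AddMonoidAlgebra A P, twist (powChar z f') g F = 0 →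
      ∀ x, ((twist (tangentChar z f f') g F).coeff x).fst = 0 := by
    intro F hF x
    have h := map_coeff_twist (tangentChar z f f') g (TrivSqZeroExt.fstHom A K K) F x
    rwa [fstHom_comp_tangentChar, hF] at h
  rw [map_mul]
  exact mul_eq_zero_of_fst_coeff_eq_zero (hfst F₁ h₁) (hfst F₂ h₂)

end TangentChar

section RankTwo

variable {ι M N : Type*} [AddCommGroup M] [Module ℝ M] [AddCommGroup N] [Module ℝ N]
  {R : RootPairing ι ℝ M N}

section Reflections

variable [R.IsCrystallographic]

lemma weightCoeffHom_weylAct_ofIdx_of_pairing_eq_zero {i j : ι} (h : R.pairing i j = 0)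
    (x : R.weightLattice) :
    weightCoeffHom R j (R.weylAct (ofIdx R i) x) = weightCoeffHom R j x := by
  rw [weightCoeffHom_eq_iff, coe_weylAct, coroot'_ofIdx_smul, h, mul_zero, sub_zero,
    weightCoeffHom_cast]

lemma weightCoeffHom_weylAct_ofIdx_eq_reflectionPerm (i j : ι) (x : R.weightLattice) :
    weightCoeffHom R j (R.weylAct (ofIdx R i) x) = weightCoeffHom R (R.reflectionPerm i j) x := by
  have h := weightCoeffHom_weylGroupToPerm_weylAct R (ofIdx R i) (R.reflectionPerm i j) x
  rwa [weylGroupToPerm_ofIdx, R.reflectionPerm_self] at h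

lemma weightCoeffHom_reflectionPerm {i j : ι} (h : R.pairing i j = -2) (x : R.weightLattice) :
    weightCoeffHom R (R.reflectionPerm i j) x =
      weightCoeffHom R j x + 2 * weightCoeffHom R i x := by
  rw [← weightCoeffHom_weylAct_ofIdx_eq_reflectionPerm, weightCoeffHom_eq_iff, coe_weylAct,
    coroot'_ofIdx_smul, h]
  push_cast
  rw [weightCoeffHom_cast, weightCoeffHom_cast]
  ring

end Reflections

lemma pairing_reflectionPerm_eq_zero {i j : ι} (hij : R.pairing i j = -2)
    (hji : R.pairing j i = -1) : R.pairing (R.reflectionPerm i j) j = 0 := by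
  rw [← R.root_coroot'_eq_pairing, R.root_reflectionPerm, reflection_apply, map_sub, map_smul,
    R.root_coroot'_eq_pairing, R.root_coroot'_eq_pairing, R.root_coroot'_eq_pairing, hij, hji,
    R.pairing_same]
  norm_num

/-- The element of the group generated by the reflections in `i` and `j` with given exponents of
the reflections in `j`, in `s_i j` and in `i`. If `i` and `j` are simple roots of a subsystem of
type `B₂` with `i` long, then the first two reflections commute and every element is of this
form. -/
def rankTwoWord (R : RootPairing ι ℝ M N) (i j : ι) (t : Bool × Bool × Bool) : R.weylGroup :=
  (if t.1 then ofIdx R j else 1) * (if t.2.1 then ofIdx R (R.reflectionPerm i j) else 1) *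
    (if t.2.2 then ofIdx R i else 1)

lemma weylSign_rankTwoWord [Finite ι] [R.IsRootSystem] (i j : ι) (t : Bool × Bool × Bool) :
    R.weylSign (rankTwoWord R i j t) =
      (if t.1 then -1 else 1) * (if t.2.1 then -1 else 1) * (if t.2.2 then -1 else 1) := by
  obtain ⟨_ | _, _ | _, _ | _⟩ := t <;>
    simp [rankTwoWord, weylSign_mul, weylSign_reflection, weylSign_one]

section Words

variable {i j : ι} (hij : R.pairing i j = -2) (hji : R.pairing j i = -1)

include hij hji in
lemma ofIdx_left_mul_rankTwoWord (t₁ t₂ t₃ : Bool) :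
    ofIdx R i * rankTwoWord R i j (t₁, t₂, t₃) = rankTwoWord R i j (t₂, t₁, !t₃) := by
  have h₁ : ofIdx R i * ofIdx R j = ofIdx R (R.reflectionPerm i j) * ofIdx R i :=
    ofIdx_mul_ofIdx R i j
  have h₂ : ofIdx R i * ofIdx R (R.reflectionPerm i j) = ofIdx R j * ofIdx R i := by
    rw [ofIdx_mul_ofIdx, R.reflectionPerm_self]
  have h₃ : ofIdx R (R.reflectionPerm i j) * ofIdx R j =
      ofIdx R j * ofIdx R (R.reflectionPerm i j) := by
    rw [ofIdx_mul_ofIdx,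
      R.reflectionPerm_eq_of_pairing_eq_zero' (pairing_reflectionPerm_eq_zero hij hji)]
  cases t₁ <;> cases t₂ <;> cases t₃ <;>
    simp [rankTwoWord, ← mul_assoc, h₁, h₂, ofIdx_mul_self] <;>
    simp [mul_assoc, h₂, ← h₃, ofIdx_mul_self]

lemma ofIdx_right_mul_rankTwoWord (t₁ t₂ t₃ : Bool) :
    ofIdx R j * rankTwoWord R i j (t₁, t₂, t₃) = rankTwoWord R i j (!t₁, t₂, t₃) := by
  cases t₁ <;> simp [rankTwoWord, ← mul_assoc, ofIdx_mul_self]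

variable [R.IsCrystallographic]

include hij hji in
lemma weightCoeffHom_weylAct_rankTwoWord (t : Bool × Bool × Bool) (x : R.weightLattice) :
    weightCoeffHom R j (R.weylAct (rankTwoWord R i j t) x) = (if t.1 then -1 else 1) *
      (if t.2.2 then weightCoeffHom R (R.reflectionPerm i j) x else weightCoeffHom R j x) := by
  have h := weightCoeffHom_weylAct_ofIdx_of_pairing_eq_zero (pairing_reflectionPerm_eq_zero hij hji)
  obtain ⟨_ | _, _ | _, _ | _⟩ := t <;>
    simp [rankTwoWord, weylAct_mul, weylAct_one, weightCoeffHom_weylAct_ofIdx, h,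
      weightCoeffHom_weylAct_ofIdx_eq_reflectionPerm]

include hij hji in
lemma weightCoeffHom_reflectionPerm_weylAct_rankTwoWord (t : Bool × Bool × Bool)
    (x : R.weightLattice) :
    weightCoeffHom R (R.reflectionPerm i j) (R.weylAct (rankTwoWord R i j t) x) =
      (if t.2.1 then -1 else 1) *
        (if t.2.2 then weightCoeffHom R j x else weightCoeffHom R (R.reflectionPerm i j) x) := by
  have h := weightCoeffHom_weylAct_ofIdx_of_pairing_eq_zero
    (R.pairing_eq_zero_iff.1 (pairing_reflectionPerm_eq_zero hij hji))
  have h' (x : R.weightLattice) : weightCoeffHom R (R.reflectionPerm i j)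
      (R.weylAct (ofIdx R i) x) = weightCoeffHom R j x := by
    rw [weightCoeffHom_weylAct_ofIdx_eq_reflectionPerm, R.reflectionPerm_self]
  obtain ⟨_ | _, _ | _, _ | _⟩ := t <;>
    simp [rankTwoWord, weylAct_mul, weylAct_one, weightCoeffHom_weylAct_ofIdx, h, h']

include hij hji in
lemma rankTwoWord_injective {x : R.weightLattice} (hj : 0 < weightCoeffHom R j x)
    (hi : 0 < weightCoeffHom R i x) : Function.Injective (rankTwoWord R i j) := by
  intro t t' h
  have h₁ := weightCoeffHom_weylAct_rankTwoWord hij hji t x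
  have h₂ := weightCoeffHom_reflectionPerm_weylAct_rankTwoWord hij hji t x
  rw [h, weightCoeffHom_weylAct_rankTwoWord hij hji] at h₁
  rw [h, weightCoeffHom_reflectionPerm_weylAct_rankTwoWord hij hji] at h₂
  rw [weightCoeffHom_reflectionPerm hij] at h₁ h₂
  obtain ⟨_ | _, _ | _, _ | _⟩ := t <;> obtain ⟨_ | _, _ | _, _ | _⟩ := t' <;>
    simp at h₁ h₂ ⊢ <;> omega

end Words

lemma exists_rankTwoWord_eq {b : R.Base} {β δ : b.support} (hβδ : R.pairing β δ = -2)
    (hδβ : R.pairing δ β = -1) {w : R.weylGroup} (hw : w ∈ parabolic b {β, δ}) :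
    ∃ t, rankTwoWord R β δ t = w := by
  have hmul {v : R.weylGroup} (hv : ∃ t, rankTwoWord R β δ t = v) {i : b.support}
      (hi : i ∈ ({β, δ} : Set b.support)) : ∃ t, rankTwoWord R β δ t = ofIdx R i * v := by
    obtain ⟨t, rfl⟩ := hv
    rcases hi with rfl | rfl
    · exact ⟨_, (ofIdx_left_mul_rankTwoWord hβδ hδβ ..).symm⟩
    · exact ⟨_, (ofIdx_right_mul_rankTwoWord ..).symm⟩
  induction hw using Subgroup.closure_induction_left with
  | one => exact ⟨(false, false, false), by simp [rankTwoWord]⟩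
  | mul_left s hs v _ ih =>
    obtain ⟨i, hi, rfl⟩ := hs
    exact hmul ih hi
  | inv_mul_cancel s hs v _ ih =>
    obtain ⟨i, hi, rfl⟩ := hs
    simp only [ofIdx_inv]
    exact hmul ih hi

lemma snd_sum_rankTwoWord [Finite ι] [R.IsRootSystem] [R.IsCrystallographic] {K : Type*} [Field K]
    {i j : ι} (hij : R.pairing i j = -2) (hji : R.pairing j i = -1)
    (z : Kˣ) (x : R.weightLattice) :
    (∑ t, (R.weylSign (rankTwoWord R i j t) : DualNumber K) *
      tangentChar z (weightCoeffHom R j) (weightCoeffHom R (R.reflectionPerm i j))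
        (.ofAdd (R.weylAct (rankTwoWord R i j t) x))).snd =
      2 * (weightCoeffHom R j x *
          antisymmPow z (weightCoeffHom R (R.reflectionPerm i j) x) -
        weightCoeffHom R (R.reflectionPerm i j) x * antisymmPow z (weightCoeffHom R j x)) := by
  have hterm (n : ℤ) (a c : K) : ((n : DualNumber K) *
      (TrivSqZeroExt.inl a + TrivSqZeroExt.inr c)).snd = n * c := by
    rw [← zsmul_eq_mul, TrivSqZeroExt.snd_smul]
    simp
  simp_rw [tangentChar_apply, TrivSqZeroExt.snd_sum, hterm, weylSign_rankTwoWord,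
    weightCoeffHom_weylAct_rankTwoWord hij hji,
    weightCoeffHom_reflectionPerm_weylAct_rankTwoWord hij hji, Fintype.sum_prod_type,
    Fintype.sum_bool]
  simp only [antisymmPow, if_true, if_false, Bool.false_eq_true, one_mul, neg_mul]
  push_cast
  ring

section Vanishing

variable [R.IsCrystallographic] [R.IsRootSystem] {b : R.Base} {α β δ : b.support}
  {A B : Type*} [CommRing A] [CommRing B] [Algebra A B] {z : Bˣ}
  {F : AddMonoidAlgebra A R.weightLattice}

lemma twist_eq_zero_of_vanishesAt_left (hβδ : R.pairing β δ = -2) (hF : VanishesAt R (β : ι) z F) :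
    twist (powChar z (weightCoeffHom R (R.reflectionPerm β δ))) (lexHom b α {β, δ}) F = 0 := by
  refine twist_eq_zero_of_factor (fun p hp => ?_) hF
  obtain ⟨a, ha⟩ : ∃ a : ℝ, a • R.root β = p :=
    Submodule.mem_span_singleton.1 ((Submodule.Quotient.mk_eq_zero _).1 hp)
  have hcoeff : weightCoeffHom R (R.reflectionPerm β δ) p = weightCoeffHom R β p := by
    rw [weightCoeffHom_reflectionPerm hβδ]
    suffices h : weightCoeffHom R δ p + weightCoeffHom R β p = 0 by linarith
    rify
    rw [weightCoeffHom_cast, weightCoeffHom_cast, ← ha, map_smul, map_smul,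
      R.root_coroot'_eq_pairing, R.root_coroot'_eq_pairing, hβδ, R.pairing_same, smul_eq_mul,
      smul_eq_mul]
    ring
  refine ⟨by rw [powChar_apply, powChar_apply, hcoeff], ?_⟩
  rw [← map_zero (lexHom b α {β, δ}), lexHom_eq_iff]
  intro i hi
  rw [← ha, map_smul, coord_root_of_ne b fun h : i = β => hi (h ▸ Set.mem_insert _ _)]
  simp

lemma twist_eq_zero_of_vanishesAt_right (hinv : F ∈ R.weylInvariants A)
    (hF : VanishesAt R (δ : ι) z F) :
    twist (powChar z (weightCoeffHom R (R.reflectionPerm β δ))) (lexHom b α {β, δ}) F = 0 := by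
  refine twist_eq_zero_of_factor (fun p hp => ⟨rfl, ?_⟩) (hF.weylGroupToPerm hinv (ofIdx R β))
  obtain ⟨a, ha⟩ : ∃ a : ℝ, a • R.root (R.weylGroupToPerm (ofIdx R β) δ) = p :=
    Submodule.mem_span_singleton.1 ((Submodule.Quotient.mk_eq_zero _).1 hp)
  rw [← map_zero (lexHom b α {β, δ}), lexHom_eq_iff]
  intro i hi
  rw [← ha, map_smul, root_weylGroupToPerm,
    coord_ofIdx_smul_of_ne b fun h : i = β => hi (h ▸ Set.mem_insert _ _),
    coord_root_of_ne b fun h : i = δ => hi (h ▸ Set.mem_insert_of_mem _ rfl)]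
  simp

end Vanishing

section Identity

variable [R.IsRootSystem] [R.IsCrystallographic] {b : R.Base}
  {α β δ : b.support} {A K : Type*} [CommRing A] [Field K] [Algebra A K] {z : Kˣ}
  {x : R.weightLattice} {u : R.weylGroup}

lemma filter_lexHom_eq_image_rankTwoWord [Fintype R.weylGroup] [DecidableEq R.weylGroup]
    (hβδ : R.pairing β δ = -2) (hδβ : R.pairing δ β = -1)
    (hu : ∀ v : R.weylGroup, (∀ i ∉ ({β, δ} : Set b.support),
      coord b i (v • (x : M)) = coord b i (u • (x : M))) → v * u⁻¹ ∈ parabolic b {β, δ}) :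
    Finset.univ.filter (fun v : R.weylGroup =>
        lexHom b α {β, δ} (R.weylAct v x) = lexHom b α {β, δ} (R.weylAct u x)) =
      Finset.univ.image (rankTwoWord R β δ · * u) := by
  ext v
  simp only [Finset.mem_filter, Finset.mem_univ, true_and, Finset.mem_image]
  constructor
  · intro hv
    obtain ⟨t, ht⟩ := exists_rankTwoWord_eq hβδ hδβ (hu v (lexHom_eq_iff.1 hv))
    exact ⟨t, by rw [ht, inv_mul_cancel_right]⟩
  · rintro ⟨t, rfl⟩
    have hβ (x : R.weightLattice) :
        lexHom b α {β, δ} (R.weylAct (ofIdx R β) x) = lexHom b α {β, δ} x :=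
      lexHom_weylAct_ofIdx α (Set.mem_insert _ _) x
    have hδ (x : R.weightLattice) :
        lexHom b α {β, δ} (R.weylAct (ofIdx R δ) x) = lexHom b α {β, δ} x :=
      lexHom_weylAct_ofIdx α (Set.mem_insert_of_mem β (Set.mem_singleton δ)) x
    obtain ⟨_ | _, _ | _, _ | _⟩ := t <;>
      simp [rankTwoWord, ofIdx_reflectionPerm, weylAct_mul, hβ, hδ]

variable [Finite ι]

lemma twist_tangentChar_schurWeyl_eq_zero (hβδ : R.pairing β δ = -2) (hδβ : R.pairing δ β = -1)
    {F₁ F₂ X₁ X₂ : AddMonoidAlgebra A R.weightLattice} {y : R.weightLattice}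
    (h₁ : VanishesAt R (β : ι) z F₁) (h₂ : VanishesAt R (δ : ι) z F₂)
    (hinv : F₂ ∈ R.weylInvariants A)
    (hx : (F₁ * X₁ + F₂ * X₂) * R.schurWeyl A y = R.schurWeyl A x) (f : R.weightLattice →+ ℤ) :
    twist (tangentChar z f (weightCoeffHom R (R.reflectionPerm β δ))) (lexHom b α {β, δ})
      (R.schurWeyl A x) = 0 := by
  have hδ : δ ∈ ({β, δ} : Set b.support) := Set.mem_insert_of_mem _ rfl
  rw [← hx]
  refine twist_tangentChar_mul_eq_zero ?_ (twist_schurWeyl_eq_zero (δ : ι) (fun w => ?_)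
    (lexHom_weylAct_ofIdx α hδ)) f
  · rw [map_add, map_mul, map_mul, twist_eq_zero_of_vanishesAt_left hβδ h₁,
      twist_eq_zero_of_vanishesAt_right hinv h₂, zero_mul, zero_mul, add_zero]
  · rw [powChar_apply, powChar_apply, weightCoeffHom_weylAct_ofIdx_of_pairing_eq_zero
      (R.pairing_eq_zero_iff.1 (pairing_reflectionPerm_eq_zero hβδ hδβ))]

lemma mul_antisymmPow_eq [CharZero K] (hβδ : R.pairing β δ = -2)
    (hδβ : R.pairing δ β = -1)
    {F₁ F₂ X₁ X₂ : AddMonoidAlgebra A R.weightLattice} {y : R.weightLattice}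
    (h₁ : VanishesAt R (β : ι) z F₁) (h₂ : VanishesAt R (δ : ι) z F₂)
    (hinv : F₂ ∈ R.weylInvariants A)
    (hx : (F₁ * X₁ + F₂ * X₂) * R.schurWeyl A y = R.schurWeyl A x)
    (hu : ∀ v : R.weylGroup, (∀ i ∉ ({β, δ} : Set b.support),
      coord b i (v • (x : M)) = coord b i (u • (x : M))) → v * u⁻¹ ∈ parabolic b {β, δ})
    {p r : ℤ} (hp : weightCoeffHom R δ (R.weylAct u x) = p)
    (hr : weightCoeffHom R β (R.weylAct u x) = r) (hp0 : 0 < p) (hr0 : 0 < r) :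
    (p : K) * antisymmPow z (p + 2 * r) = (p + 2 * r : ℤ) * antisymmPow z p := by
  classical
  let := Fintype.ofFinite R.weylGroup
  let χ := tangentChar z (weightCoeffHom R δ) (weightCoeffHom R (R.reflectionPerm β δ))
  have hinj : Function.Injective (rankTwoWord R β δ · * u) := fun t t' h =>
    rankTwoWord_injective hβδ hδβ (hp ▸ hp0) (hr ▸ hr0) (mul_right_cancel h)
  have hcoeff : (twist χ (lexHom b β {β, δ}) (R.schurWeyl A x)).coeff
      (lexHom b β {β, δ} (R.weylAct u x)) = 0 := by
    rw [twist_tangentChar_schurWeyl_eq_zero hβδ hδβ h₁ h₂ hinv hx]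
    rfl
  rw [coeff_twist_schurWeyl, filter_lexHom_eq_image_rankTwoWord hβδ hδβ hu,
    Finset.sum_image hinj.injOn] at hcoeff
  simp_rw [weylSign_mul, weylAct_mul, mul_comm _ (R.weylSign u), Int.cast_mul, mul_assoc,
    ← Finset.mul_sum] at hcoeff
  have hsign := (isUnit_weylSign R u).map (Int.castRingHom (DualNumber K))
  rw [eq_intCast] at hsign
  rw [hsign.mul_right_eq_zero] at hcoeff
  have hsnd := snd_sum_rankTwoWord hβδ hδβ z (R.weylAct u x)
  rw [hcoeff, TrivSqZeroExt.snd_zero, weightCoeffHom_reflectionPerm hβδ, hp, hr] at hsnd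
  exact sub_eq_zero.1 ((mul_eq_zero.1 hsnd.symm).resolve_left two_ne_zero)

end Identity

end RankTwo

section RootLengths

variable {ι M N : Type*} [Fintype ι] [AddCommGroup M] [Module ℝ M] [AddCommGroup N] [Module ℝ N]
  {R : RootPairing ι ℝ M N}

lemma normSq_weylGroupToPerm (w : R.weylGroup) (i : ι) :
    R.normSq (R.weylGroupToPerm w i) = R.normSq i := by
  rw [normSq, root_weylGroupToPerm, rootForm_weylGroup_smul, normSq]

lemma normSq_reflectionPerm (i j : ι) : R.normSq (R.reflectionPerm i j) = R.normSq j := by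
  rw [← weylGroupToPerm_ofIdx, normSq_weylGroupToPerm]

variable [R.IsCrystallographic]

lemma pairingIn_mul_normSq (i j : ι) :
    (R.pairingIn ℤ i j : ℝ) * R.normSq j = R.pairingIn ℤ j i * R.normSq i := by
  have h := R.toInvariantForm.pairing_mul_eq_pairing_mul_swap j i
  rwa [← R.algebraMap_pairingIn ℤ, ← R.algebraMap_pairingIn ℤ] at h

lemma pairingIn_eq_mul_of_normSq_eq [R.IsRootSystem] {i j : ι} {m : ℕ}
    (h : R.normSq i = m * R.normSq j) : R.pairingIn ℤ i j = m * R.pairingIn ℤ j i := by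
  have hswap := pairingIn_mul_normSq (R := R) i j
  rw [h, ← mul_assoc, mul_comm _ (m : ℝ)] at hswap
  exact_mod_cast mul_right_cancel₀ (normSq_pos j).ne' hswap

lemma normSq_eq_two_mul_of_pairingIn {i j : ι} (h : R.pairingIn ℤ i j = -2)
    (h' : R.pairingIn ℤ j i = -1) : R.normSq i = 2 * R.normSq j := by
  have hswap := pairingIn_mul_normSq (R := R) i j
  rw [h, h'] at hswap
  push_cast at hswap
  linarith

lemma abs_pairingIn_le_one_of_normSq_eq {i j : ι} (h : R.normSq i = R.normSq j)
    (hne : R.root i ≠ R.root j) (hne' : R.root i ≠ -R.root j) : |R.pairingIn ℤ i j| ≤ 1 := by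
  have hmem := R.pairingIn_pairingIn_mem_set_of_length_eq_of_ne (B := R.toInvariantForm) h
    (mt (congrArg R.root) hne) hne'
  simp only [Set.mem_insert_iff, Set.mem_singleton_iff, Prod.mk.injEq] at hmem
  rw [abs_le]
  omega

variable [R.IsRootSystem] [R.IsReduced]

lemma natAbs_pairingIn_eq_one_of_normSq_le {i j : ι} (h : R.normSq i ≤ R.normSq j)
    (hne : R.root i ≠ R.root j) (hne' : R.root i ≠ -R.root j) (h₀ : R.pairingIn ℤ i j ≠ 0) :
    (R.pairingIn ℤ i j).natAbs = 1 := by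
  have hi := normSq_pos (R := R) i
  have hswap := pairingIn_mul_normSq (R := R) i j
  have hmem := R.pairingIn_pairingIn_mem_set_of_isCrystal_of_isRed' i j hne hne'
  simp only [Set.mem_insert_iff, Set.mem_singleton_iff, Prod.mk.injEq] at hmem
  rcases hmem with h' | h' | h' | h' | h' | h' | h' | h' | h' | h' | h' <;>
    obtain ⟨hij, hji⟩ := h' <;> rw [hij, hji] at hswap <;> rw [hij] at h₀ ⊢ <;> first
    | rfl
    | exact absurd rfl h₀
    | (push_cast at hswap; linarith)

variable [R.IsIrreducible]

lemma one_le_lengthRatio [Nonempty ι] : 1 ≤ R.lengthRatio := by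
  obtain ⟨i, hi⟩ := Finite.exists_max R.normSq
  obtain ⟨j, hj⟩ := Finite.exists_min R.normSq
  refine Nat.one_le_iff_ne_zero.2 fun h₀ => (normSq_pos (R := R) i).ne' ?_
  rw [R.normSq_eq_lengthRatio_mul hi hj, h₀, Nat.cast_zero, zero_mul]

lemma natAbs_pairingIn_eq_one_or_eq_lengthRatio {i j : ι} (hi : R.IsLong i)
    (hne : R.root j ≠ R.root i) (hne' : R.root j ≠ -R.root i) (h₀ : R.pairingIn ℤ i j ≠ 0) :
    (R.pairingIn ℤ i j).natAbs = 1 ∨ (R.pairingIn ℤ i j).natAbs = R.lengthRatio := by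
  have hone := natAbs_pairingIn_eq_one_of_normSq_le (hi j) hne hne'
    (mt R.pairingIn_eq_zero_iff.1 h₀)
  by_cases heq : R.normSq j = R.normSq i
  · have hswap := pairingIn_eq_mul_of_normSq_eq (i := i) (j := j) (m := 1)
      (by rw [heq, Nat.cast_one, one_mul])
    rw [Nat.cast_one, one_mul] at hswap
    exact Or.inl (hswap ▸ hone)
  · have hj : R.IsShort j := fun k => by
      rcases R.toInvariantForm.apply_eq_or_of_apply_ne heq k with h | h
      · exact h.ge
      · exact (hi j).trans h.ge
    rw [pairingIn_eq_mul_of_normSq_eq (R.normSq_eq_lengthRatio_mul hi hj), Int.natAbs_mul, hone,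
      mul_one]
    exact Or.inr (Int.natAbs_natCast _)

end RootLengths

section GcdConditionLength

variable {ι M N : Type*} [Fintype ι] [AddCommGroup M] [Module ℝ M] [AddCommGroup N] [Module ℝ N]
  {R : RootPairing ι ℝ M N} [R.IsRootSystem] [R.IsCrystallographic] [R.IsReduced]
  {b : R.Base} {α : b.support} {c d e : ℕ}

lemma int_gcd_mul_natCast (n : ℤ) (c e : ℕ) : Int.gcd (n * c) e = Nat.gcd (n.natAbs * c) e := by
  rw [Int.gcd, Int.natAbs_mul, Int.natAbs_natCast, Int.natAbs_natCast]

lemma gcdCondition_of_isShort (hα : R.IsShort α) (hce : Nat.gcd c e = d) :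
    GcdCondition b α c e d := by
  refine ⟨hce, fun w i hi hi' h₀ => ?_⟩
  rw [← root_weylGroupToPerm] at hi hi'
  rw [int_gcd_mul_natCast, natAbs_pairingIn_eq_one_of_normSq_le
    ((normSq_weylGroupToPerm w α).trans_le (hα i)) hi.symm (by rwa [Ne, eq_neg_iff_add_eq_zero,
      add_comm, ← eq_neg_iff_add_eq_zero]) h₀, one_mul, hce]

lemma gcdCondition_of_isLong [R.IsIrreducible] (hα : R.IsLong α) (hce : Nat.gcd c e = d)
    (hmce : Nat.gcd (R.lengthRatio * c) e = d) : GcdCondition b α c e d := by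
  refine ⟨hce, fun w i hi hi' h₀ => ?_⟩
  rw [← root_weylGroupToPerm] at hi hi'
  have hlong : R.IsLong (R.weylGroupToPerm w α) := fun j =>
    (hα j).trans_eq (normSq_weylGroupToPerm w α).symm
  rcases natAbs_pairingIn_eq_one_or_eq_lengthRatio hlong hi hi' h₀ with h | h <;>
    rw [int_gcd_mul_natCast, h]
  · rwa [one_mul]
  · exact hmce

end GcdConditionLength

section CartanMatrixG₂

variable {ι M N : Type*} [Finite ι] [AddCommGroup M] [Module ℝ M] [AddCommGroup N] [Module ℝ N]
  {R : RootPairing ι ℝ M N} [R.IsCrystallographic] [R.IsReduced] [R.IsIrreducible]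
  {b : R.Base} {β δ : b.support}

lemma exists_equiv_fin_two {τ : Type*} [Fintype τ] {x y : τ} (hτ : Fintype.card τ = 2)
    (hxy : x ≠ y) : ∃ f : τ ≃ Fin 2, f.symm 0 = x ∧ f.symm 1 = y := by
  have hbij : Function.Bijective ![x, y] := by
    rw [Fintype.bijective_iff_injective_and_card, hτ, Fintype.card_fin]
    exact ⟨by simpa [Function.Injective, Fin.forall_fin_two] using ⟨hxy, hxy.symm⟩, rfl⟩
  exact ⟨(Equiv.ofBijective _ hbij).symm, rfl, rfl⟩

lemma hasCartanMatrix_G₂ (h : R.pairingIn ℤ β δ = -3) : b.HasCartanMatrix CartanMatrix.G₂ := by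
  have : R.IsG2 := ⟨⟨β, δ, h⟩⟩
  have h' : R.pairingIn ℤ δ β = -1 := by
    have hmem := R.pairingIn_pairingIn_mem_set_of_isCrystal_of_isRed β δ
    simp only [h, Set.mem_insert_iff, Set.mem_singleton_iff, Prod.mk.injEq] at hmem
    omega
  have hne : β ≠ δ := by
    rintro rfl
    omega
  obtain ⟨f, hβ, hδ⟩ := exists_equiv_fin_two
    ((Fintype.card_coe _).trans (IsG2.card_base_support_eq_two b)) hne
  refine ⟨f, ?_⟩
  ext i j
  rw [Matrix.reindex_apply, Matrix.submatrix_apply]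
  fin_cases i <;> fin_cases j
  · exact b.cartanMatrix_apply_same _
  · rw [← hβ, ← hδ] at h
    exact h
  · rw [← hβ, ← hδ] at h'
    exact h'
  · exact b.cartanMatrix_apply_same _

end CartanMatrixG₂

section RankTwoPairings

variable {ι M N : Type*} [AddCommGroup M] [Module ℝ M] [AddCommGroup N] [Module ℝ N]
  {R : RootPairing ι ℝ M N} [R.IsRootSystem] {b : R.Base} {α β δ : b.support}

lemma coord_root_reflectionPerm_of_ne (h : α ≠ β) (i : ι) :
    coord b α (R.root (R.reflectionPerm β i)) = coord b α (R.root i) := by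
  rw [← weylGroupToPerm_ofIdx, root_weylGroupToPerm, coord_ofIdx_smul_of_ne b h]

variable [R.IsCrystallographic] [Fintype ι]

lemma abs_pairingIn_le_one_of_coord_ne_zero (hβ : α ≠ β) {γ : ι} (hγ : coord b α (R.root γ) ≠ 0)
    (hN : R.normSq γ = R.normSq β) : |R.pairingIn ℤ γ β| ≤ 1 := by
  have hroot := root_ne_and_ne_neg_of_coord_ne_zero hβ hγ
  exact abs_pairingIn_le_one_of_normSq_eq hN hroot.1.symm fun h => hroot.2 (by rw [h, neg_neg])

section

variable {γ : ι} (hβδ : R.pairingIn ℤ β δ = -2)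
  (hβ : α ≠ β) (hδ : α ≠ δ) (hγ : coord b α (R.root γ) ≠ 0)
  (hγβ : R.pairingIn ℤ γ β ≤ 0) (hγδ : R.pairingIn ℤ γ δ ≤ 0)
  (hneg : R.pairingIn ℤ γ β < 0 ∨ R.pairingIn ℤ γ δ < 0)
include hβδ hβ hδ hγ hγβ hγδ hneg

lemma pairingIn_eq_of_normSq_eq_left (hδβ : R.pairingIn ℤ δ β = -1) (hN : R.normSq γ = R.normSq β) :
    R.pairingIn ℤ γ β = -1 ∧ R.pairingIn ℤ γ δ = 0 := by
  have heven := pairingIn_eq_mul_of_normSq_eq (m := 2)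
    (hN.trans (by exact_mod_cast normSq_eq_two_mul_of_pairingIn hβδ hδβ) :
      R.normSq γ = (2 : ℕ) * R.normSq δ)
  have hle := abs_pairingIn_le_one_of_coord_ne_zero hβ (γ := R.reflectionPerm δ γ)
    (by rwa [coord_root_reflectionPerm_of_ne hδ]) (by rw [normSq_reflectionPerm, hN])
  rw [pairingIn_reflectionPerm_eq_sub, hδβ, abs_le] at hle
  push_cast at heven
  omega

lemma pairingIn_eq_of_normSq_eq_right (hN : R.normSq γ = R.normSq δ) :
    R.pairingIn ℤ γ β = 0 ∧ R.pairingIn ℤ γ δ = -1 := by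
  have hle := abs_pairingIn_le_one_of_coord_ne_zero hδ (γ := R.reflectionPerm β γ)
    (by rwa [coord_root_reflectionPerm_of_ne hβ]) (by rw [normSq_reflectionPerm, hN])
  rw [pairingIn_reflectionPerm_eq_sub, hβδ, abs_le] at hle
  omega

end

end RankTwoPairings

section RankTwoFibre

variable {ι M N : Type*} [AddCommGroup M] [Module ℝ M] [AddCommGroup N] [Module ℝ N]
  {R : RootPairing ι ℝ M N}

lemma weightCoeffHom_pos {i : ι} {x : R.weightLattice} (h : 0 < R.coroot' i (x : M)) :
    0 < weightCoeffHom R i x := by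
  rwa [← weightCoeffHom_cast, Int.cast_pos] at h

variable [R.IsRootSystem] [R.IsCrystallographic] {b : R.Base} {d e : ℕ}

variable (b) in
/-- The terms of the orbit sum of `x` which agree with `u x` outside of the coordinates in `{β, δ}`
form an orbit of the rank two group generated by the reflections in `β` and `δ`, and the
coefficients of `u x` at `β` and `δ` are positive and have the divisibility properties modulo `e`
which rule out that the antisymmetric sum over this orbit vanishes. -/
structure IsRankTwoFibre (β δ : b.support) (e d : ℕ) (x : R.weightLattice)
    (u : R.weylGroup) : Prop where
  pos_left : 0 < weightCoeffHom R β (R.weylAct u x)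
  pos_right : 0 < weightCoeffHom R δ (R.weylAct u x)
  mul_inv_mem : ∀ v : R.weylGroup, (∀ i ∉ ({β, δ} : Set b.support),
    coord b i (v • (x : M)) = coord b i (u • (x : M))) → v * u⁻¹ ∈ parabolic b {β, δ}
  gcd_eq : ((e : ℤ) ∣ weightCoeffHom R δ (R.weylAct u x) ∧
      Int.gcd (2 * weightCoeffHom R β (R.weylAct u x)) e = d) ∨
    ((e : ℤ) ∣ weightCoeffHom R β (R.weylAct u x) ∧
      Int.gcd (weightCoeffHom R δ (R.weylAct u x)) e = d)

variable [Finite ι] [R.IsReduced] {α β δ : b.support}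

lemma IsAdapted.isRankTwoFibre {K : Set b.support} {u : R.weylGroup} (hu : IsAdapted b K u)
    (hβ : β ∉ K) (hδ : δ ∉ K) {x : R.weightLattice} (hx : StrictlyDominant b (x : M))
    (hgcd : ((e : ℤ) ∣ weightCoeffHom R δ (R.weylAct u x) ∧
        Int.gcd (2 * weightCoeffHom R β (R.weylAct u x)) e = d) ∨
      ((e : ℤ) ∣ weightCoeffHom R β (R.weylAct u x) ∧
        Int.gcd (weightCoeffHom R δ (R.weylAct u x)) e = d)) : IsRankTwoFibre b β δ e d x u where
  pos_left := weightCoeffHom_pos (hu.pos _ hx β hβ)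
  pos_right := weightCoeffHom_pos (hu.pos _ hx δ hδ)
  mul_inv_mem _ hv := hu.mul_inv_mem_parabolic
    (Set.disjoint_insert_right.2 ⟨hβ, Set.disjoint_singleton_right.2 hδ⟩) hx hv
  gcd_eq := hgcd

namespace AdmissibleShift

variable {μ : R.weightLattice} {c : ℕ} (h : AdmissibleShift b α μ c e d)
include h

lemma isRankTwoFibre_one_left (hβδ : R.pairingIn ℤ α δ = -2) (hne : α ≠ δ) :
    IsRankTwoFibre b α δ e d (μ + c • b.fundamentalWeight α) 1 := by
  refine IsAdapted.empty_one.isRankTwoFibre (Set.notMem_empty _) (Set.notMem_empty _)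
    h.strictlyDominant_add (Or.inl ⟨h.dvd_weightCoeffHom ?_, ?_⟩)
  · rw [one_smul, coroot'_fundamentalWeight_of_ne b hne]
  · have hmod := (h.weightCoeffHom_modEq (w := 1) (i := α) (n := 1) (by
      rw [one_smul, coroot'_fundamentalWeight_self b, Int.cast_one])).mul_left 2
    have hperm : R.weylGroupToPerm 1 α = α := by rw [map_one, Equiv.Perm.one_apply]
    have hgcd := h.gcdCondition.gcd_pairingIn_mul_eq (w := 1) hne
      (by rw [one_smul, coord_root_self]) (by rw [hperm, hβδ]; decide)
    rwa [hperm, hβδ, neg_mul, Int.neg_gcd, ← one_mul (c : ℤ), ← gcd_eq_gcd_of_modEq hmod] at hgcd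

lemma isRankTwoFibre_one_right (hne : α ≠ β) :
    IsRankTwoFibre b β α e d (μ + c • b.fundamentalWeight α) 1 := by
  refine IsAdapted.empty_one.isRankTwoFibre (Set.notMem_empty _) (Set.notMem_empty _)
    h.strictlyDominant_add (Or.inr ⟨h.dvd_weightCoeffHom ?_, ?_⟩)
  · rw [one_smul, coroot'_fundamentalWeight_of_ne b hne]
  · rw [weylAct_one, h.gcd_weightCoeffHom_self]

section

variable {K : Set b.support} {u w : R.weylGroup} (hu : IsLowering b α K u w)
  (hβK : β ∉ K) (hδK : δ ∉ K) (hβ : α ≠ β) (hδ : α ≠ δ)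
include hu hβK hδK hβ hδ

lemma isRankTwoFibre_of_isLowering_left (hβδ : R.pairingIn ℤ β δ = -2)
    (hγβ : R.pairingIn ℤ (R.weylGroupToPerm w α) β = -1)
    (hγδ : R.pairingIn ℤ (R.weylGroupToPerm w α) δ = 0) :
    IsRankTwoFibre b β δ e d (μ + c • b.fundamentalWeight α) u := by
  have hmod := h.weightCoeffHom_modEq_of_smul_eq_sub hu.smul_fundamentalWeight hβ
  have hmod' := h.weightCoeffHom_modEq_of_smul_eq_sub hu.smul_fundamentalWeight hδ
  rw [hγβ, neg_mul, one_mul, neg_neg] at hmod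
  rw [hγδ, zero_mul, neg_zero] at hmod'
  have hpair : R.pairingIn ℤ (R.weylGroupToPerm (ofIdx R β * w) α) δ = -2 := by
    rw [map_mul, Equiv.Perm.mul_apply, weylGroupToPerm_ofIdx, pairingIn_reflectionPerm_eq_sub,
      hγβ, hγδ, hβδ]
    rfl
  have hgcd := h.gcdCondition.gcd_pairingIn_mul_eq hδ (w := ofIdx R β * w)
    (by rw [mul_smul, coord_ofIdx_smul_of_ne b hβ, hu.coord_root_self]) (by rw [hpair]; decide)
  rw [hpair, neg_mul, Int.neg_gcd, ← gcd_eq_gcd_of_modEq (hmod.mul_left 2)] at hgcd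
  exact hu.isAdapted.isRankTwoFibre hβK hδK h.strictlyDominant_add
    (Or.inl ⟨Int.modEq_zero_iff_dvd.1 hmod', hgcd⟩)

lemma isRankTwoFibre_of_isLowering_right
    (hγβ : R.pairingIn ℤ (R.weylGroupToPerm w α) β = 0)
    (hγδ : R.pairingIn ℤ (R.weylGroupToPerm w α) δ = -1) :
    IsRankTwoFibre b β δ e d (μ + c • b.fundamentalWeight α) u := by
  have hmod := h.weightCoeffHom_modEq_of_smul_eq_sub hu.smul_fundamentalWeight hβ
  rw [hγβ, zero_mul, neg_zero] at hmod
  exact hu.isAdapted.isRankTwoFibre hβK hδK h.strictlyDominant_add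
    (Or.inr ⟨Int.modEq_zero_iff_dvd.1 hmod, h.gcd_weightCoeffHom_of_smul_eq_sub
      hu.smul_fundamentalWeight hδ hu.coord_root_self (by rw [hγδ]; decide)⟩)

end

lemma exists_isRankTwoFibre [R.IsIrreducible] (hβδ : R.pairingIn ℤ β δ = -2)
    (hδβ : R.pairingIn ℤ δ β = -1) :
    ∃ u, IsRankTwoFibre b β δ e d (μ + c • b.fundamentalWeight α) u := by
  have := Fintype.ofFinite ι
  have hne : β ≠ δ := by
    rintro rfl
    omega
  by_cases hβ : α = β
  · subst hβ
    exact ⟨1, h.isRankTwoFibre_one_left hβδ hne⟩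
  by_cases hδ : α = δ
  · subst hδ
    exact ⟨1, h.isRankTwoFibre_one_right hne.symm⟩
  obtain ⟨K, u, w, hu, hKJ, i, hiJ, hneg⟩ := exists_isLowering (b := b) (α := α)
    (J := {β, δ}) (Set.insert_nonempty _ _)
    (by rw [Set.mem_insert_iff, Set.mem_singleton_iff]; tauto)
  obtain ⟨hβK, hδK⟩ : β ∉ K ∧ δ ∉ K := by
    rwa [Set.disjoint_insert_right, Set.disjoint_singleton_right] at hKJ
  have hγβ := hu.coroot'_nonpos hβK
  have hγδ := hu.coroot'_nonpos hδK
  rw [coroot'_smul_root, Int.cast_nonpos] at hγβ hγδ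
  rw [coroot'_smul_root, Int.cast_lt_zero] at hneg
  have hγneg : R.pairingIn ℤ (R.weylGroupToPerm w α) β < 0 ∨
      R.pairingIn ℤ (R.weylGroupToPerm w α) δ < 0 := by
    rcases hiJ with rfl | rfl
    exacts [Or.inl hneg, Or.inr hneg]
  have hγ : coord b α (R.root (R.weylGroupToPerm w α)) ≠ 0 := by
    rw [root_weylGroupToPerm, hu.coord_root_self]
    exact one_ne_zero
  have hlength := normSq_eq_two_mul_of_pairingIn hβδ hδβ
  have hlength_ne : R.normSq β ≠ R.normSq δ := by
    linarith [normSq_pos (R := R) δ]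
  rcases R.toInvariantForm.apply_eq_or_of_apply_ne hlength_ne (R.weylGroupToPerm w α) with hN | hN
  · obtain ⟨hγβ, hγδ⟩ :=
      pairingIn_eq_of_normSq_eq_left hβδ hβ hδ hγ hγβ hγδ hγneg hδβ hN
    exact ⟨u, h.isRankTwoFibre_of_isLowering_left hu hβK hδK hβ hδ hβδ hγβ hγδ⟩
  · obtain ⟨hγβ, hγδ⟩ := pairingIn_eq_of_normSq_eq_right hβδ hβ hδ hγ hγβ hγδ hγneg hN
    exact ⟨u, h.isRankTwoFibre_of_isLowering_right hu hβK hδK hβ hδ hγβ hγδ⟩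

end AdmissibleShift

end RankTwoFibre

section AdjacentRoots

variable {ι M N : Type*} [AddCommGroup M] [Module ℝ M] [AddCommGroup N] [Module ℝ N]
  {R : RootPairing ι ℝ M N}

lemma exists_weylGroupToPerm_eq {i j : ι} (h : R.pairing i j = -1) (h' : R.pairing j i = -1) :
    ∃ w : R.weylGroup, R.weylGroupToPerm w i = j := by
  refine ⟨ofIdx R i * ofIdx R j, R.root.injective ?_⟩
  rw [root_weylGroupToPerm, mul_smul, ofIdx_smul, ofIdx_smul]
  simp only [map_sub, map_smul, R.root_coroot'_eq_pairing, R.pairing_same, h, h', smul_eq_mul]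
  module

variable [R.IsCrystallographic]

lemma pairing_eq_intCast {i j : ι} {n : ℤ} (h : R.pairingIn ℤ i j = n) :
    R.pairing i j = n := by
  rw [← R.algebraMap_pairingIn ℤ, h]
  rfl

variable [Finite ι] [R.IsReduced] [R.IsIrreducible] {b : R.Base}

lemma exists_pairingIn_ne_zero {p : b.support → Prop} {i j : b.support} (hi : p i) (hj : ¬ p j) :
    ∃ β δ : b.support, p β ∧ ¬ p δ ∧ R.pairingIn ℤ δ β ≠ 0 := by
  by_contra! h
  exact hj <| b.induction_on_cartanMatrix p hi fun β δ hβ hne =>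
    not_not.1 fun hδ => hne (h β δ hβ hδ)

lemma pairingIn_eq_neg_one_or [R.IsRootSystem] (hG₂ : ¬ b.HasCartanMatrix CartanMatrix.G₂)
    {β δ : b.support} (hne : β ≠ δ) (h₀ : R.pairingIn ℤ β δ ≠ 0) :
    (R.pairingIn ℤ β δ = -1 ∧ R.pairingIn ℤ δ β = -1) ∨
    (R.pairingIn ℤ β δ = -2 ∧ R.pairingIn ℤ δ β = -1) ∨
    (R.pairingIn ℤ β δ = -1 ∧ R.pairingIn ℤ δ β = -2) := by
  have hle := b.pairingIn_le_zero_of_ne (Subtype.coe_ne_coe.2 hne) β.2 δ.2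
  have hroot := root_ne_and_ne_neg_of_coord_ne_zero hne (x := R.root β)
    (by rw [coord_root_self b]; exact one_ne_zero)
  have hmem := R.pairingIn_pairingIn_mem_set_of_isCrystal_of_isRed' β δ hroot.1.symm
    fun h => hroot.2 (by rw [h, neg_neg])
  simp only [Set.mem_insert_iff, Set.mem_singleton_iff, Prod.mk.injEq] at hmem
  have hβδ : R.pairingIn ℤ β δ ≠ -3 := fun h => hG₂ (hasCartanMatrix_G₂ h)
  have hδβ : R.pairingIn ℤ δ β ≠ -3 := fun h => hG₂ (hasCartanMatrix_G₂ h)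
  omega

end AdjacentRoots

section Contradiction

variable {ι M N A : Type*} [AddCommGroup M] [Module ℝ M] [AddCommGroup N] [Module ℝ N]
  {R : RootPairing ι ℝ M N} {b : R.Base} {α β δ : b.support} {μ : R.weightLattice}
  {c d e : ℕ} [CommRing A] {F₁ F₂ X Y : AddMonoidAlgebra A R.weightLattice}

lemma antisymmPow_add_two_mul {B : Type*} [CommRing B] {z : Bˣ} {e k : ℤ} (hz : z ^ (2 * e) = 1)
    (h : e ∣ k) (n : ℤ) : antisymmPow z (n + 2 * k) = antisymmPow z n := by
  have hk : z ^ (2 * k) = 1 := by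
    obtain ⟨m, rfl⟩ := h
    rw [← mul_assoc, zpow_mul, hz, one_zpow]
  rw [antisymmPow, antisymmPow, neg_add, zpow_add, zpow_add, zpow_neg z (2 * k), hk, inv_one,
    mul_one, mul_one]

variable [R.IsCrystallographic] [R.IsRootSystem]
  {K : Type*} [Field K] [CharZero K] [Algebra A K] {z : Kˣ}

lemma IsRankTwoFibre.mul_antisymmPow_ne {x : R.weightLattice} {u : R.weylGroup}
    (h : IsRankTwoFibre b β δ e d x u) (hz : z ^ (2 * (e : ℤ)) = 1) (hzd : antisymmPow z d ≠ 0)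
    {p r : ℤ} (hp : weightCoeffHom R δ (R.weylAct u x) = p)
    (hr : weightCoeffHom R β (R.weylAct u x) = r) :
    (p : K) * antisymmPow z (p + 2 * r) ≠ (p + 2 * r : ℤ) * antisymmPow z p := by
  have hr₀ := hr ▸ h.pos_left
  have hp₀ := hp ▸ h.pos_right
  rcases hp ▸ hr ▸ h.gcd_eq with ⟨hdvd, hgcd⟩ | ⟨hdvd, hgcd⟩
  · have hmod : p + 2 * r ≡ 2 * r [ZMOD e] := by
      simpa only [zero_add] using (Int.modEq_zero_iff_dvd.2 hdvd).add_right (2 * r)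
    rw [antisymmPow_eq_zero_of_dvd hz hdvd, mul_zero]
    exact mul_ne_zero (Int.cast_ne_zero.2 hp₀.ne') (antisymmPow_ne_zero_of_gcd_eq hz hzd
      (by rw [gcd_eq_gcd_of_modEq hmod, hgcd]))
  · rw [antisymmPow_add_two_mul hz hdvd]
    have hp_ne := antisymmPow_ne_zero_of_gcd_eq hz hzd (congrArg Nat.cast hgcd)
    rw [Ne, mul_left_inj' hp_ne, Int.cast_inj]
    omega

variable [Finite ι]

lemma AdmissibleShift.not_isC_of_vanishesAt [R.IsReduced] [R.IsIrreducible]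
    (h : AdmissibleShift b α μ c e d)
    (hβδ : R.pairingIn ℤ β δ = -2) (hδβ : R.pairingIn ℤ δ β = -1) (hz : z ^ (2 * (e : ℤ)) = 1)
    (hzd : antisymmPow z d ≠ 0) (h₁ : VanishesAt R β z F₁) (h₂ : VanishesAt R δ z F₂)
    (hinv : F₂ ∈ R.weylInvariants A) :
    ¬ b.IsC (F₁ * X + F₂ * Y) (μ + c • b.fundamentalWeight α) d := fun hC => by
  obtain ⟨u, hu⟩ := h.exists_isRankTwoFibre hβδ hδβ
  exact hu.mul_antisymmPow_ne hz hzd rfl rfl <|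
    mul_antisymmPow_eq (by exact_mod_cast pairing_eq_intCast hβδ)
      (by exact_mod_cast pairing_eq_intCast hδβ) h₁ h₂ hinv hC hu.mul_inv_mem rfl rfl hu.pos_right
      hu.pos_left

variable {U V : R.weylInvariants A}

lemma isUnit_of_forall_weightCoeffHom_eq_zero
    {y : R.weightLattice} (h : IsLeading b α (U : AddMonoidAlgebra A R.weightLattice) y)
    (hU : IsUnit ((U : AddMonoidAlgebra A R.weightLattice).coeff y))
    (hy : ∀ β : b.support, weightCoeffHom R β y = 0) : IsUnit U := by
  obtain rfl : y = 0 := Subtype.ext <| eq_zero_of_coroot'_eq_zero b fun β => by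
    rw [← weightCoeffHom_cast, hy β, Int.cast_zero]
  exact isUnit_of_isLeading_zero h hU

namespace CoprimeFactorization

variable [R.IsReduced] [R.IsIrreducible] [IsDomain A] [FaithfulSMul A K] [IsAlgClosed K]
  (h : CoprimeFactorization b α μ c e d (U : AddMonoidAlgebra A R.weightLattice) V)
  (hU : ¬ IsUnit U) (hV : ¬ IsUnit V)
include h hU hV

lemma exists_adjacent_vanishesAt (hz : z ^ (2 * (e : ℤ)) = 1) (hzd : antisymmPow z d ≠ 0) :
    ∃ β δ : b.support, R.pairingIn ℤ δ β ≠ 0 ∧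
      VanishesAt R β z (V : AddMonoidAlgebra A R.weightLattice) ∧
      ¬ VanishesAt R β z (U : AddMonoidAlgebra A R.weightLattice) ∧
      VanishesAt R δ z (U : AddMonoidAlgebra A R.weightLattice) := by
  obtain ⟨y, y', hlead⟩ :=
    exists_leadingFactorization α h.shift.d_pos h.shift.dominantRegular h.isC
  have hdich (β : b.support) := (h.vanishesAt_dichotomy (K := K) hlead β).imp
    (And.imp_right fun H => H z hz hzd) (And.imp_right fun H => H z hz hzd)
  obtain ⟨δ, hδ⟩ : ∃ δ : b.support,
      ¬ VanishesAt R δ z (V : AddMonoidAlgebra A R.weightLattice) := by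
    by_contra! hall
    exact hU <| isUnit_of_forall_weightCoeffHom_eq_zero hlead.left (IsUnit.of_mul_eq_one _
      hlead.coeff_mul_coeff) fun β => ((hdich β).resolve_right fun H => H.2.2 (hall β)).1
  obtain ⟨β, hβ⟩ : ∃ β : b.support,
      VanishesAt R β z (V : AddMonoidAlgebra A R.weightLattice) := by
    by_contra! hall
    exact hV <| isUnit_of_forall_weightCoeffHom_eq_zero hlead.right
      (IsUnit.of_mul_eq_one _ hlead.symm.coeff_mul_coeff)
      fun β => ((hdich β).resolve_left fun H => hall β H.2.1).1
  obtain ⟨β, δ, hβ, hδ, hne⟩ :=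
    exists_pairingIn_ne_zero (p := fun β : b.support =>
      VanishesAt R β z (V : AddMonoidAlgebra A R.weightLattice)) hβ hδ
  exact ⟨β, δ, hne, hβ, ((hdich β).resolve_right fun H => H.2.2 hβ).2.2,
    ((hdich δ).resolve_left fun H => hδ H.2.1).2.1⟩

end CoprimeFactorization

variable (K) in
lemma CoprimeFactorization.isUnit_or_isUnit [R.IsReduced] [R.IsIrreducible] [IsDomain A]
    [FaithfulSMul A K] [IsAlgClosed K] (hG₂ : ¬ b.HasCartanMatrix CartanMatrix.G₂)
    (h : CoprimeFactorization b α μ c e d (U : AddMonoidAlgebra A R.weightLattice) V)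
    (hde : d ∣ e) (hne : e ≠ d) : IsUnit U ∨ IsUnit V := by
  by_contra! hunit
  obtain ⟨z, hz, hzd⟩ := exists_zpow_eq_one_of_dvd (K := K) hde hne h.shift.e_pos
  obtain ⟨β, δ, h₀, hβV, hβU, hδU⟩ := h.exists_adjacent_vanishesAt hunit.1 hunit.2 hz hzd
  obtain ⟨X, Y, hXY⟩ := h.exists_isC_add
  have hδβ : δ ≠ β := by
    rintro rfl
    exact hβU hδU
  rcases pairingIn_eq_neg_one_or hG₂ hδβ h₀ with ⟨h₁, h₂⟩ | ⟨h₁, h₂⟩ | ⟨h₁, h₂⟩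
  · obtain ⟨w, hw⟩ := exists_weylGroupToPerm_eq (R := R) (i := δ) (j := β)
      (by exact_mod_cast pairing_eq_intCast h₁) (by exact_mod_cast pairing_eq_intCast h₂)
    exact hβU (hw ▸ hδU.weylGroupToPerm U.2 w)
  · exact h.shift.not_isC_of_vanishesAt h₁ h₂ hz hzd hδU hβV V.2 hXY
  · rw [add_comm] at hXY
    exact h.shift.not_isC_of_vanishesAt h₂ h₁ hz hzd hβV hδU U.2 hXY

end Contradiction

section Divisibility

lemma exists_unit_zpow_eq_one_iff_dvd (A : Type*) [CommRing A] [Nontrivial A] (n : ℕ) :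
    ∃ z : (MonoidAlgebra A (Multiplicative (ZMod n)))ˣ, ∀ k : ℤ, z ^ k = 1 ↔ (n : ℤ) ∣ k := by
  refine ⟨Units.map (MonoidAlgebra.of A _) (toUnits (.ofAdd 1)), fun k => ?_⟩
  rw [← map_zpow, ← map_zpow, map_eq_one_iff _ (Units.map_injective MonoidAlgebra.of_injective),
    map_eq_one_iff _ toUnits.injective, ← ofAdd_zsmul, ofAdd_eq_one, zsmul_one,
    CharP.intCast_eq_zero_iff (ZMod n) n]

lemma gcd_eq_of_gcd_le {c d e : ℕ} (he : 0 < e) (hde : d ∣ e) (hdc : d ∣ c)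
    (h : Nat.gcd e c ≤ d) : Nat.gcd c e = d := by
  rw [Nat.gcd_comm]
  exact h.antisymm (Nat.le_of_dvd (Nat.gcd_pos_of_pos_left c he) (Nat.dvd_gcd hde hdc))

variable {ι M N A : Type*} [Finite ι] [AddCommGroup M] [Module ℝ M] [AddCommGroup N] [Module ℝ N]
  {R : RootPairing ι ℝ M N} [R.IsRootSystem] [R.IsCrystallographic] [R.IsReduced] {b : R.Base}
  {x : R.weightLattice} {d : ℕ} [CommRing A] [Nontrivial A]

lemma dvd_weightCoeffHom_of_isC {F : AddMonoidAlgebra A R.weightLattice} (hx : b.DominantRegular x)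
    (h : b.IsC F x d) (β : b.support) : (d : ℤ) ∣ weightCoeffHom R β x := by
  obtain ⟨z, hz⟩ := exists_unit_zpow_eq_one_iff_dvd A (2 * d)
  have hρ (i : ι) (hi : i ∈ b.support) : (d : ℤ) ∣ R.weightCoeff i (d • b.rho) := by
    rw [← weightCoeffHom_apply, weightCoeffHom_nsmul_rho b ⟨i, hi⟩]
  have hzero : leadingValue b β β z (R.schurWeyl A x) x = 0 := by
    rw [leadingValue, ← show _ = _ from h, map_mul, twist_schurWeyl_eq_zero_of_dvd hρ _ _
      ((hz _).2 (by push_cast; rfl)), mul_zero]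
    rfl
  rw [leadingValue_schurWeyl_self hx, antisymmPow_eq_zero_iff, hz] at hzero
  push_cast at hzero
  exact (mul_dvd_mul_iff_left two_ne_zero).1 hzero

lemma dvd_of_isC_add {α : b.support} {μ : R.weightLattice} {c : ℕ}
    {F : AddMonoidAlgebra A R.weightLattice} (hμ : b.DominantRegular μ)
    (hd : (d : ℤ) ∣ R.weightCoeff α μ) (h : b.IsC F (μ + c • b.fundamentalWeight α) d) :
    d ∣ c := by
  classical
  have hdvd := dvd_weightCoeffHom_of_isC (dominantRegular_add_nsmul_fundamentalWeight hμ α c) h α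
  rw [map_add, map_nsmul, weightCoeffHom_fundamentalWeight b, if_pos rfl, nsmul_one,
    weightCoeffHom_apply, dvd_add_right hd] at hdvd
  exact_mod_cast hdvd

end Divisibility

section PrimeBound

variable {ι M N : Type*} [Fintype ι] [AddCommGroup M] [Module ℝ M] [AddCommGroup N] [Module ℝ N]
  {R : RootPairing ι ℝ M N} [R.IsRootSystem] [R.IsCrystallographic] [R.IsReduced] [R.IsIrreducible]
  {b : R.Base} {μ : R.weightLattice}

lemma two_mul_weightCoeff_le_two_mul_lengthRatio_mul_sum (hμ : b.DominantRegular μ)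
    (β : b.support) :
    2 * R.weightCoeff β μ ≤ 2 * R.lengthRatio * ∑ β ∈ b.support, R.weightCoeff β μ := by
  have : Nonempty ι := ⟨β⟩
  have hratio : (1 : ℤ) ≤ R.lengthRatio := by exact_mod_cast one_le_lengthRatio (R := R)
  have hsum : R.weightCoeff β μ ≤ ∑ β ∈ b.support, R.weightCoeff β μ :=
    Finset.single_le_sum (fun i hi => (hμ i hi).le) β.2
  nlinarith [hμ β β.2]

end PrimeBound

end WeylCharacter

end

open WeylCharacter in
theorem proposition5_general {ι M N : Type*} [Fintype ι] [AddCommGroup M] [Module ℝ M]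
    [AddCommGroup N] [Module ℝ N] (R : RootPairing ι ℝ M N) [R.IsRootSystem]
    [R.IsCrystallographic] [R.IsReduced] [R.IsIrreducible] (b : R.Base)
    (hG₂ : ¬ b.HasCartanMatrix CartanMatrix.G₂)
    (μ : R.weightLattice) (hμ : b.DominantRegular μ) (α : b.support) (c : ℕ)
    (𝒪 : Type*) [CommRing 𝒪] [IsDomain 𝒪] [CharZero 𝒪]
    (h𝒪 : ∀ β : b.support, ∀ p : ℕ, p.Prime → (p : ℤ) ≤ 2 * R.weightCoeff β μ → ¬ IsUnit (p : 𝒪))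
    (d e : ℕ) (hde : d ∣ e) (hne : e ≠ d) (heμ : e ∣ b.weightGcd μ)
    (U V : R.weylInvariants 𝒪) (hU : ¬ IsUnit U) (hV : ¬ IsUnit V)
    (hUV : b.IsC (U * V : AddMonoidAlgebra 𝒪 R.weightLattice) μ d)
    (hVe : ∃ Z : AddMonoidAlgebra 𝒪 R.weightLattice,
      b.IsC ((V : AddMonoidAlgebra 𝒪 R.weightLattice) * Z) (e • b.rho) d)
    (X Y : AddMonoidAlgebra 𝒪 R.weightLattice)
    (hXY : b.IsC ((U : AddMonoidAlgebra 𝒪 R.weightLattice) * X +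
      (V : AddMonoidAlgebra 𝒪 R.weightLattice) * Y) (μ + c • b.fundamentalWeight α) d) :
    (R.IsShort α → d < Nat.gcd e c) ∧ (R.IsLong α → d < Nat.gcd e (R.lengthRatio * c)) := by
  have heμ (i : ι) (hi : i ∈ b.support) : (e : ℤ) ∣ R.weightCoeff i μ :=
    Int.natCast_dvd.2 (heμ.trans (Finset.gcd_dvd hi))
  have he : 0 < e := pos_of_dvd_weightCoeff hμ (heμ α α.2)
  have hdc : d ∣ c :=
    dvd_of_isC_add hμ ((Int.natCast_dvd_natCast.2 hde).trans (heμ α α.2)) hXY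
  let K := AlgebraicClosure (FractionRing 𝒪)
  have : FaithfulSMul 𝒪 K := FaithfulSMul.trans 𝒪 (FractionRing 𝒪) K
  have : CharZero K := charZero_of_injective_algebraMap (FaithfulSMul.algebraMap_injective 𝒪 K)
  have hgcd : ¬ GcdCondition b α c e d := fun h =>
    (CoprimeFactorization.isUnit_or_isUnit K hG₂
      ⟨⟨hμ, heμ, h⟩, U.2, V.2, hUV, hVe, ⟨X, Y, hXY⟩, h𝒪⟩ hde hne).elim hU hV
  constructor
  · intro hα
    by_contra! hle
    exact hgcd (gcdCondition_of_isShort hα (gcd_eq_of_gcd_le he hde hdc hle))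
  · intro hα
    by_contra! hle
    have hle' : Nat.gcd e c ≤ d := (Nat.le_of_dvd (Nat.gcd_pos_of_pos_left _ he)
      (Nat.gcd_dvd_gcd_mul_left_right e c R.lengthRatio)).trans hle
    exact hgcd (gcdCondition_of_isLong hα (gcd_eq_of_gcd_le he hde hdc hle')
      (gcd_eq_of_gcd_le he hde (hdc.mul_left _) hle))

theorem proposition5 {ι M N : Type*} [Fintype ι] [AddCommGroup M] [Module ℝ M]
    [AddCommGroup N] [Module ℝ N] (R : RootPairing ι ℝ M N) [R.IsRootSystem]
    [R.IsCrystallographic] [R.IsReduced] [R.IsIrreducible] (b : R.Base)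
    (hF₄ : ¬ b.HasCartanMatrix CartanMatrix.F₄) (hG₂ : ¬ b.HasCartanMatrix CartanMatrix.G₂)
    (μ η : R.weightLattice) (hμ : b.DominantRegular μ)
    (α : b.support) (hα : ¬ R.SimplyLaced → b.IsCorner α)
    (c : ℕ) (hc : 0 < c) (hη : η = μ + c • b.fundamentalWeight α)
    (𝒪 : Type*) [CommRing 𝒪] [IsDomain 𝒪] [CharZero 𝒪]
    (h𝒪 : ∀ p : ℕ, p.Prime → (p : ℤ) ≤ 2 * R.lengthRatio * ∑ β ∈ b.support, R.weightCoeff β μ →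
      ¬ IsUnit (p : 𝒪))
    (d e : ℕ) (hde : d ∣ e) (hne : e ≠ d) (heμ : e ∣ b.weightGcd μ)
    (U V : R.weylInvariants 𝒪) (hU : ¬ IsUnit U) (hV : ¬ IsUnit V)
    (hUV : b.IsC (U * V : AddMonoidAlgebra 𝒪 R.weightLattice) μ d)
    (hVe : ∃ Z : AddMonoidAlgebra 𝒪 R.weightLattice, b.IsC ((V : AddMonoidAlgebra 𝒪 R.weightLattice) * Z) (e • b.rho) d)
    (X Y : AddMonoidAlgebra 𝒪 R.weightLattice)
    (hXY : b.IsC ((U : AddMonoidAlgebra 𝒪 R.weightLattice) * X +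
      (V : AddMonoidAlgebra 𝒪 R.weightLattice) * Y) η d) :
    (R.SimplyLaced ∨ R.IsShort α → d < Nat.gcd e c) ∧
    (¬ R.SimplyLaced ∧ R.IsLong α → d < Nat.gcd e (R.lengthRatio * c)) := by
  subst hη
  have h := proposition5_general R b hG₂ μ hμ α c 𝒪
    (fun β p hp hle => h𝒪 p hp <|
      hle.trans (WeylCharacter.two_mul_weightCoeff_le_two_mul_lengthRatio_mul_sum hμ β))
    d e hde hne heμ U V hU hV hUV hVe X Y hXY
  exact ⟨fun hα => h.1 (hα.elim (fun hR j => (hR α j).le) id), fun hα => h.2 hα.2⟩
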